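/- **Theorem 3.1.** All logarithms are to base $2$, and $\{0,1\}$ is identified with $\mathbb F_2$. A degree-$d$ polynomial source on $\{0,1\}^\ell$ is a distribution of the form $P(\mathbf U^m)$, where $m$ is arbitrary, $\mathbf U^m$ is uniform on $\mathbb F_2^m$, and $P=(p_1,\dots,p_\ell)\colon\mathbb F_2^m\to\mathbb F_2^\ell$ consists of $\mathbb F_2$-polynomials of degree at most $d$. A function $\mathsf{Iso}\colon\{0,1\}^n\to\{0,1\}$ is an $(\alpha,\beta,k)$-isolator for a class $\mathcal X$ of distributions on $\{0,1\}^n$ if $\Pr[\mathsf{Iso}(\mathbf U^n)=1]\ge\alpha$ and every $\mathbf X\in\mathcal X$ satisfies $\Pr_{x\sim\mathbf X}[\Pr[\mathbf X=x]\le 2^{-k}\text{ and }\mathsf{Iso}(x)=1]\le\beta$. Total variation distance is denoted by $\|\cdot\|_{\mathrm{TV}}$. For positive integers $N,\Delta$ put $$\varepsilon(N,\Delta)=\frac{\Delta}{\log\log N}\,\log\!\left(\frac{\log\log N}{\Delta}\right).$$ There exist constants $\delta,C,c>0$ such that for all positive integers $N,\Delta$ with $\Delta\le\delta\log\log N$ there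 are positive integers $n,t,d$ with $(n+1)t\le N$, $n\ge(\log N)^c$ and $\Delta(t+1)\le d$, and functions $\mathsf{Iso},\widetilde{\mathsf{Iso}}\colon\{0,1\}^n\to\{0,1\}$, for which the following holds. 1. $\mathsf{Iso}$ is an $(\alpha,\beta,k)$-isolator for the class of degree-$d$ polynomial sources on $\{0,1\}^n$, for some $\alpha,\beta\in[0,1]$ and some integer $0<k<n$ with $$(1-\alpha)^{t+1}+(2t^3+1)\,2^{-(n-k)}+\beta\ \le\ C\,\varepsilon(N,\Delta).$$ 2. Let $\mathbf D=(\mathbf U_1,\dots,\mathbf U_t,\mathsf{Iso}(\mathbf U_1),\dots,\mathsf{Iso}(\mathbf U_t))$, where $\mathbf U_1,\dots,\mathbf U_t$ are independent copies of $\mathbf U^n$. Every degree-$\Delta$ polynomial source $\mathbf X$ on $\{0,1\}^{(n+1)t}$ satisfies $$\|\mathbf D-\mathbf X\|_{\mathrm{TV}}\ \ge\ 1-C\,\varepsilon(N,\Delta).$$ 3. $\widetilde{\mathsf{Iso}}$ is an $(\tilde\alpha,\tilde\beta,\tilde k)$-isolator for the class of degree-$d$ polynomial sources on $\{0,1\}^n$,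 for some $\tilde\alpha,\tilde\beta\in[0,1]$ and some integer $0<\tilde k<n$ with $(1-\tilde\alpha)^2+3\cdot2^{-(n-\tilde k)}+\tilde\beta\le\frac34+n^{-c}$. 4. Let $\widetilde{\mathbf D}=(\mathbf U^n,\widetilde{\mathsf{Iso}}(\mathbf U^n))$. Every degree-$\Delta$ polynomial source $\mathbf Y$ on $\{0,1\}^{n+1}$ satisfies $$\|\widetilde{\mathbf D}-\mathbf Y\|_{\mathrm{TV}}\ \ge\ \tfrac14-n^{-c}.$$ Moreover, these choices can be made so that $\mathbf D$ can be sampled in $\mathrm{poly}(N)$ time, and so can $\widetilde{\mathbf D}$: for each of the two there are a polynomial $q$ and a single Turing machine which, for all $N,\Delta$ as above, on input $1^N0\,1^\Delta0\,r$ with $r$ uniform on $\{0,1\}^{q(N)}$, halts after a number of steps polynomial in the length of its input and outputs a string distributed exactly as $\mathbf D$ (respectively $\widetilde{\mathbf D}$). -/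

import Mathlib

namespace HardDist

open Real

/-! Bit strings of length `n` are functions `Fin n → ZMod 2`; thus `{0,1}` is identified with the
field of two elements. All logarithms are to base 2. -/

/-- The uniform distribution `U^n` on `{0,1}^n`. -/
noncomputable def unif (n : ℕ) : PMF (Fin n → ZMod 2) :=
  PMF.uniformOfFintype (Fin n → ZMod 2)

/-- The probability of the event `E` under `μ`. -/
noncomputable def prob {α : Type} (μ : PMF α) (E : Set α) : ℝ :=
  (μ.toOuterMeasure E).toReal

/-- Total variation distance of two distributions on a finite set. -/
noncomputable def tvDist {α : Type} [Fintype α] (μ ν : PMF α) : ℝ :=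
  (1 / 2) * ∑ a, |(μ a).toReal - (ν a).toReal|

/-- The class of degree-`d` polynomial sources on `{0,1}^n`: the distributions `P(U^m)`, where `m`
is arbitrary and `P = (p_1, …, p_n)` consists of polynomials over the field of two elements in `m`
variables, each of degree at most `d`. -/
def polySources (n d : ℕ) : Set (PMF (Fin n → ZMod 2)) :=
  {X | ∃ (m : ℕ) (P : Fin n → MvPolynomial (Fin m) (ZMod 2)),
    (∀ i, (P i).totalDegree ≤ d) ∧
      X = (unif m).map (fun u i => MvPolynomial.eval u (P i))}

/-- The points that `X` hits with probability at most `2^{-k}`. -/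
def lightPoints {n : ℕ} (X : PMF (Fin n → ZMod 2)) (k : ℕ) : Set (Fin n → ZMod 2) :=
  {x | (X x).toReal ≤ ((2 : ℝ) ^ k)⁻¹}

/-- `(α, β, k)`-isolators for a class `𝒳` of distributions on `{0,1}^n`. -/
structure IsIsolator {n : ℕ} (α β : ℝ) (k : ℕ) (𝒳 : Set (PMF (Fin n → ZMod 2)))
    (Iso : (Fin n → ZMod 2) → ZMod 2) : Prop where
  mass_ge : α ≤ prob (unif n) {x | Iso x = 1}
  light_le : ∀ X ∈ 𝒳, prob X {x | x ∈ lightPoints X k ∧ Iso x = 1} ≤ β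

/-- `Iso` is an isolator for degree-`d` polynomial sources on `{0,1}^n`, with parameters
`α, β ∈ [0,1]` and `0 < k < n` such that
`(1 - α)^(t+1) + (2t³ + 1) 2^{-(n-k)} + β ≤ η`. -/
def IsSuitableIsolator {n : ℕ} (d t : ℕ) (η : ℝ) (Iso : (Fin n → ZMod 2) → ZMod 2) : Prop :=
  ∃ (α β : ℝ) (k : ℕ), 0 ≤ α ∧ α ≤ 1 ∧ 0 ≤ β ∧ β ≤ 1 ∧ 0 < k ∧ k < n ∧
    IsIsolator α β k (polySources n d) Iso ∧
    (1 - α) ^ (t + 1) + (2 * (t : ℝ) ^ 3 + 1) * ((2 : ℝ) ^ (n - k))⁻¹ + β ≤ η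

/-- The string `(u_1, …, u_t, Iso(u_1), …, Iso(u_t))` of length `t * n + t = (n + 1) t`: position
`j * n + i` with `j < t`, `i < n` holds bit `i` of `u_j`, and position `t * n + j` holds
`Iso(u_j)`. -/
def graphString {n : ℕ} (t : ℕ) (Iso : (Fin n → ZMod 2) → ZMod 2)
    (u : Fin t → Fin n → ZMod 2) : Fin (t * n + t) → ZMod 2 :=
  Fin.append (fun p : Fin (t * n) => u (finProdFinEquiv.symm p).1 (finProdFinEquiv.symm p).2)
    (fun j : Fin t => Iso (u j))

/-- The distribution `(U_1, …, U_t, Iso(U_1), …, Iso(U_t))` with `U_1, …, U_t` independent copies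
of `U^n` (that is, `(U_1, …, U_t)` is uniform on `({0,1}^n)^t`). For `t = 1` this is
`(U^n, Iso(U^n))`. -/
noncomputable def hardDist {n : ℕ} (t : ℕ) (Iso : (Fin n → ZMod 2) → ZMod 2) :
    PMF (Fin (t * n + t) → ZMod 2) :=
  (PMF.uniformOfFintype (Fin t → Fin n → ZMod 2)).map (graphString t Iso)

/-- `log log N`. -/
noncomputable def loglog (N : ℕ) : ℝ := logb 2 (logb 2 (N : ℝ))

/-- `(Δ / log log N) · log (log log N / Δ)`. -/
noncomputable def rate (N Δ : ℕ) : ℝ :=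
  (Δ : ℝ) / loglog N * logb 2 (loglog N / (Δ : ℝ))

/-- The pairs `(N, Δ)` of positive integers with `Δ ≤ δ log log N`. -/
def admissible (δ : ℝ) : Set (ℕ × ℕ) :=
  {p | 0 < p.1 ∧ 0 < p.2 ∧ (p.2 : ℝ) ≤ δ * loglog p.1}

/-- Inputs of a sampling algorithm for a family of distributions indexed by `S`: an index
`(N, Δ) ∈ S`, and `q(N)` coin flips. -/
structure SamplerInput (S : Set (ℕ × ℕ)) (q : Polynomial ℕ) where
  N : ℕ
  Δ : ℕ
  mem : (N, Δ) ∈ S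
  coins : Fin (q.eval N) → Bool

/-- The input tape `1^N 0 1^Δ 0 r`, where `r` is the string of coin flips. -/
def SamplerInput.encode {S : Set (ℕ × ℕ)} {q : Polynomial ℕ} (a : SamplerInput S q) : List Bool :=
  List.replicate a.N true ++ false :: (List.replicate a.Δ true ++ false :: List.ofFn a.coins)

/-- The output tape for a string. -/
def bits {n : ℕ} (x : Fin n → ZMod 2) : List Bool :=
  List.ofFn (fun i => decide (x i = 1))

/-- The family `D N Δ`, `(N, Δ) ∈ S`, of distributions on bit strings can be sampled in time
polynomial in `N + Δ`: for some polynomial `q`, one Turing machine (the same for the whole family)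
gets `N` and `Δ` in unary and `q(N)` uniformly random bits, runs for a number of steps that is
polynomial in the length of this input, and outputs a string with distribution exactly `D N Δ`.
When `Δ` is bounded by a polynomial in `N` for `(N, Δ) ∈ S`, this is time `poly(N)`. -/
def PolyTimeSamplable (S : Set (ℕ × ℕ)) {len : ℕ → ℕ → ℕ}
    (D : ∀ N Δ : ℕ, PMF (Fin (len N Δ) → ZMod 2)) : Prop :=
  ∃ (q : Polynomial ℕ) (f : SamplerInput S q → List Bool),
    Nonempty (Turing.TM2ComputableInPolyTime (SamplerInput.encode (S := S) (q := q))
      (id : List Bool → List Bool) f) ∧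
    ∀ (N Δ : ℕ) (h : (N, Δ) ∈ S),
      (PMF.uniformOfFintype (Fin (q.eval N) → Bool)).map (fun r => f ⟨N, Δ, h, r⟩) =
        (D N Δ).map bits

end HardDist

/-!
The isolators are found by exhaustive search over truth tables on a number of bits so small
compared to `N` that the search takes polynomial time; a probabilistic argument shows that the
search succeeds.

**From isolators to hard distributions** (`one_sub_le_tvDist_hardDist`). Suppose that a source of
degree `Δ` were close to `(U_1, …, U_t, Iso(U_1), …, Iso(U_t))`. Output the first string `u_j` that
is labelled `1`, or a fresh uniform string if there is none. As a polynomial in the input bits this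
has degree at most `Δ (t + 1)`. If all labels are correct, then the output satisfies `Iso` except
with probability `(1 - α) ^ (t + 1)`, and it is unlikely to be one of the few points that are heavy
for the new source. But an isolator for degree `Δ (t + 1)` allows light points that satisfy `Iso`
only with probability `β`. This is a test that tells the source from the hard distribution.

**Existence of isolators** (`exists_isGood`, `isIsolator_lookup`). Put `l = 10 q`, where `q` is the
degree. A source may be assumed to have only `20 q` input bits: restricting it to a random affine
subspace of dimension `20 q` changes the distribution of its first `l` bits by at most `2 ^ (-5 q)`,
because two points of a random affine frame are independent (`exists_source_close`). There remain
at most `2 ^ (10 q 2 ^ (6 q))` sources on `l` bits, since there are at most `2 ^ (6 q)` monomials of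
degree at most `q`. A random set of density slightly above `α` violates the bound `α + 2 ^ (-q)` on
the truncated mass of a given source with probability at most `exp (- 2 ^ (7 q) / 16)`, and a union
bound gives a set that works for all of them. Reading only the first `l` of `n = 2 ^ l` bits makes
it an isolator on `n` bits.

**Sampling** (`polyTimeSamplable_table`). With `q` about `log log N / 40`, both the truth tables on
`10 q` bits and the sources with `20 q` input bits are coded by numbers up to `N`. So the first good
truth table is the value of an arithmetic expression built from sums with at most polynomially many
terms. Such expressions are compiled to programs operating on stacks, which in turn are compiled to
Turing machines (`Expr.samplerOut_polyTime`).

**Parameters** (`error_le`). With `t` about `q / (2 Δ)` copies and density `α` about `log t / t`,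
all the error terms are of the order of `log t / t`, which is of the order of the rate. The second
isolator has density `1 / 2`, and is used with a single copy.
-/

namespace HardDist

open Real

/-! ### Structured programs on stacks and their compilation to Turing machines -/

/-- Structured programs acting on stacks of bits indexed by `ℕ`. -/
inductive Prog
  /-- do nothing -/
  | skip
  /-- push a bit on a stack -/
  | push (k : ℕ) (b : Bool)
  /-- pop a stack, and continue according to whether it was empty, had top `false`, or top `true` -/
  | case (k : ℕ) (pE pF pT : Prog)
  /-- sequential composition -/
  | seq (p p' : Prog)
  /-- repeat the body as long as a stack is nonempty -/
  | loop (k : ℕ) (p : Prog)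

namespace Prog

/-- The contents of all stacks; the head of a list is the top of the stack. -/
abbrev Stk := ℕ → List Bool

/-- `Exec p S t S'`: started with stacks `S`, the program `p` halts with stacks `S'`, and its
compiled form takes `t` steps. -/
inductive Exec : Prog → Stk → ℕ → Stk → Prop
  | skip (S) : Exec skip S 1 S
  | push (k b S) : Exec (push k b) S 1 (Function.update S k (b :: S k))
  | caseE {k pE pF pT S t S'} (h : S k = []) (h' : Exec pE S t S') :
      Exec (case k pE pF pT) S (t + 1) S'
  | caseF {k pE pF pT S l t S'} (h : S k = false :: l) (h' : Exec pF (Function.update S k l) t S') :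
      Exec (case k pE pF pT) S (t + 1) S'
  | caseT {k pE pF pT S l t S'} (h : S k = true :: l) (h' : Exec pT (Function.update S k l) t S') :
      Exec (case k pE pF pT) S (t + 1) S'
  | seq {p p' S t S' t' S''} (h : Exec p S t S') (h' : Exec p' S' t' S'') :
      Exec (seq p p') S (t + t') S''
  | loopE {k p S} (h : S k = []) : Exec (loop k p) S 1 S
  | loopS {k p S t S' t' S''} (h : S k ≠ []) (h' : Exec p S t S')
      (h'' : Exec (loop k p) S' t' S'') : Exec (loop k p) S (1 + t + t') S''

/-- The labels of the compiled form of a program. -/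
def Lab : Prog → Type
  | skip => Unit
  | push _ _ => Unit
  | case _ pE pF pT => Option (Lab pE ⊕ Lab pF ⊕ Lab pT)
  | seq p p' => Lab p ⊕ Lab p'
  | loop _ p => Option (Lab p)

/-- There are finitely many labels. -/
@[reducible] def Lab.fintype : (p : Prog) → Fintype (Lab p)
  | skip => inferInstanceAs (Fintype Unit)
  | push _ _ => inferInstanceAs (Fintype Unit)
  | case _ pE pF pT =>
    let _ := Lab.fintype pE
    let _ := Lab.fintype pF
    let _ := Lab.fintype pT
    inferInstanceAs (Fintype (Option (Lab pE ⊕ Lab pF ⊕ Lab pT)))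
  | seq p p' =>
    let _ := Lab.fintype p
    let _ := Lab.fintype p'
    inferInstanceAs (Fintype (Lab p ⊕ Lab p'))
  | loop _ p =>
    let _ := Lab.fintype p
    inferInstanceAs (Fintype (Option (Lab p)))

/-- The label at which execution starts. -/
def entry : (p : Prog) → Lab p
  | skip => ()
  | push _ _ => ()
  | case _ _ _ _ => none
  | seq p _ => Sum.inl (entry p)
  | loop _ _ => none

/-- Statements of the machines: `w + 1` stacks of bits, and a state remembering the last symbol
read. -/
abbrev MStmt (w : ℕ) (Λ : Type) := Turing.TM2.Stmt (fun _ : Fin (w + 1) => Bool) Λ (Option Bool)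

open Turing.TM2.Stmt in
/-- The compiled form of a program, with labels embedded in `Λ` by `emb`, and with control passing
to the label `exit` at the end. -/
def code (w : ℕ) {Λ : Type} : (p : Prog) → (Lab p → Λ) → Λ → Lab p → MStmt w Λ
  | skip, _, exit, _ => goto fun _ => exit
  | push k b, _, exit, _ =>
    Turing.TM2.Stmt.push (Fin.ofNat (w + 1) k) (fun _ => b) (goto fun _ => exit)
  | case k pE pF pT, emb, exit, l => match l with
    | none => pop (Fin.ofNat (w + 1) k) (fun _ x => x) (goto fun
        | none => emb (some (Sum.inl (entry pE)))
        | some false => emb (some (Sum.inr (Sum.inl (entry pF))))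
        | some true => emb (some (Sum.inr (Sum.inr (entry pT)))))
    | some (Sum.inl l) => code w pE (fun l => emb (some (Sum.inl l))) exit l
    | some (Sum.inr (Sum.inl l)) => code w pF (fun l => emb (some (Sum.inr (Sum.inl l)))) exit l
    | some (Sum.inr (Sum.inr l)) => code w pT (fun l => emb (some (Sum.inr (Sum.inr l)))) exit l
  | seq p p', emb, exit, l => match l with
    | Sum.inl l => code w p (fun l => emb (Sum.inl l)) (emb (Sum.inr (entry p'))) l
    | Sum.inr l => code w p' (fun l => emb (Sum.inr l)) exit l
  | loop k p, emb, exit, l => match l with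
    | none => peek (Fin.ofNat (w + 1) k) (fun _ x => x) (goto fun
        | none => exit
        | some _ => emb (some (entry p)))
    | some l => code w p (fun l => emb (some l)) (emb none) l

/-- All stacks used by the program have index at most `w`. -/
def Below (w : ℕ) : Prog → Prop
  | skip => True
  | push k _ => k ≤ w
  | case k pE pF pT => k ≤ w ∧ Below w pE ∧ Below w pF ∧ Below w pT
  | seq p p' => Below w p ∧ Below w p'
  | loop k p => k ≤ w ∧ Below w p

/-- A bound on the indices of the stacks used by a program. -/
def width : Prog → ℕ
  | skip => 0
  | push k _ => k
  | case k pE pF pT => max k (max (width pE) (max (width pF) (width pT)))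
  | seq p p' => max (width p) (width p')
  | loop k p => max k (width p)

theorem below_of_width_le {w : ℕ} : ∀ {p : Prog}, width p ≤ w → Below w p
  | skip, _ => trivial
  | push _ _, h => h
  | case _ _ _ _, h => by
    simp only [width, max_le_iff] at h
    exact ⟨h.1, below_of_width_le h.2.1, below_of_width_le h.2.2.1, below_of_width_le h.2.2.2⟩
  | seq _ _, h => by
    simp only [width, max_le_iff] at h
    exact ⟨below_of_width_le h.1, below_of_width_le h.2⟩
  | loop _ _, h => by
    simp only [width, max_le_iff] at h
    exact ⟨h.1, below_of_width_le h.2⟩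

/-- `n` steps of the machine lead from one configuration to another. -/
def Steps {w : ℕ} {Λ : Type} (M : Λ → MStmt w Λ)
    (c : Turing.TM2.Cfg (fun _ : Fin (w + 1) => Bool) Λ (Option Bool)) (n : ℕ)
    (c' : Turing.TM2.Cfg (fun _ : Fin (w + 1) => Bool) Λ (Option Bool)) : Prop :=
  (flip bind (Turing.TM2.step M))^[n] (some c) = some c'

theorem Steps.trans {w : ℕ} {Λ : Type} {M : Λ → MStmt w Λ} {c c' c'' n n'}
    (h : Steps M c n c') (h' : Steps M c' n' c'') : Steps M c (n + n') c'' := by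
  unfold Steps at *
  rw [Nat.add_comm n n', Function.iterate_add_apply, h, h']

theorem Steps.one {w : ℕ} {Λ : Type} {M : Λ → MStmt w Λ} {c c'}
    (h : Turing.TM2.step M c = some c') : Steps M c 1 c' := h

/-- The stacks with index at most `w`. -/
def restr (w : ℕ) (S : Stk) : Fin (w + 1) → List Bool := fun k => S k

theorem ofNat_val {w k : ℕ} (h : k ≤ w) : ((Fin.ofNat (w + 1) k : Fin (w + 1)) : ℕ) = k := by
  simp only [Fin.ofNat]
  exact Nat.mod_eq_of_lt (by omega)

theorem restr_update {w k : ℕ} (h : k ≤ w) (S : Stk) (l : List Bool) :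
    Function.update (restr w S) (Fin.ofNat (w + 1) k) l = restr w (Function.update S k l) := by
  funext j
  by_cases hj : j = Fin.ofNat (w + 1) k
  · subst hj
    rw [Function.update_self, restr, ofNat_val h, Function.update_self]
  · have : (j : ℕ) ≠ k := fun e => hj (Fin.ext (by rw [ofNat_val h, e]))
    rw [Function.update_of_ne hj, restr, restr, Function.update_of_ne this]

theorem restr_ofNat {w k : ℕ} (h : k ≤ w) (S : Stk) : restr w S (Fin.ofNat (w + 1) k) = S k := by
  simp only [restr, ofNat_val h]

theorem step_some {w : ℕ} {Λ : Type} {M : Λ → MStmt w Λ} {l : Λ} {s : MStmt w Λ} (h : M l = s)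
    {v : Option Bool} {S : Fin (w + 1) → List Bool} :
    Turing.TM2.step M ⟨some l, v, S⟩ = some (Turing.TM2.stepAux s v S) := by
  rw [← h]
  rfl

/-- The compiled form of a program simulates it. -/
theorem Exec.steps {w : ℕ} {Λ : Type} {M : Λ → MStmt w Λ} {p : Prog} {S : Stk} {t : ℕ} {S' : Stk}
    (h : Exec p S t S') : ∀ (emb : Lab p → Λ) (exit : Λ), Below w p →
      (∀ l, M (emb l) = code w p emb exit l) → ∀ v, ∃ v',
      Steps M ⟨some (emb (entry p)), v, restr w S⟩ t ⟨some exit, v', restr w S'⟩ := by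
  induction h with
  | skip S =>
    intro emb exit _ hM v
    exact ⟨v, Steps.one (step_some (hM _))⟩
  | push k b S =>
    intro emb exit hw hM v
    refine ⟨v, Steps.one ((step_some (hM _)).trans ?_)⟩
    change some (Turing.TM2.stepAux (Turing.TM2.Stmt.push (Fin.ofNat (w + 1) k) (fun _ => b)
      (Turing.TM2.Stmt.goto _)) v (restr w S)) = _
    simp only [Turing.TM2.stepAux]
    rw [restr_update hw, restr_ofNat hw]
  | @caseE k pE pF pT S t S' h _ ih =>
    intro emb exit hw hM v
    obtain ⟨v', hv⟩ := ih (fun l => emb (some (Sum.inl l))) exit hw.2.1 (fun l => hM _) none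
    refine ⟨v', ?_⟩
    rw [Nat.add_comm t 1]
    refine Steps.trans (Steps.one ((step_some (hM _)).trans ?_)) hv
    change some (Turing.TM2.stepAux (Turing.TM2.Stmt.pop (Fin.ofNat (w + 1) k) (fun _ x => x)
      (Turing.TM2.Stmt.goto _)) v (restr w S)) = _
    simp only [Turing.TM2.stepAux]
    rw [restr_update hw.1, restr_ofNat hw.1, h]
    simp only [List.tail_nil, List.head?_nil]
    rw [← h, Function.update_eq_self]
  | @caseF k pE pF pT S l t S' h _ ih =>
    intro emb exit hw hM v
    obtain ⟨v', hv⟩ := ih (fun l => emb (some (Sum.inr (Sum.inl l)))) exit hw.2.2.1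
      (fun l => hM _) (some false)
    refine ⟨v', ?_⟩
    rw [Nat.add_comm t 1]
    refine Steps.trans (Steps.one ((step_some (hM _)).trans ?_)) hv
    change some (Turing.TM2.stepAux (Turing.TM2.Stmt.pop (Fin.ofNat (w + 1) k) (fun _ x => x)
      (Turing.TM2.Stmt.goto _)) v (restr w S)) = _
    simp only [Turing.TM2.stepAux]
    rw [restr_update hw.1, restr_ofNat hw.1, h]
    rfl
  | @caseT k pE pF pT S l t S' h _ ih =>
    intro emb exit hw hM v
    obtain ⟨v', hv⟩ := ih (fun l => emb (some (Sum.inr (Sum.inr l)))) exit hw.2.2.2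
      (fun l => hM _) (some true)
    refine ⟨v', ?_⟩
    rw [Nat.add_comm t 1]
    refine Steps.trans (Steps.one ((step_some (hM _)).trans ?_)) hv
    change some (Turing.TM2.stepAux (Turing.TM2.Stmt.pop (Fin.ofNat (w + 1) k) (fun _ x => x)
      (Turing.TM2.Stmt.goto _)) v (restr w S)) = _
    simp only [Turing.TM2.stepAux]
    rw [restr_update hw.1, restr_ofNat hw.1, h]
    rfl
  | @seq p p' S t S' t' S'' _ _ ih ih' =>
    intro emb exit hw hM v
    obtain ⟨v', hv⟩ := ih (fun l => emb (Sum.inl l)) (emb (Sum.inr (entry p'))) hw.1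
      (fun l => hM _) v
    obtain ⟨v'', hv'⟩ := ih' (fun l => emb (Sum.inr l)) exit hw.2 (fun l => hM _) v'
    exact ⟨v'', hv.trans hv'⟩
  | @loopE k p S h =>
    intro emb exit hw hM v
    refine ⟨none, Steps.one ((step_some (hM _)).trans ?_)⟩
    change some (Turing.TM2.stepAux (Turing.TM2.Stmt.peek (Fin.ofNat (w + 1) k) (fun _ x => x)
      (Turing.TM2.Stmt.goto _)) v (restr w S)) = _
    simp only [Turing.TM2.stepAux]
    rw [restr_ofNat hw.1, h]
    rfl
  | @loopS k p S t S' t' S'' h _ _ ih ih' =>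
    intro emb exit hw hM v
    obtain ⟨b, l, hbl⟩ := List.exists_cons_of_ne_nil h
    obtain ⟨v', hv⟩ := ih (fun l => emb (some l)) (emb none) hw.2 (fun l => hM _) (some b)
    obtain ⟨v'', hv'⟩ := ih' emb exit hw hM v'
    refine ⟨v'', Steps.trans (Steps.trans (Steps.one ((step_some (hM _)).trans ?_)) hv) hv'⟩
    change some (Turing.TM2.stepAux (Turing.TM2.Stmt.peek (Fin.ofNat (w + 1) k) (fun _ x => x)
      (Turing.TM2.Stmt.goto _)) v (restr w S)) = _
    simp only [Turing.TM2.stepAux]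
    rw [restr_ofNat hw.1, hbl]
    rfl

/-- The Turing machine of a program: after the program it resets its state and halts. Stack `0`
holds the input, stack `o` the output. -/
def machine (p : Prog) (o : ℕ) : Turing.FinTM2 where
  K := Fin (p.width + 1)
  k₀ := Fin.ofNat _ 0
  k₁ := Fin.ofNat _ o
  Γ := fun _ => Bool
  Λ := Option (Lab p)
  main := some (entry p)
  ΛFin := by
    let _ := Lab.fintype p
    infer_instance
  σ := Option Bool
  initialState := none
  Γk₀Fin := inferInstanceAs (Fintype Bool)
  m := fun
    | none => Turing.TM2.Stmt.load (fun _ => none) Turing.TM2.Stmt.halt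
    | some l => code p.width p some none l

/-- A function is computed in polynomial time if a program, started with the encoded argument on
stack `0` and all other stacks empty, halts after polynomially many steps with the value on
stack `o` and all other stacks empty. -/
theorem computableInPolyTime {α : Type} {ea : α → List Bool} {f : α → List Bool} (p : Prog)
    (o : ℕ) (ho : o ≤ p.width) (T : Polynomial ℕ)
    (h : ∀ a, ∃ t ≤ T.eval (ea a).length, Exec p (Function.update (fun _ => []) 0 (ea a)) t
      (Function.update (fun _ => []) o (f a))) :
    Nonempty (Turing.TM2ComputableInPolyTime ea (id : List Bool → List Bool) f) := by
  choose t ht hE using h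
  refine ⟨{ tm := machine p o
            inputAlphabet := Equiv.refl _
            outputAlphabet := Equiv.refl _
            time := T + 1
            outputsFun := fun a => ⟨⟨t a + 1, ?_⟩, ?_⟩ }⟩
  · obtain ⟨v, hv⟩ := (hE a).steps (M := (machine p o).m) (w := p.width) some none
      (below_of_width_le le_rfl) (fun l => rfl) none
    have hlast : Steps (w := p.width) (machine p o).m
        ⟨some none, v, restr p.width (Function.update (fun _ => []) o (f a))⟩ 1
        ⟨none, none, restr p.width (Function.update (fun _ => []) o (f a))⟩ := Steps.one rfl
    have key := hv.trans hlast
    unfold Steps at key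
    have e1 : Turing.initList (machine p o) (List.map (Equiv.refl Bool).invFun (ea a)) =
        ⟨some (some (entry p)), none, restr p.width (Function.update (fun _ => []) 0 (ea a))⟩ := by
      unfold Turing.initList
      congr 1
      rw [← restr_update (Nat.zero_le _)]
      funext k
      by_cases hk : k = Fin.ofNat (p.width + 1) 0
      · subst hk
        refine (dif_pos rfl).trans ((List.map_id (ea a)).trans ?_)
        exact (Function.update_self (β := fun _ => List Bool) (Fin.ofNat (p.width + 1) 0) _ _).symm
      · refine (dif_neg hk).trans ?_
        exact (Function.update_of_ne (β := fun _ => List Bool) hk _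
          (restr p.width fun _ => [])).symm
    have e2 : Turing.haltList (machine p o) (List.map (Equiv.refl Bool).invFun (id (f a))) =
        ⟨none, none, restr p.width (Function.update (fun _ => []) o (f a))⟩ := by
      unfold Turing.haltList
      congr 1
      rw [← restr_update ho]
      funext k
      by_cases hk : k = Fin.ofNat (p.width + 1) o
      · subst hk
        refine (dif_pos rfl).trans ((List.map_id (f a)).trans ?_)
        exact (Function.update_self (β := fun _ => List Bool) (Fin.ofNat (p.width + 1) o) _ _).symm
      · refine (dif_neg hk).trans ?_
        exact (Function.update_of_ne (β := fun _ => List Bool) hk _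
          (restr p.width fun _ => [])).symm
    exact (congrArg (fun c => (flip bind (Turing.TM2.step (machine p o).m))^[t a + 1] (some c))
      e1).trans (key.trans (congrArg some e2.symm))
  · simpa using ht a

end Prog

/-! ### Arithmetic expressions and their evaluation in polynomial time -/

namespace Prog

/-- `Runs p S T S'`: the program `p` leads from `S` to `S'` in at most `T` steps. -/
def Runs (p : Prog) (S : Stk) (T : ℕ) (S' : Stk) : Prop := ∃ t ≤ T, Exec p S t S'

theorem Runs.mono {p : Prog} {S : Stk} {T T' : ℕ} {S' : Stk} (h : Runs p S T S') (hT : T ≤ T') :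
    Runs p S T' S' :=
  let ⟨t, ht, h⟩ := h
  ⟨t, ht.trans hT, h⟩

theorem Runs.to {p : Prog} {S : Stk} {T T' : ℕ} {S' S'' : Stk} (h : Runs p S T S')
    (hT : T ≤ T') (hS : S' = S'') : Runs p S T' S'' := hS ▸ h.mono hT

theorem Runs.from_to {p : Prog} {S₀ S : Stk} {T T' : ℕ} {S' S'' : Stk} (h : Runs p S₀ T S')
    (hS₀ : S₀ = S) (hT : T ≤ T') (hS : S' = S'') : Runs p S T' S'' := hS₀ ▸ h.to hT hS

theorem Runs.skip (S : Stk) : Runs skip S 1 S := ⟨1, le_rfl, .skip S⟩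

theorem Runs.push (k : ℕ) (b : Bool) (S : Stk) :
    Runs (push k b) S 1 (Function.update S k (b :: S k)) := ⟨1, le_rfl, .push k b S⟩

theorem Runs.seq {p p' : Prog} {S : Stk} {T : ℕ} {S' : Stk} {T' : ℕ} {S'' : Stk}
    (h : Runs p S T S') (h' : Runs p' S' T' S'') : Runs (seq p p') S (T + T') S'' :=
  let ⟨_, ht, h⟩ := h
  let ⟨_, ht', h'⟩ := h'
  ⟨_, Nat.add_le_add ht ht', .seq h h'⟩

theorem Runs.caseE {k : ℕ} {pE pF pT : Prog} {S : Stk} {T : ℕ} {S' : Stk} (h : S k = [])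
    (h' : Runs pE S T S') : Runs (case k pE pF pT) S (T + 1) S' :=
  let ⟨_, ht, h'⟩ := h'
  ⟨_, Nat.add_le_add_right ht 1, .caseE h h'⟩

theorem Runs.caseF {k : ℕ} {pE pF pT : Prog} {S : Stk} {T : ℕ} {S' : Stk} {l : List Bool}
    (h : S k = false :: l) (h' : Runs pF (Function.update S k l) T S') :
    Runs (case k pE pF pT) S (T + 1) S' :=
  let ⟨_, ht, h'⟩ := h'
  ⟨_, Nat.add_le_add_right ht 1, .caseF h h'⟩

theorem Runs.caseT {k : ℕ} {pE pF pT : Prog} {S : Stk} {T : ℕ} {S' : Stk} {l : List Bool}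
    (h : S k = true :: l) (h' : Runs pT (Function.update S k l) T S') :
    Runs (case k pE pF pT) S (T + 1) S' :=
  let ⟨_, ht, h'⟩ := h'
  ⟨_, Nat.add_le_add_right ht 1, .caseT h h'⟩

/-- A loop whose successive states are known. -/
theorem Runs.loop {k : ℕ} {p : Prog} (n : ℕ) : ∀ (I : ℕ → Stk) {T : ℕ}, (∀ i < n, I i k ≠ []) →
    (∀ i < n, Runs p (I i) T (I (i + 1))) → I n k = [] →
    Runs (loop k p) (I 0) (n * (T + 1) + 1) (I n) := by
  induction n with
  | zero => intro I T _ _ h; exact ⟨1, by omega, .loopE h⟩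
  | succ n ih =>
    intro I T hne hb hE
    obtain ⟨t, ht, h⟩ := hb 0 (by omega)
    obtain ⟨t', ht', h'⟩ := ih (fun i => I (i + 1)) (fun i hi => hne (i + 1) (by omega))
      (fun i hi => hb (i + 1) (by omega)) hE
    exact ⟨1 + t + t', by rw [Nat.succ_mul]; omega, .loopS (hne 0 (by omega)) h h'⟩

/-- Remove the top of a stack. -/
def drop (k : ℕ) : Prog := case k skip skip skip

theorem Runs.drop {k : ℕ} {S : Stk} : Runs (drop k) S 2 (Function.update S k (S k).tail) := by
  rcases h : S k with _ | ⟨_ | _, l⟩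
  · refine Runs.caseE h ?_
    rw [List.tail_nil, ← h, Function.update_eq_self]
    exact Runs.skip S
  · exact Runs.caseF h (Runs.skip _)
  · exact Runs.caseT h (Runs.skip _)

/-- Empty a stack. -/
def clear (k : ℕ) : Prog := loop k (drop k)

theorem Runs.clear (k : ℕ) (S : Stk) :
    Runs (clear k) S (3 * (S k).length + 1) (Function.update S k []) := by
  have := Runs.loop (k := k) (p := Prog.drop k) (S k).length
    (fun i => Function.update S k ((S k).drop i)) (T := 2)
    (fun i hi => by simpa using hi)
    (fun i hi => by
      have := Runs.drop (k := k) (S := Function.update S k ((S k).drop i))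
      simpa using this)
    (by simp)
  exact this.from_to (by simp) (by omega) (by simp)

/-- Move the contents of a stack to another one, reversing their order. -/
def move (a b : ℕ) : Prog := loop a (case a skip (push b false) (push b true))

theorem Runs.move {a b : ℕ} (hab : a ≠ b) (S : Stk) :
    Runs (move a b) S (3 * (S a).length + 1)
      (Function.update (Function.update S a []) b ((S a).reverse ++ S b)) := by
  have := Runs.loop (k := a) (p := case a .skip (.push b false) (.push b true)) (S a).length
    (fun i => Function.update (Function.update S a ((S a).drop i)) b
      (((S a).take i).reverse ++ S b)) (T := 2)
    (fun i hi => by simpa [Function.update_of_ne hab] using hi)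
    (fun i hi => by
      have e := List.drop_eq_getElem_cons hi
      have e' : (S a).take (i + 1) = (S a).take i ++ [(S a)[i]] := by simp
      rcases hc : (S a)[i] with _ | _ <;> rw [hc] at e e'
      · refine Runs.caseF (l := (S a).drop (i + 1)) (by grind) ?_
        refine (Runs.push _ _ _).to le_rfl ?_
        funext j; grind
      · refine Runs.caseT (l := (S a).drop (i + 1)) (by grind) ?_
        refine (Runs.push _ _ _).to le_rfl ?_
        funext j; grind)
    (by simp [Function.update_of_ne hab])
  exact this.from_to (by simp) (by omega) (by simp)

/-- The unary representation of a number. -/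
abbrev U (n : ℕ) : List Bool := List.replicate n true

theorem U_append (m n : ℕ) : U m ++ U n = U (m + n) := List.replicate_append_replicate

theorem U_cons (n : ℕ) : true :: U n = U (n + 1) := rfl

/-- Add a number to another one, setting the first to zero. -/
theorem Runs.move_unary {a b m n : ℕ} (hab : a ≠ b) {S : Stk} (ha : S a = U m) (hb : S b = U n) :
    Runs (Prog.move a b) S (3 * m + 1)
      (Function.update (Function.update S a []) b (U (m + n))) := by
  have := Runs.move hab S
  rwa [ha, hb, List.reverse_replicate, U_append, List.length_replicate] at this

/-- Copy a number, with an auxiliary stack. -/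
def copy (a b c : ℕ) : Prog :=
  seq (loop a (seq (drop a) (seq (push b true) (push c true)))) (move c a)

theorem Runs.copy {a b c n : ℕ} (hab : a ≠ b) (hac : a ≠ c) (hbc : b ≠ c) {S : Stk}
    (ha : S a = U n) (hb : S b = []) (hc : S c = []) :
    Runs (copy a b c) S (8 * n + 2) (Function.update S b (U n)) := by
  have := Runs.loop (k := a) (p := .seq (.drop a) (.seq (.push b true) (.push c true))) n
    (fun i => Function.update (Function.update (Function.update S a (U (n - i))) b (U i)) c (U i))
    (T := 4)
    (fun i hi => by
      simp [Function.update_of_ne hab, Function.update_of_ne hac]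
      omega)
    (fun i hi => by
      refine ((Runs.drop).seq ((Runs.push _ _ _).seq (Runs.push _ _ _))).to (by norm_num) ?_
      have e : U (n - i) = true :: U (n - (i + 1)) := by rw [U_cons]; congr 1; omega
      have e' := U_cons i
      funext j; grind)
    (by simp [Function.update_of_ne hab, Function.update_of_ne hac])
  have h2 := Runs.move_unary (a := c) (b := a) (m := n) (n := 0) hac.symm
    (S := Function.update (Function.update (Function.update S a (U (n - n))) b (U n)) c (U n))
    (by simp) (by simp [Function.update_of_ne hab, Function.update_of_ne hac])
  have e0 : U 0 = [] := rfl
  refine (this.seq h2).from_to ?_ (by omega) ?_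
  · funext j; grind
  · funext j; grind

end Prog

section

open Prog

/-- Expressions for functions of natural numbers (the variables, numbered as de Bruijn indices)
and of a list of bits (the coins). -/
inductive Expr
  /-- the constant `1` -/
  | one
  /-- a variable -/
  | var (i : ℕ)
  /-- addition -/
  | add (e e' : Expr)
  /-- truncated subtraction -/
  | sub (e e' : Expr)
  /-- the sum of `e` over all values of variable `0` less than `n` -/
  | sum (n e : Expr)
  /-- the bit of the coins at position `e` -/
  | coin (e : Expr)

/-- Extend an environment by a new variable `0`. -/
def ext (x : ℕ) (env : ℕ → ℕ) : ℕ → ℕ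
  | 0 => x
  | i + 1 => env i

@[simp] theorem ext_zero (x : ℕ) (env : ℕ → ℕ) : ext x env 0 = x := rfl
@[simp] theorem ext_succ (x : ℕ) (env : ℕ → ℕ) (i : ℕ) : ext x env (i + 1) = env i := rfl

namespace Expr

/-- The value of an expression. -/
def eval (r : List Bool) : Expr → (ℕ → ℕ) → ℕ
  | one, _ => 1
  | var i, env => env i
  | add e e', env => eval r e env + eval r e' env
  | sub e e', env => eval r e env - eval r e' env
  | sum n e, env => ∑ i ∈ Finset.range (eval r n env), eval r e (ext i env)
  | coin e, env => (r.getD (eval r e env) false).toNat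

/-- A program evaluating an expression: `v` tells which stacks hold the variables, the value is put
on the stack `b`, and the stacks from `b` on serve as working space. -/
def compile : Expr → (ℕ → ℕ) → ℕ → Prog
  | one, _, b => push b true
  | var i, v, b => copy (v i) b (b + 1)
  | add e e', v, b => seq (compile e v b) (seq (compile e' v (b + 1)) (move (b + 1) b))
  | sub e e', v, b => seq (compile e v b) (seq (compile e' v (b + 1))
      (loop (b + 1) (seq (drop (b + 1)) (drop b))))
  | sum n e, v, b => seq (compile n v b) (seq (loop b (seq (drop b)
      (seq (compile e (ext (b + 2) v) (b + 3)) (seq (move (b + 3) (b + 1)) (push (b + 2) true)))))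
      (seq (clear (b + 2)) (move (b + 1) b)))
  | coin e, v, b => seq (compile e v b) (seq
      (loop b (seq (drop b) (case 0 skip (push (b + 1) false) (push (b + 1) true))))
      (seq (case 0 skip (push (b + 1) false) (seq (push (b + 1) true) (push b true)))
        (move (b + 1) 0)))

/-- The stacks hold the coins and the variables, and the stacks from `b` on are empty. -/
structure Holds (r : List Bool) (env v : ℕ → ℕ) (b : ℕ) (S : Stk) : Prop where
  coins : S 0 = r
  pos : ∀ i, 0 < v i
  lt : ∀ i, v i < b
  val : ∀ i, S (v i) = U (env i)
  empty : ∀ k, b ≤ k → S k = []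

theorem Holds.base_pos {r : List Bool} {env v : ℕ → ℕ} {b : ℕ} {S : Stk}
    (h : Holds r env v b S) : 0 < b := (h.pos 0).trans (h.lt 0)

/-- Stacks below the working space may be added. -/
theorem Holds.update {r : List Bool} {env v : ℕ → ℕ} {b : ℕ} {S S' : Stk} (h : Holds r env v b S)
    {b' : ℕ} (hb : b ≤ b') (hS : ∀ k, k < b → S' k = S k) (hS' : ∀ k, b' ≤ k → S' k = []) :
    Holds r env v b' S' where
  coins := by rw [hS 0 h.base_pos, h.coins]
  pos := h.pos
  lt i := (h.lt i).trans_le hb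
  val i := by rw [hS _ (h.lt i), h.val]
  empty := hS'

theorem Holds.ext {r : List Bool} {env v : ℕ → ℕ} {b : ℕ} {S : Stk} (h : Holds r env v b S)
    {c x : ℕ} (hc0 : 0 < c) (hcb : c < b) (hx : S c = U x) :
    Holds r (ext x env) (ext c v) b S where
  coins := h.coins
  pos i := by cases i with
    | zero => exact hc0
    | succ i => exact h.pos i
  lt i := by cases i with
    | zero => exact hcb
    | succ i => exact h.lt i
  val i := by cases i with
    | zero => exact hx
    | succ i => exact h.val i
  empty := h.empty

set_option maxHeartbeats 2000000 in
/-- Evaluating an expression with values and coins bounded by `x` takes time polynomial in `x`, and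
the value is polynomially bounded. -/
theorem exists_bounds (e : Expr) : ∃ V T : Polynomial ℕ, ∀ (x : ℕ) (r : List Bool) (env : ℕ → ℕ),
    r.length ≤ x → (∀ i, env i ≤ x) → eval r e env ≤ V.eval x ∧
    ∀ (v : ℕ → ℕ) (b : ℕ) (S : Stk), Holds r env v b S →
      Runs (compile e v b) S (T.eval x) (Function.update S b (U (eval r e env))) := by
  induction e with
  | one =>
    refine ⟨1, 1, fun x r env _ _ => ⟨by simp [eval], fun v b S h => ?_⟩⟩
    refine (Runs.push b true S).to (by simp) ?_
    rw [h.empty b le_rfl]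
    rfl
  | var i =>
    refine ⟨Polynomial.X, 8 * Polynomial.X + 2, fun x r env _ hx =>
      ⟨by simpa [eval] using hx i, fun v b S h => ?_⟩⟩
    have := h.lt i
    refine (Runs.copy (n := env i) (by omega) (by omega) (by omega) (h.val i) (h.empty b le_rfl)
      (h.empty (b + 1) (by omega))).to ?_ rfl
    have := hx i
    simp only [Polynomial.eval_add, Polynomial.eval_mul, Polynomial.eval_ofNat, Polynomial.eval_X]
    omega
  | add e e' ih ih' =>
    obtain ⟨V, T, h⟩ := ih
    obtain ⟨V', T', h'⟩ := ih'
    refine ⟨V + V', T + (T' + (3 * V' + 1)), fun x r env hr hx => ?_⟩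
    obtain ⟨hV, hT⟩ := h x r env hr hx
    obtain ⟨hV', hT'⟩ := h' x r env hr hx
    refine ⟨by simpa [eval] using Nat.add_le_add hV hV', fun v b S hS => ?_⟩
    have h1 := hT v b S hS
    have h2 := hT' v (b + 1) (Function.update S b (U (eval r e env)))
      (hS.update (by omega) (fun k hk => by grind) (fun k hk => by grind [hS.empty k (by omega)]))
    refine (h1.seq (h2.seq (Runs.move_unary (m := eval r e' env) (n := eval r e env) (by omega)
      (by grind) (by grind)))).to ?_ ?_
    · simp only [Polynomial.eval_add, Polynomial.eval_mul, Polynomial.eval_ofNat,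
        Polynomial.eval_one]
      omega
    · have := hS.empty (b + 1) (by omega)
      simp only [eval]
      rw [add_comm (eval r e' env)]
      funext j; grind
  | sub e e' ih ih' =>
    obtain ⟨V, T, h⟩ := ih
    obtain ⟨V', T', h'⟩ := ih'
    refine ⟨V, T + (T' + (5 * V' + 1)), fun x r env hr hx => ?_⟩
    obtain ⟨hV, hT⟩ := h x r env hr hx
    obtain ⟨hV', hT'⟩ := h' x r env hr hx
    refine ⟨(Nat.sub_le _ _).trans hV, fun v b S hS => ?_⟩
    have h1 := hT v b S hS
    have h2 := hT' v (b + 1) (Function.update S b (U (eval r e env)))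
      (hS.update (by omega) (fun k hk => by grind) (fun k hk => by grind [hS.empty k (by omega)]))
    have h3 := Runs.loop (k := b + 1) (p := .seq (.drop (b + 1)) (.drop b)) (eval r e' env)
      (fun i => Function.update (Function.update S b (U (eval r e env - i))) (b + 1)
        (U (eval r e' env - i))) (T := 4)
      (fun i hi => by simp; omega)
      (fun i hi => by
        refine ((Runs.drop).seq (Runs.drop)).to (by norm_num) ?_
        have e1 : (U (eval r e env - i)).tail = U (eval r e env - (i + 1)) := by
          rw [List.tail_replicate]; congr 1
        have e2 : (U (eval r e' env - i)).tail = U (eval r e' env - (i + 1)) := by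
          rw [List.tail_replicate]; congr 1
        funext j; grind)
      (by simp)
    refine (h1.seq (h2.seq (h3.from_to ?_ le_rfl rfl))).to ?_ ?_
    · simp
    · simp only [Polynomial.eval_add, Polynomial.eval_mul, Polynomial.eval_ofNat,
        Polynomial.eval_one]
      omega
    · have := hS.empty (b + 1) (by omega)
      simp only [eval, Nat.sub_self, List.replicate_zero]
      funext j; grind
  | sum n e ih ih' =>
    obtain ⟨V, T, h⟩ := ih
    obtain ⟨V', T', h'⟩ := ih'
    refine ⟨V * V'.comp (Polynomial.X + V), T + (V * (2 + (T'.comp (Polynomial.X + V) +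
      ((3 * V'.comp (Polynomial.X + V) + 1) + 1)) + 1) + 1 + ((3 * V + 1) +
        (3 * (V * V'.comp (Polynomial.X + V)) + 1))), fun x r env hr hx => ?_⟩
    obtain ⟨hV, hT⟩ := h x r env hr hx
    have hb : ∀ i < eval r n env, _ := fun i hi =>
      h' (x + V.eval x) r (HardDist.ext i env) (by omega) (fun j => by
        cases j with
        | zero => simp only [ext_zero]; omega
        | succ j => have := hx j; simp only [ext_succ]; omega)
    set y := x + V.eval x with hy
    have hsum : ∀ m ≤ eval r n env,
        ∑ i ∈ Finset.range m, eval r e (HardDist.ext i env) ≤ V.eval x * V'.eval y := by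
      intro m hm
      refine (Finset.sum_le_card_nsmul _ _ (V'.eval y) (fun i hi => (hb i ?_).1)).trans ?_
      · exact (Finset.mem_range.mp hi).trans_le hm
      · rw [Finset.card_range, smul_eq_mul]
        exact Nat.mul_le_mul_right _ (hm.trans hV)
    refine ⟨by simpa [eval] using hsum _ le_rfl, fun v b S hS => ?_⟩
    have h1 := hT v b S hS
    set N := eval r n env with hN
    set A : ℕ → ℕ := fun m => ∑ i ∈ Finset.range m, eval r e (HardDist.ext i env) with hA
    have hS1 := hS.empty (b + 1) (by omega)
    have hS2 := hS.empty (b + 2) (by omega)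
    have hS3 := hS.empty (b + 3) (by omega)
    have h2 := Runs.loop (k := b) (p := .seq (.drop b)
      (.seq (compile e (HardDist.ext (b + 2) v) (b + 3)) (.seq (.move (b + 3) (b + 1))
        (.push (b + 2) true)))) N
      (fun i => Function.update (Function.update (Function.update S b (U (N - i))) (b + 1)
        (U (A i))) (b + 2) (U i)) (T := 2 + (T'.eval y + ((3 * V'.eval y + 1) + 1)))
      (fun i hi => by simp; omega)
      (fun i hi => by
        obtain ⟨hVi, hTi⟩ := hb i hi
        have e1 : (U (N - i)).tail = U (N - (i + 1)) := by
          rw [List.tail_replicate]; congr 1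
        have k2 := hTi (HardDist.ext (b + 2) v) (b + 3) (Function.update (Function.update
          (Function.update S b (U (N - (i + 1)))) (b + 1) (U (A i))) (b + 2) (U i))
          ((hS.update (b' := b + 3) (by omega) (fun k hk => by grind)
            (fun k hk => by grind [hS.empty k (by omega)])).ext (by omega) (by omega) (by simp))
        refine ((Runs.drop).seq ((k2.from_to ?_ le_rfl rfl).seq ((Runs.move_unary
          (m := eval r e (HardDist.ext i env)) (n := A i) (by omega) ?_ ?_).seq
            (Runs.push _ _ _)))).to ?_ ?_
        · funext j; grind
        · simp
        · grind
        · omega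
        · have e2 : A (i + 1) = eval r e (HardDist.ext i env) + A i := by
            simp only [hA, Finset.sum_range_succ]; rw [add_comm]
          have e3 := U_cons i
          funext j; grind)
      (by grind)
    have h3 := Runs.clear (b + 2) (Function.update (Function.update (Function.update S b
      (U (N - N))) (b + 1) (U (A N))) (b + 2) (U N))
    have hU : U 0 = [] := rfl
    have h4 := Runs.move_unary (a := b + 1) (b := b) (m := A N) (n := 0) (by omega)
      (S := Function.update (Function.update (Function.update (Function.update S b
      (U (N - N))) (b + 1) (U (A N))) (b + 2) (U N)) (b + 2) []) (by grind) (by grind)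
    refine (h1.seq ((h2.from_to ?_ le_rfl rfl).seq (h3.seq h4))).to ?_ ?_
    · funext j; grind [Finset.sum_range_zero]
    · have e0 : A N ≤ _ := hsum N le_rfl
      simp only [Polynomial.eval_add, Polynomial.eval_mul, Polynomial.eval_ofNat,
        Polynomial.eval_one, Polynomial.eval_comp, Polynomial.eval_X, ← hy,
        Function.update_self, List.length_replicate]
      gcongr
    · have : eval r (sum n e) env = A N := rfl
      rw [this]
      funext j; grind
  | coin e ih =>
    obtain ⟨V, T, h⟩ := ih
    refine ⟨1, T + ((V * (2 + 2 + 1) + 1) + (3 + (3 * (V + 1) + 1))), fun x r env hr hx => ?_⟩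
    obtain ⟨hV, hT⟩ := h x r env hr hx
    refine ⟨by simp [eval]; exact Bool.toNat_le _, fun v b S hS => ?_⟩
    have h1 := hT v b S hS
    set N := eval r e env with hN
    have hb0 := hS.base_pos
    have hS0 := hS.coins
    have hS1 := hS.empty (b + 1) (by omega)
    have h2 := Runs.loop (k := b) (p := .seq (.drop b) (.case 0 .skip (.push (b + 1) false)
        (.push (b + 1) true))) N
      (fun i => Function.update (Function.update (Function.update S b (U (N - i))) (b + 1)
        (r.take i).reverse) 0 (r.drop i)) (T := 2 + 2)
      (fun i hi => by grind [List.replicate_eq_nil_iff])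
      (fun i hi => by
        have e1 : (U (N - i)).tail = U (N - (i + 1)) := by
          rw [List.tail_replicate]; congr 1
        refine (Runs.drop).seq ?_
        by_cases hir : i < r.length
        · have e := List.drop_eq_getElem_cons hir
          have e' : r.take (i + 1) = r.take i ++ [r[i]] := by simp
          rcases hc : r[i] with _ | _ <;> rw [hc] at e e'
          · refine Runs.caseF (l := r.drop (i + 1)) (by grind) ?_
            refine (Runs.push _ _ _).to le_rfl ?_
            funext j; grind
          · refine Runs.caseT (l := r.drop (i + 1)) (by grind) ?_
            refine (Runs.push _ _ _).to le_rfl ?_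
            funext j; grind
        · have e : r.drop i = [] := List.drop_eq_nil_of_le (by omega)
          have e2 : r.drop (i + 1) = [] := List.drop_eq_nil_of_le (by omega)
          have e3 : r.take i = r.take (i + 1) := by
            rw [List.take_of_length_le (by omega), List.take_of_length_le (by omega)]
          refine Runs.caseE (by grind) ((Runs.skip _).to le_rfl ?_)
          funext j; grind)
      (by grind)
    have hU : U 0 = [] := rfl
    have hU1 : U 1 = [true] := rfl
    have hlen : (r.take N).length ≤ V.eval x := (List.length_take_le _ _).trans hV
    refine (h1.seq ((h2.from_to ?_ le_rfl rfl).seq (T' := 3 + (3 * (V.eval x + 1) + 1))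
      ?_)).to ?_ rfl
    · funext j; grind
    · by_cases hir : N < r.length
      · have e1 := List.drop_eq_getElem_cons hir
        have e' : eval r (coin e) env = (r[N]).toNat := by simp [eval, ← hN, hir]
        have e2 := List.take_append_drop N r
        rw [e']
        rcases hc : r[N] with _ | _ <;> rw [hc] at e1
        · refine Runs.seq (T := 3) ((Runs.caseF (l := r.drop (N + 1)) (by grind)
            (Runs.push _ _ _)).mono (by norm_num)) ?_
          refine (Runs.move (by omega) _).to (by grind) ?_
          funext j; grind
        · refine Runs.seq (T := 3) ((Runs.caseT (l := r.drop (N + 1)) (by grind)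
            ((Runs.push _ _ _).seq (Runs.push _ _ _))).mono (by norm_num)) ?_
          refine (Runs.move (by omega) _).to (by grind) ?_
          funext j; grind
      · have e1 : r.drop N = [] := List.drop_eq_nil_of_le (by omega)
        have e' : eval r (coin e) env = 0 := by
          rw [show eval r (coin e) env = (r.getD N false).toNat from rfl,
            List.getD_eq_default _ _ (by omega)]
          rfl
        have e3 : r.take N = r := List.take_of_length_le (by omega)
        rw [e']
        refine Runs.seq (T := 3) ((Runs.caseE (by grind) (Runs.skip _)).mono (by norm_num)) ?_
        refine (Runs.move (by omega) _).to (by grind) ?_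
        funext j; grind
    · simp only [Polynomial.eval_add, Polynomial.eval_mul, Polynomial.eval_ofNat,
        Polynomial.eval_one]
      gcongr

end Expr

end

/-! ### Sampling programs -/

section

open Prog

/-- Move a block `1^m` that is followed by `0` from stack `0` to stack `k`, with a flag on
stack `f`. -/
def Prog.readUnary (k f : ℕ) : Prog :=
  seq (push f true) (loop f (case 0 (drop f) (drop f) (push k true)))

theorem Prog.Runs.readUnary {k f m : ℕ} {l : List Bool} (hk : k ≠ 0) (hf : f ≠ 0) (hkf : k ≠ f)
    {S : Stk} (h0 : S 0 = U m ++ false :: l) (hSk : S k = []) (hSf : S f = []) :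
    Runs (Prog.readUnary k f) S (5 * m + 6)
      (Function.update (Function.update S 0 l) k (U m)) := by
  have h1 := Runs.push f true S
  have h2 := Runs.loop (k := f) (p := case 0 (.drop f) (.drop f) (.push k true)) (m + 1)
    (fun i => if i ≤ m then Function.update (Function.update (Function.update S f [true]) 0
      (U (m - i) ++ false :: l)) k (U i) else Function.update (Function.update S 0 l) k (U m))
    (T := 3)
    (fun i hi => by grind)
    (fun i hi => by
      by_cases him : i < m
      · have e : U (m - i) = true :: U (m - (i + 1)) := by rw [U_cons]; congr 1; omega
        have e' := U_cons i
        rw [if_pos (by omega), if_pos (by omega)]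
        refine (Runs.caseT (l := U (m - (i + 1)) ++ false :: l) (by grind) (Runs.push _ _ _)).to
          (by norm_num) ?_
        funext j; grind
      · have e : U (m - i) = [] := by rw [show m - i = 0 by omega]; rfl
        have e' : i = m := by omega
        rw [if_pos (by omega), if_neg (by omega)]
        refine (Runs.caseF (l := l) (by grind) Runs.drop).to (by norm_num) ?_
        funext j; grind)
    (by grind)
  refine (h1.seq (h2.from_to ?_ le_rfl rfl)).to (by omega) ?_
  · rw [if_pos (by omega)]; funext j; grind
  · rw [if_neg (by omega)]

namespace Expr

/-- The stacks holding the variables of a sampling program: `N` is on stack `1` and `Δ` is on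
stack `2`. -/
def stackOf : ℕ → ℕ := ext 1 (ext 2 fun _ => 3)

/-- The variables of a sampling algorithm. -/
def params (N Δ : ℕ) : ℕ → ℕ := ext N (ext Δ fun _ => 0)

/-- The sampling program that outputs as many bits as the value of `len`, where the value of `bit`
tells whether a bit, whose index is variable `0`, is set. -/
def sampler (len bit : Expr) : Prog :=
  seq (readUnary 1 3) (seq (readUnary 2 3) (seq (compile len stackOf 6) (seq
    (loop 6 (seq (drop 6) (seq (compile bit (ext 5 stackOf) 7)
      (seq (case 7 (push 4 false) skip (seq (push 4 true) (clear 7))) (push 5 true)))))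
    (seq (clear 5) (seq (clear 2) (seq (clear 1) (seq (clear 0) (move 4 3))))))))

/-- The output of a sampling program. -/
def samplerOut (len bit : Expr) (N Δ : ℕ) (r : List Bool) : List Bool :=
  (List.range (eval r len (params N Δ))).map
    fun i => decide (eval r bit (ext i (params N Δ)) ≠ 0)

theorem emit_runs (bit : Expr) {N Δ m V T : ℕ} {r : List Bool} {S : Stk} (h0 : S 0 = r)
    (h1 : S 1 = U N) (h2 : S 2 = U Δ) (h3 : ∀ k, 3 ≤ k → S k = [])
    (hb : ∀ i < m, eval r bit (ext i (params N Δ)) ≤ V ∧ ∀ (v : ℕ → ℕ) (b : ℕ) (S : Stk),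
      Holds r (ext i (params N Δ)) v b S → Runs (compile bit v b) S T
        (Function.update S b (U (eval r bit (ext i (params N Δ)))))) :
    Runs (loop 6 (seq (drop 6) (seq (compile bit (ext 5 stackOf) 7)
      (seq (case 7 (push 4 false) skip (seq (push 4 true) (clear 7))) (push 5 true)))))
      (Function.update S 6 (U m)) (m * (2 + (T + ((1 + (3 * V + 1) + 1) + 1)) + 1) + 1)
      (Function.update (Function.update S 5 (U m)) 4 ((List.range m).map
        fun i => decide (eval r bit (ext i (params N Δ)) ≠ 0)).reverse) := by
  set B : ℕ → List Bool := fun i => (List.range i).map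
    fun i => decide (eval r bit (ext i (params N Δ)) ≠ 0) with hB
  have hB0 : B 0 = [] := rfl
  have hBs : ∀ i, B (i + 1) = B i ++ [decide (eval r bit (ext i (params N Δ)) ≠ 0)] := by
    intro i
    simp [hB, List.range_succ]
  clear_value B
  have h33 := h3 3 (by norm_num)
  have h34 := h3 4 (by norm_num)
  have h35 := h3 5 (by norm_num)
  have h36 := h3 6 (by norm_num)
  have h37 := h3 7 (by norm_num)
  have hU : U 0 = [] := rfl
  have h4 := Runs.loop (k := 6) (p := .seq (drop 6) (.seq (compile bit (ext 5 stackOf) 7)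
      (.seq (.case 7 (.push 4 false) .skip (.seq (.push 4 true) (clear 7))) (.push 5 true)))) m
    (fun i => Function.update (Function.update (Function.update S 6 (U (m - i))) 5 (U i)) 4
      (B i).reverse) (T := 2 + (T + ((1 + (3 * V + 1) + 1) + 1)))
    (fun i hi => by simp; omega)
    (fun i hi => by
      obtain ⟨hVi, hTi⟩ := hb i hi
      clear hb
      have e1 : (U (m - i)).tail = U (m - (i + 1)) := by
        rw [List.tail_replicate]; congr 1
      have e3 := U_cons i
      have hH : Holds r (ext i (params N Δ)) (ext 5 stackOf) 7 (Function.update (Function.update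
          (Function.update S 6 (U (m - (i + 1)))) 5 (U i)) 4 (B i).reverse) → _ :=
        hTi (ext 5 stackOf) 7 _
      clear hTi
      have k2 := hH (by
        refine Holds.ext (x := i) (c := 5)
          ⟨?_, fun j => ?_, fun j => ?_, fun j => ?_, fun k hk => ?_⟩
          (by norm_num) (by norm_num) ?_
        · simp [h0]
        · rcases j with _ | _ | j <;> simp [stackOf]
        · rcases j with _ | _ | j <;> simp [stackOf]
        · rcases j with _ | _ | j <;> simp [stackOf, params, h1, h2, h33]
        · rw [Function.update_of_ne (by omega), Function.update_of_ne (by omega),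
            Function.update_of_ne (by omega), h3 k (by omega)]
        · simp)
      clear hH h3
      have hBi := hBs i
      clear hBs hB
      generalize eval r bit (ext i (params N Δ)) = c at *
      refine (Runs.drop).seq ((k2.from_to ?_ le_rfl rfl).seq
        (Runs.seq (S' := Function.update (Function.update (Function.update S 6
          (U (m - (i + 1)))) 5 (U i)) 4 (B (i + 1)).reverse) ?_ ((Runs.push _ _ _).to le_rfl ?_)))
      · clear k2
        funext j; grind
      · clear k2
        rcases c with _ | c
        · refine (Runs.caseE (by simp) (Runs.push _ _ _)).to (by omega) ?_
          funext j; grind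
        · refine (Runs.caseT (l := U c) (by simp [List.replicate_succ])
            ((Runs.push _ _ _).seq (Runs.clear _ _))).to ?_ ?_
          · simp; omega
          · funext j; grind
      · clear k2
        funext j; grind)
    (by simp)
  clear hb
  refine h4.from_to ?_ le_rfl ?_
  · funext j; grind
  · rw [Nat.sub_self,
      show Function.update S 6 (U 0) = S by rw [hU, ← h36, Function.update_eq_self], hB]

theorem sampler_runs (len bit : Expr) : ∃ T : Polynomial ℕ, ∀ (N Δ : ℕ) (r : List Bool),
    Runs (sampler len bit) (Function.update (fun _ => []) 0
      (U N ++ false :: (U Δ ++ false :: r)))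
      (T.eval (U N ++ false :: (U Δ ++ false :: r)).length)
      (Function.update (fun _ => []) 3 (samplerOut len bit N Δ r)) := by
  obtain ⟨V, T, hlen⟩ := len.exists_bounds
  obtain ⟨V', T', hbit⟩ := bit.exists_bounds
  set X : Polynomial ℕ := Polynomial.X
  refine ⟨(5 * X + 6) + ((5 * X + 6) + (T + ((V * (2 + (T'.comp (X + V) + ((1 + (3 *
    V'.comp (X + V) + 1) + 1) + 1)) + 1) + 1) + ((3 * V + 1) + ((3 * X + 1) + ((3 * X + 1) +
      ((3 * X + 1) + (3 * V + 1)))))))), fun N Δ r => ?_⟩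
  set x := (U N ++ false :: (U Δ ++ false :: r)).length with hx
  have hx' : x = N + (Δ + (r.length + 1) + 1) := by simp [hx]
  have h1 := Runs.readUnary (k := 1) (f := 3) (m := N) (l := U Δ ++ false :: r)
    (S := Function.update (fun _ => []) 0 (U N ++ false :: (U Δ ++ false :: r)))
    (by norm_num) (by norm_num) (by norm_num) (by simp) (by simp) (by simp)
  have h2 := Runs.readUnary (k := 2) (f := 3) (m := Δ) (l := r)
    (S := Function.update (Function.update (Function.update (fun _ => []) 0
      (U N ++ false :: (U Δ ++ false :: r))) 0 (U Δ ++ false :: r)) 1 (U N))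
    (by norm_num) (by norm_num) (by norm_num) (by simp) (by simp) (by simp)
  set S : Stk := fun j => if j = 0 then r else if j = 1 then U N else if j = 2 then U Δ else []
    with hS
  have hparams : ∀ i, params N Δ i ≤ x := by
    intro i
    rcases i with _ | _ | i <;> simp only [params, ext_zero, ext_succ] <;> omega
  have hSH : Holds r (params N Δ) stackOf 6 S := by
    refine ⟨rfl, fun i => ?_, fun i => ?_, fun i => ?_, fun k hk => ?_⟩
    · rcases i with _ | _ | i <;> simp [stackOf]
    · rcases i with _ | _ | i <;> simp [stackOf]
    · rcases i with _ | _ | i <;> simp [stackOf, hS, params]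
    · simp only [hS]
      rw [if_neg (by omega), if_neg (by omega), if_neg (by omega)]
  obtain ⟨hV, hT⟩ := hlen x r (params N Δ) (by omega) hparams
  have h3 := hT stackOf 6 S hSH
  set y := x + V.eval x with hy
  set m := eval r len (params N Δ) with hm
  have hb : ∀ i < m, _ := fun i hi =>
    hbit y r (ext i (params N Δ)) (by omega) (fun j => by
      cases j with
      | zero => simp only [ext_zero]; omega
      | succ j => have := hparams j; simp only [ext_succ]; omega)
  have hS3 : ∀ k, 3 ≤ k → S k = [] := fun k hk => by
    simp only [hS]
    rw [if_neg (by omega), if_neg (by omega), if_neg (by omega)]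
  have h4 := emit_runs bit (S := S) (r := r) rfl rfl rfl hS3 hb
  set B := (List.range m).map fun i => decide (eval r bit (ext i (params N Δ)) ≠ 0) with hB
  have hBm : samplerOut len bit N Δ r = B := rfl
  have hBl : B.length = m := by simp [hB]
  rw [hBm]
  clear_value B
  have e : Function.update (Function.update (Function.update (Function.update (Function.update
      (fun _ => []) 0 (U N ++ false :: (U Δ ++ false :: r))) 0 (U Δ ++ false :: r)) 1 (U N)) 0 r)
      2 (U Δ) = S := by
    clear h1 h2 h3 h4 hlen hbit hT hSH hb
    funext j
    simp only [hS, Function.update_apply]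
    split_ifs <;> simp_all
  rw [e] at h2
  refine (h1.seq (h2.seq (h3.seq (h4.seq ((Runs.clear 5 _).seq
    ((Runs.clear 2 _).seq ((Runs.clear 1 _).seq ((Runs.clear 0 _).seq
      (Runs.move (a := 4) (b := 3) (by norm_num) _))))))))).to ?_ ?_
  · simp only [Polynomial.eval_add, Polynomial.eval_mul, Polynomial.eval_ofNat,
      Polynomial.eval_one, Polynomial.eval_comp, X, Polynomial.eval_X, ← hy, hS]
    simp [hBl]
    gcongr <;> omega
  · clear h1 h2 h3 h4 hlen hbit hT hSH hb
    funext j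
    simp only [hS, Function.update_apply]
    split_ifs <;> simp_all

end Expr

/-- The output of a sampling program is computed in polynomial time. -/
theorem Expr.samplerOut_polyTime (A : Set (ℕ × ℕ)) (q : Polynomial ℕ) (len bit : Expr) :
    Nonempty (Turing.TM2ComputableInPolyTime (SamplerInput.encode (S := A) (q := q))
      (id : List Bool → List Bool)
      (fun a => samplerOut len bit a.N a.Δ (List.ofFn a.coins))) := by
  obtain ⟨T, hT⟩ := sampler_runs len bit
  refine computableInPolyTime (sampler len bit) 3 ?_ T fun a => hT a.N a.Δ (List.ofFn a.coins)
  simp [sampler, readUnary, width]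

end

/-! ### Functions definable by expressions -/

/-- The coins and the values of the variables. -/
abbrev Ctx := List Bool × (ℕ → ℕ)

/-- The value of variable `0`. -/
def Ctx.head (c : Ctx) : ℕ := c.2 0

/-- Forget variable `0`. -/
def Ctx.tail (c : Ctx) : Ctx := (c.1, fun i => c.2 (i + 1))

/-- Add a new variable `0`. -/
def Ctx.cons (x : ℕ) (c : Ctx) : Ctx := (c.1, ext x c.2)

/-- A function definable by an expression. -/
def Feas (f : Ctx → ℕ) : Prop := ∃ e : Expr, ∀ c : Ctx, e.eval c.1 c.2 = f c

/-- The indicator of a proposition. -/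
noncomputable def ind (p : Prop) : ℕ := by classical exact if p then 1 else 0

@[simp] theorem ind_of_true {p : Prop} (h : p) : ind p = 1 := by simp [ind, h]
@[simp] theorem ind_of_false {p : Prop} (h : ¬p) : ind p = 0 := by simp [ind, h]
theorem ind_eq_ite (p : Prop) [Decidable p] : ind p = if p then 1 else 0 := by
  by_cases h : p <;> simp [h]

/-- A predicate whose indicator is definable by an expression. -/
def FeasP (p : Ctx → Prop) : Prop := Feas fun c => ind (p c)

/-- Rename the variables of an expression. -/
def Expr.rename : Expr → (ℕ → ℕ) → Expr
  | one, _ => one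
  | var i, s => var (s i)
  | add e e', s => add (e.rename s) (e'.rename s)
  | sub e e', s => sub (e.rename s) (e'.rename s)
  | sum n e, s => sum (n.rename s) (e.rename (ext 0 fun i => s i + 1))
  | coin e, s => coin (e.rename s)

theorem Expr.eval_rename (r : List Bool) (e : Expr) : ∀ (s env : ℕ → ℕ),
    (e.rename s).eval r env = e.eval r (fun i => env (s i)) := by
  induction e with
  | one => intro s env; rfl
  | var i => intro s env; rfl
  | add e e' ih ih' => intro s env; simp only [rename, eval, ih, ih']
  | sub e e' ih ih' => intro s env; simp only [rename, eval, ih, ih']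
  | sum n e ih ih' =>
    intro s env
    simp only [rename, eval, ih, ih']
    refine Finset.sum_congr rfl fun i _ => ?_
    congr 1
    funext j
    cases j <;> rfl
  | coin e ih => intro s env; simp only [rename, eval, ih]

namespace Feas

theorem congr {f g : Ctx → ℕ} (hf : Feas f) (h : ∀ c, f c = g c) : Feas g :=
  let ⟨e, he⟩ := hf
  ⟨e, fun c => (he c).trans (h c)⟩

theorem var (i : ℕ) : Feas fun c => c.2 i := ⟨.var i, fun _ => rfl⟩

theorem head : Feas Ctx.head := var 0

theorem tail {f : Ctx → ℕ} (hf : Feas f) : Feas fun c => f c.tail :=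
  let ⟨e, he⟩ := hf
  ⟨e.rename Nat.succ, fun c => (e.eval_rename _ _ _).trans (he c.tail)⟩

theorem add {f g : Ctx → ℕ} (hf : Feas f) (hg : Feas g) : Feas fun c => f c + g c :=
  let ⟨e, he⟩ := hf
  let ⟨e', he'⟩ := hg
  ⟨.add e e', fun c => by rw [Expr.eval, he, he']⟩

theorem sub {f g : Ctx → ℕ} (hf : Feas f) (hg : Feas g) : Feas fun c => f c - g c :=
  let ⟨e, he⟩ := hf
  let ⟨e', he'⟩ := hg
  ⟨.sub e e', fun c => by rw [Expr.eval, he, he']⟩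

theorem const (n : ℕ) : Feas fun _ => n := by
  induction n with
  | zero => exact ⟨.sub .one .one, fun c => rfl⟩
  | succ n ih => exact ih.add ⟨.one, fun c => rfl⟩

theorem sum {n : Ctx → ℕ} {F : Ctx → ℕ → ℕ} (hn : Feas n) (hF : Feas fun c => F c.tail c.head) :
    Feas fun c => ∑ i ∈ Finset.range (n c), F c i :=
  let ⟨e, he⟩ := hn
  let ⟨e', he'⟩ := hF
  ⟨.sum e e', fun c => by
    rw [Expr.eval, he]
    exact Finset.sum_congr rfl fun i _ => he' (c.cons i)⟩

theorem coin {f : Ctx → ℕ} (hf : Feas f) : Feas fun c => (c.1.getD (f c) false).toNat :=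
  let ⟨e, he⟩ := hf
  ⟨.coin e, fun c => by rw [Expr.eval, he]⟩

theorem mul {f g : Ctx → ℕ} (hf : Feas f) (hg : Feas g) : Feas fun c => f c * g c :=
  (sum (F := fun c _ => g c) hf hg.tail).congr fun c => by simp

end Feas

namespace FeasP

theorem congr {p p' : Ctx → Prop} (hp : FeasP p) (h : ∀ c, p c ↔ p' c) : FeasP p' :=
  Feas.congr hp fun c => by rw [propext (h c)]

theorem le {f g : Ctx → ℕ} (hf : Feas f) (hg : Feas g) : FeasP fun c => f c ≤ g c :=
  ((Feas.const 1).sub (hf.sub hg)).congr fun c => by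
    rw [ind_eq_ite]
    split_ifs <;> omega

theorem lt {f g : Ctx → ℕ} (hf : Feas f) (hg : Feas g) : FeasP fun c => f c < g c :=
  le (hf.add (.const 1)) hg

theorem not {p : Ctx → Prop} (hp : FeasP p) : FeasP fun c => ¬p c :=
  ((Feas.const 1).sub hp).congr fun c => by by_cases h : p c <;> simp [h]

theorem and {p p' : Ctx → Prop} (hp : FeasP p) (hp' : FeasP p') : FeasP fun c => p c ∧ p' c :=
  (Feas.mul hp hp').congr fun c => by by_cases h : p c <;> by_cases h' : p' c <;> simp [h, h']

theorem imp {p p' : Ctx → Prop} (hp : FeasP p) (hp' : FeasP p') : FeasP fun c => p c → p' c :=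
  (hp.and hp'.not).not.congr fun c => by tauto

theorem or {p p' : Ctx → Prop} (hp : FeasP p) (hp' : FeasP p') : FeasP fun c => p c ∨ p' c :=
  (hp.not.and hp'.not).not.congr fun c => by tauto

theorem eq {f g : Ctx → ℕ} (hf : Feas f) (hg : Feas g) : FeasP fun c => f c = g c :=
  ((le hf hg).and (le hg hf)).congr fun _ => le_antisymm_iff.symm

/-- Bounded quantification. -/
theorem ball {n : Ctx → ℕ} {P : Ctx → ℕ → Prop} (hn : Feas n)
    (hP : FeasP fun c => P c.tail c.head) : FeasP fun c => ∀ i < n c, P c i :=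
  (eq (Feas.sum (F := fun c i => ind (¬P c i)) hn hP.not) (.const 0)).congr fun c => by
    rw [Finset.sum_eq_zero_iff]
    refine forall_congr' fun i => ?_
    rw [Finset.mem_range]
    refine imp_congr_right fun _ => ?_
    by_cases h : P c i <;> simp [h]

end FeasP

namespace Feas

theorem ite {p : Ctx → Prop} {f g : Ctx → ℕ} [∀ c, Decidable (p c)] (hp : FeasP p) (hf : Feas f)
    (hg : Feas g) : Feas fun c => if p c then f c else g c :=
  ((Feas.mul hp hf).add (Feas.mul hp.not hg)).congr fun c => by by_cases h : p c <;> simp [h]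

theorem div {f g : Ctx → ℕ} (hf : Feas f) (hg : Feas g) : Feas fun c => f c / g c :=
  (ite (p := fun c => 0 < g c) (FeasP.lt (.const 0) hg) (Feas.sum (n := f)
    (F := fun c i => ind ((i + 1) * g c ≤ f c)) hf
      (FeasP.le ((head.add (.const 1)).mul hg.tail) hf.tail)) (.const 0)).congr fun c => by
    split_ifs with h
    · have : ∀ i, (i + 1) * g c ≤ f c ↔ i < f c / g c := fun i => by
        rw [Nat.lt_iff_add_one_le, Nat.le_div_iff_mul_le h]
      simp only [this, ind_eq_ite, Finset.sum_boole, Nat.cast_id]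
      rw [show (Finset.range (f c)).filter (fun i => i < f c / g c) =
        Finset.range (f c / g c) from ?_, Finset.card_range]
      ext i
      simp only [Finset.mem_filter, Finset.mem_range]
      have := Nat.div_le_self (f c) (g c)
      omega
    · rw [show g c = 0 by omega, Nat.div_zero]

theorem mod {f g : Ctx → ℕ} (hf : Feas f) (hg : Feas g) : Feas fun c => f c % g c :=
  (hf.sub (hg.mul (hf.div hg))).congr fun _ => (Nat.mod_eq_sub _ _).symm

theorem min {f g : Ctx → ℕ} (hf : Feas f) (hg : Feas g) : Feas fun c => Min.min (f c) (g c) :=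
  (ite (FeasP.le hf hg) hf hg).congr fun _ => (min_def _ _).symm

end Feas

/-- Powers of two are the positive numbers without odd divisors other than `1`. -/
theorem exists_eq_two_pow_iff (y : ℕ) :
    (∃ k, y = 2 ^ k) ↔ 0 < y ∧ ∀ d < y + 1, y % d = 0 → (d = 1 ∨ d % 2 = 0) := by
  constructor
  · rintro ⟨k, rfl⟩
    refine ⟨by positivity, fun d _ hd => ?_⟩
    obtain ⟨i, _, rfl⟩ := (Nat.dvd_prime_pow Nat.prime_two).1 (Nat.dvd_of_mod_eq_zero hd)
    rcases i with _ | i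
    · exact Or.inl rfl
    · exact Or.inr (by rw [pow_succ]; omega)
  · rintro ⟨hy, h⟩
    rcases Nat.eq_two_pow_or_exists_odd_prime_and_dvd y with hk | ⟨p, hp, hpy, hodd⟩
    · exact hk
    · exfalso
      rcases h p (Nat.lt_succ_of_le (Nat.le_of_dvd hy hpy)) (Nat.mod_eq_zero_of_dvd hpy) with h | h
      · exact hp.one_lt.ne' h
      · rw [Nat.odd_iff] at hodd
        omega

theorem FeasP.isPow {f : Ctx → ℕ} (hf : Feas f) : FeasP fun c => ∃ k, f c = 2 ^ k :=
  ((FeasP.lt (.const 0) hf).and (FeasP.ball (n := fun c => f c + 1)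
    (P := fun c d => f c % d = 0 → (d = 1 ∨ d % 2 = 0)) (hf.add (.const 1))
      ((FeasP.eq (hf.tail.mod .head) (.const 0)).imp ((FeasP.eq .head (.const 1)).or
        (FeasP.eq (Feas.head.mod (.const 2)) (.const 0)))))).congr
    fun c => (exists_eq_two_pow_iff (f c)).symm

namespace Feas

theorem log {f : Ctx → ℕ} (hf : Feas f) : Feas fun c => Nat.log 2 (f c) :=
  (Feas.sum (n := fun c => f c + 1) (F := fun _ y => ind (2 ≤ y ∧ ∃ k, y = 2 ^ k))
    (hf.add (.const 1)) ((FeasP.le (.const 2) .head).and (FeasP.isPow .head))).congr fun c => by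
    classical
    simp only [ind_eq_ite, Finset.sum_boole, Nat.cast_id]
    rw [show (Finset.range (f c + 1)).filter (fun y => 2 ≤ y ∧ ∃ k, y = 2 ^ k) =
      (Finset.range (Nat.log 2 (f c))).image (fun k => 2 ^ (k + 1)) from ?_,
      Finset.card_image_of_injective, Finset.card_range]
    · intro a b hab
      have := Nat.pow_right_injective le_rfl hab
      omega
    · ext y
      simp only [Finset.mem_filter, Finset.mem_range, Finset.mem_image]
      constructor
      · rintro ⟨hy, h2, k, rfl⟩
        rcases k with _ | k
        · norm_num at h2
        · have := Nat.le_log_of_pow_le one_lt_two (Nat.lt_succ_iff.1 hy)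
          exact ⟨k, by omega, rfl⟩
      · rintro ⟨k, hk, rfl⟩
        refine ⟨Nat.lt_succ_of_le (Nat.pow_le_of_le_log ?_ (by omega)), ?_, k + 1, rfl⟩
        · intro h0; rw [h0] at hk; simp at hk
        · rw [pow_succ]; have := Nat.one_le_two_pow (n := k); omega

theorem pow {f g : Ctx → ℕ} (hf : Feas f) (hg : Feas g) (h : ∀ c, 2 ^ f c ≤ g c) :
    Feas fun c => 2 ^ f c :=
  (Feas.sum (n := fun c => g c + 1)
    (F := fun c y => ind ((∃ k, y = 2 ^ k) ∧ Nat.log 2 y = f c) * y)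
    (hg.add (.const 1)) (Feas.mul ((FeasP.isPow .head).and (FeasP.eq head.log hf.tail))
      .head)).congr fun c => by
    rw [Finset.sum_eq_single_of_mem (2 ^ f c) (Finset.mem_range.2 (Nat.lt_succ_of_le (h c)))]
    · rw [ind_of_true ⟨⟨_, rfl⟩, Nat.log_pow one_lt_two _⟩, one_mul]
    · rintro y _ hy
      rw [ind_of_false, zero_mul]
      rintro ⟨⟨k, rfl⟩, hk⟩
      rw [Nat.log_pow one_lt_two] at hk
      exact hy (by rw [hk])

theorem divPow {f g : Ctx → ℕ} (hf : Feas f) (hg : Feas g) : Feas fun c => f c / 2 ^ g c :=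
  (Feas.sum (n := fun c => f c + 1)
    (F := fun c y => ind ((∃ k, y = 2 ^ k) ∧ Nat.log 2 y = g c) * (f c / y))
    (hf.add (.const 1)) (Feas.mul ((FeasP.isPow .head).and (FeasP.eq head.log hg.tail))
      (hf.tail.div .head))).congr fun c => by
    by_cases h : 2 ^ g c ≤ f c
    · rw [Finset.sum_eq_single_of_mem (2 ^ g c) (Finset.mem_range.2 (Nat.lt_succ_of_le h))]
      · rw [ind_of_true ⟨⟨_, rfl⟩, Nat.log_pow one_lt_two _⟩, one_mul]
      · rintro y _ hy
        rw [ind_of_false, zero_mul]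
        rintro ⟨⟨k, rfl⟩, hk⟩
        rw [Nat.log_pow one_lt_two] at hk
        exact hy (by rw [hk])
    · rw [Nat.div_eq_of_lt (not_le.1 h)]
      refine Finset.sum_eq_zero fun y hy => ?_
      rw [ind_of_false, zero_mul]
      rintro ⟨⟨k, rfl⟩, hk⟩
      rw [Nat.log_pow one_lt_two] at hk
      rw [Finset.mem_range, hk] at hy
      omega

end Feas

/-- The binary digit of `x` at position `j`. -/
def bit (x j : ℕ) : ℕ := x / 2 ^ j % 2

theorem Feas.bit {f g : Ctx → ℕ} (hf : Feas f) (hg : Feas g) : Feas fun c => bit (f c) (g c) :=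
  (hf.divPow hg).mod (.const 2)

/-- Bounded search for the least number with a property, with value `0` if there is none. -/
theorem Feas.search {n : Ctx → ℕ} {P : Ctx → ℕ → Prop} (hn : Feas n)
    (hP : FeasP fun c => P c.tail c.head) :
    Feas fun c => ∑ i ∈ Finset.range (n c), ind (P c i ∧ ∀ j < i, ¬P c j) * i :=
  Feas.sum (F := fun c i => ind (P c i ∧ ∀ j < i, ¬P c j) * i) hn (Feas.mul
    (hP.and (FeasP.ball (n := Ctx.head) (P := fun c j => ¬P c.tail j) .head (by
      obtain ⟨e, he⟩ := hP
      refine FeasP.not (p := fun c => P c.tail.tail c.head)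
        ⟨e.rename (ext 0 fun i => i + 2), fun c => ?_⟩
      refine (e.eval_rename _ _ _).trans (.trans ?_ (he (c.tail.tail.cons c.head)))
      congr 1
      funext i
      cases i <;> rfl)))
    .head)

/-! ### The search for a good truth table -/

/-- The number of ones among the first `m` binary digits. -/
def weight (m S : ℕ) : ℕ := ∑ k ∈ Finset.range m, bit S k

/-- The value at `u` of the `i`-th of the `10 q` polynomials in `20 q` variables over the field of
two elements that are coded by `F`. The polynomials have degree at most `q`. Points and monomials
are numbers less than `2 ^ (20 q)`, read as subsets of the set of variables, and the digit
`10 q S + i` of `F` is the coefficient of the monomial `S` in polynomial `i`. -/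
noncomputable def coord (q F i u : ℕ) : ℕ :=
  (∑ S ∈ Finset.range (2 ^ (20 * q)),
    ind (weight (20 * q) S ≤ q ∧ ∀ k < 20 * q, bit S k ≤ bit u k) * bit F (S * (10 * q) + i)) % 2

/-- The number of points that the polynomials coded by `F` map to `z`. -/
noncomputable def hits (q F z : ℕ) : ℕ :=
  ∑ u ∈ Finset.range (2 ^ (20 * q)), ind (∀ i < 10 * q, coord q F i u = bit z i)

/-- The truncated mass that the source coded by `F` gives to the set with characteristic
function `h`. -/
noncomputable def mass (q h F : ℕ) : ℕ :=
  ∑ z ∈ Finset.range (2 ^ (10 * q)), bit h z * min (hits q F z) (2 ^ (11 * q))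

/-- The set with characteristic function `h` has density at least `num / den`, and every source of
degree `q` with `20 q` inputs and `10 q` outputs gives it truncated mass at most
`num / den + 2 ^ (-q)`. -/
def IsGood (q num den h : ℕ) : Prop :=
  num * 2 ^ (10 * q) ≤ den * ∑ z ∈ Finset.range (2 ^ (10 * q)), bit h z ∧
    ∀ F < 2 ^ (10 * q * 2 ^ (20 * q)),
      den * 2 ^ q * mass q h F ≤ (num * 2 ^ q + den) * 2 ^ (20 * q)

/-- The first good truth table. -/
noncomputable def table (q num den : ℕ) : ℕ :=
  ∑ h ∈ Finset.range (2 ^ 2 ^ (10 * q)), ind (IsGood q num den h ∧ ∀ j < h, ¬IsGood q num den j) * h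

theorem isGood_table {q num den h : ℕ} (hh : h < 2 ^ 2 ^ (10 * q)) (hg : IsGood q num den h) :
    IsGood q num den (table q num den) := by
  classical
  have hex : ∃ h, IsGood q num den h := ⟨h, hg⟩
  have : table q num den = Nat.find hex := by
    rw [table, Finset.sum_eq_single_of_mem (Nat.find hex)
      (Finset.mem_range.2 ((Nat.find_le hg).trans_lt hh))]
    · rw [ind_of_true ⟨Nat.find_spec hex, fun j hj => Nat.find_min hex hj⟩, one_mul]
    · intro j _ hj
      rw [ind_of_false, zero_mul]
      rintro ⟨h1, h2⟩
      exact hj ((Nat.find_eq_iff hex).2 ⟨h1, h2⟩).symm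
  rw [this]
  exact Nat.find_spec hex

namespace Feas

theorem weight {m S : Ctx → ℕ} (hm : Feas m) (hS : Feas S) : Feas fun c => weight (m c) (S c) :=
  sum (F := fun c k => HardDist.bit (S c) k) hm (bit hS.tail head)

theorem coord {q F i u : Ctx → ℕ} (hq : Feas q) (hF : Feas F) (hi : Feas i) (hu : Feas u)
    (hp : Feas fun c => 2 ^ (20 * q c)) : Feas fun c => coord (q c) (F c) (i c) (u c) :=
  mod (sum (F := fun c S => ind (HardDist.weight (20 * q c) S ≤ q c ∧
      ∀ k < 20 * q c, HardDist.bit S k ≤ HardDist.bit (u c) k) *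
        HardDist.bit (F c) (S * (10 * q c) + i c)) hp
    (mul (FeasP.and (FeasP.le (weight ((const 20).mul hq.tail) head) hq.tail)
      (FeasP.ball (n := fun c => 20 * q c.tail)
        (P := fun c k => HardDist.bit c.head k ≤ HardDist.bit (u c.tail) k)
        ((const 20).mul hq.tail) (FeasP.le (bit head.tail head) (bit hu.tail.tail head))))
      (bit hF.tail ((head.mul ((const 10).mul hq.tail)).add hi.tail)))) (const 2)

theorem hits {q F z : Ctx → ℕ} (hq : Feas q) (hF : Feas F) (hz : Feas z)
    (hp : Feas fun c => 2 ^ (20 * q c)) : Feas fun c => hits (q c) (F c) (z c) :=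
  sum (F := fun c u => ind (∀ i < 10 * q c,
      HardDist.coord (q c) (F c) i u = HardDist.bit (z c) i)) hp
    (FeasP.ball (n := fun c => 10 * q c.tail)
      (P := fun c i => HardDist.coord (q c.tail) (F c.tail) i c.head = HardDist.bit (z c.tail) i)
      ((const 10).mul hq.tail)
      (FeasP.eq (coord hq.tail.tail hF.tail.tail head head.tail hp.tail.tail)
        (bit hz.tail.tail head)))

theorem mass {q h F : Ctx → ℕ} (hq : Feas q) (hh : Feas h) (hF : Feas F)
    (hp : Feas fun c => 2 ^ (20 * q c)) (hp' : Feas fun c => 2 ^ (10 * q c))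
    (hp'' : Feas fun c => 2 ^ (11 * q c)) : Feas fun c => mass (q c) (h c) (F c) :=
  sum (F := fun c z => HardDist.bit (h c) z *
      Min.min (HardDist.hits (q c) (F c) z) (2 ^ (11 * q c))) hp'
    (mul (bit hh.tail head) (min (hits hq.tail hF.tail head hp.tail) hp''.tail))

theorem table {q num den g : Ctx → ℕ} (hq : Feas q) (hnum : Feas num) (hden : Feas den)
    (hg : Feas g) (h : ∀ c, 2 ^ (20 * q c) ≤ g c) (h' : ∀ c, 2 ^ 2 ^ (10 * q c) ≤ g c)
    (h'' : ∀ c, 2 ^ (10 * q c * 2 ^ (20 * q c)) ≤ g c) :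
    Feas fun c => table (q c) (num c) (den c) := by
  have hle : ∀ {k}, k ≤ 20 → ∀ c, 2 ^ (k * q c) ≤ g c := fun hk c =>
    (Nat.pow_le_pow_right (by norm_num) (Nat.mul_le_mul_right _ hk)).trans (h c)
  have p1 : Feas fun c => 2 ^ q c := hq.pow hg (by simpa using hle (k := 1) (by norm_num))
  have p10 := ((const 10).mul hq).pow hg (hle (by norm_num))
  have p11 := ((const 11).mul hq).pow hg (hle (by norm_num))
  have p20 := ((const 20).mul hq).pow hg (hle le_rfl)
  have p := p10.pow hg h'
  have p' := (((const 10).mul hq).mul p20).pow hg h''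
  refine search (P := fun c h => IsGood (q c) (num c) (den c) h) p (FeasP.and
    (FeasP.le (hnum.mul p10).tail (hden.tail.mul (sum (n := fun c => 2 ^ (10 * q c.tail))
      (F := fun c z => HardDist.bit c.head z) p10.tail (bit head.tail head))))
    (FeasP.ball (n := fun c => 2 ^ (10 * q c.tail * 2 ^ (20 * q c.tail)))
      (P := fun c F => den c.tail * 2 ^ q c.tail * HardDist.mass (q c.tail) c.head F ≤
        (num c.tail * 2 ^ q c.tail + den c.tail) * 2 ^ (20 * q c.tail)) p'.tail
      (FeasP.le ((hden.mul p1).tail.tail.mul (mass hq.tail.tail head.tail head p20.tail.tail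
          p10.tail.tail p11.tail.tail))
        (((hnum.mul p1).add hden).mul p20).tail.tail)))

end Feas

/-! ### Uniform distributions, and the sampling algorithm -/

/-- A map all of whose fibres have the same size preserves uniform distributions. -/
theorem map_uniform_of_card_fiber {A B : Type} [Fintype A] [Nonempty A] [Fintype B] [Nonempty B]
    [DecidableEq B] (f : A → B) (k : ℕ)
    (h : ∀ b, (Finset.univ.filter fun a => f a = b).card = k) :
    (PMF.uniformOfFintype A).map f = PMF.uniformOfFintype B := by
  have hcard : Fintype.card A = Fintype.card B * k := by
    rw [← Finset.card_univ, Finset.card_eq_sum_card_fiberwise (f := f) (t := Finset.univ) (by simp)]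
    simp [h]
  have hA : Fintype.card A ≠ 0 := Fintype.card_ne_zero
  have hk : k ≠ 0 := by rintro rfl; simp [hcard] at hA
  ext b
  rw [PMF.map_apply, tsum_fintype]
  simp only [PMF.uniformOfFintype_apply]
  rw [← Finset.sum_filter, Finset.sum_const, nsmul_eq_mul]
  have : (Finset.univ.filter fun a => b = f a).card = k := by
    rw [← h b]; congr 1; ext a; simp [eq_comm]
  rw [this, hcard, Nat.cast_mul, ENNReal.mul_inv (by simp) (by simp), mul_comm, mul_assoc,
    ENNReal.inv_mul_cancel (by exact_mod_cast hk) (by simp), mul_one]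

/-- The number with binary digits the first `l` bits of `x`. -/
def prefixNum (l : ℕ) {n : ℕ} (x : Fin n → ZMod 2) : ℕ :=
  ∑ i ∈ Finset.range l, (if h : i < n then (x ⟨i, h⟩).val else 0) * 2 ^ i

/-- The function on bit strings whose value is found in the truth table `h` at the position given
by the first `l` bits. -/
def lookup (l h : ℕ) {n : ℕ} (x : Fin n → ZMod 2) : ZMod 2 := (bit h (prefixNum l x) : ZMod 2)

theorem bit_lt_two (x j : ℕ) : bit x j < 2 := Nat.mod_lt _ (by norm_num)

theorem zmod_two_eq_one_iff {b : ℕ} (hb : b < 2) : ((b : ZMod 2) = 1) ↔ b ≠ 0 := by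
  interval_cases b <;> decide

/-- The strings `u_1, …, u_t` made of the first `t n` coins. -/
def coinStrings {N t n : ℕ} (h : t * n ≤ N) (r : Fin N → Bool) : Fin t → Fin n → ZMod 2 :=
  fun j i => if r (Fin.castLE h (finProdFinEquiv (j, i))) then 1 else 0

theorem map_coinStrings {N t n : ℕ} (h : t * n ≤ N) :
    (PMF.uniformOfFintype (Fin N → Bool)).map (coinStrings h) =
      PMF.uniformOfFintype (Fin t → Fin n → ZMod 2) := by
  classical
  refine map_uniform_of_card_fiber _
    (∏ k : Fin N, if (k : ℕ) < t * n then 1 else 2) fun b => ?_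
  have : (Finset.univ.filter fun r => coinStrings h r = b) = Fintype.piFinset fun k : Fin N =>
      if hk : (k : ℕ) < t * n then {decide (b (finProdFinEquiv.symm ⟨k, hk⟩).1
        (finProdFinEquiv.symm ⟨k, hk⟩).2 = 1)} else Finset.univ := by
    ext r
    simp only [Finset.mem_filter, Finset.mem_univ, true_and, Fintype.mem_piFinset]
    have h01 : ∀ y : ZMod 2, y = 0 ∨ y = 1 := by decide
    constructor
    · rintro rfl k
      split_ifs with hk
      · have e : finProdFinEquiv ((finProdFinEquiv.symm (⟨k, hk⟩ : Fin (t * n))).1,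
            (finProdFinEquiv.symm (⟨k, hk⟩ : Fin (t * n))).2) = ⟨k, hk⟩ :=
          finProdFinEquiv.apply_symm_apply _
        simp only [coinStrings, e]
        rw [Finset.mem_singleton, show Fin.castLE h ⟨k, hk⟩ = k from rfl]
        cases r k <;> simp
      · simp
    · intro hr
      funext j i
      have := hr (Fin.castLE h (finProdFinEquiv (j, i)))
      rw [dif_pos (show ((Fin.castLE h (finProdFinEquiv (j, i)) : Fin N) : ℕ) < t * n from
        (finProdFinEquiv (j, i)).2), Finset.mem_singleton] at this
      have e : (⟨((Fin.castLE h (finProdFinEquiv (j, i)) : Fin N) : ℕ),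
        (finProdFinEquiv (j, i)).2⟩ : Fin (t * n)) = finProdFinEquiv (j, i) := rfl
      rw [e, Equiv.symm_apply_apply] at this
      simp only [coinStrings, this]
      rcases h01 (b j i) with hb | hb <;> simp [hb]
  rw [this, Fintype.card_piFinset]
  refine Finset.prod_congr rfl fun k _ => ?_
  split_ifs <;> simp

theorem graphString_castAdd {n t : ℕ} (Iso : (Fin n → ZMod 2) → ZMod 2)
    (u : Fin t → Fin n → ZMod 2) (p : Fin (t * n)) : graphString t Iso u (Fin.castAdd t p) =
      u (finProdFinEquiv.symm p).1 (finProdFinEquiv.symm p).2 :=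
  Fin.append_left _ _ _

theorem graphString_natAdd {n t : ℕ} (Iso : (Fin n → ZMod 2) → ZMod 2)
    (u : Fin t → Fin n → ZMod 2) (j : Fin t) :
    graphString t Iso u (Fin.natAdd (t * n) j) = Iso (u j) :=
  Fin.append_right _ _ _

/-- If its parameters are definable by expressions, then the distribution
`(U_1, …, U_t, h(U_1), …, h(U_t))` for the first good truth table `h` can be sampled. -/
theorem polyTimeSamplable_hardDist (A : Set (ℕ × ℕ)) (q t num den : ℕ → ℕ → ℕ)
    (g : ℕ → ℕ → ℕ)
    (hq : Feas fun c => q (c.2 0) (c.2 1)) (ht : Feas fun c => t (c.2 0) (c.2 1))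
    (hnum : Feas fun c => num (c.2 0) (c.2 1)) (hden : Feas fun c => den (c.2 0) (c.2 1))
    (hg : Feas fun c => g (c.2 0) (c.2 1)) (h : ∀ N Δ, 2 ^ (20 * q N Δ) ≤ g N Δ)
    (h' : ∀ N Δ, 2 ^ 2 ^ (10 * q N Δ) ≤ g N Δ)
    (h'' : ∀ N Δ, 2 ^ (10 * q N Δ * 2 ^ (20 * q N Δ)) ≤ g N Δ)
    (hN : ∀ N Δ, (N, Δ) ∈ A → t N Δ * 2 ^ (10 * q N Δ) ≤ N) :
    PolyTimeSamplable A (fun N Δ => hardDist (t N Δ)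
      (lookup (n := 2 ^ (10 * q N Δ)) (10 * q N Δ) (table (q N Δ) (num N Δ) (den N Δ)))) := by
  have hle : ∀ {k}, k ≤ 20 → ∀ c : Ctx, 2 ^ (k * q (c.2 0) (c.2 1)) ≤ g (c.2 0) (c.2 1) :=
    fun hk c => (Nat.pow_le_pow_right (by norm_num) (Nat.mul_le_mul_right _ hk)).trans (h _ _)
  have p10 := ((Feas.const 10).mul hq).pow hg (hle (by norm_num))
  have ptable := Feas.table hq hnum hden hg (fun c => h _ _) (fun c => h' _ _) (fun c => h'' _ _)
  obtain ⟨len, hlen⟩ : Feas fun c => t (c.2 0) (c.2 1) * 2 ^ (10 * q (c.2 0) (c.2 1)) +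
      t (c.2 0) (c.2 1) := (ht.mul p10).add ht
  have hpow : Feas fun c : Ctx => ind (c.head < 10 * q (c.tail.tail.2 0) (c.tail.tail.2 1)) *
      2 ^ min c.head (10 * q (c.tail.tail.2 0) (c.tail.tail.2 1)) :=
    Feas.mul (FeasP.lt .head ((Feas.const 10).mul hq).tail.tail)
      ((Feas.min .head ((Feas.const 10).mul hq).tail.tail).pow hg.tail.tail fun c =>
        (Nat.pow_le_pow_right (by norm_num) (min_le_right _ _)).trans
          (hle (by norm_num) c.tail.tail))
  obtain ⟨b, hb⟩ : Feas fun c => if c.head < t (c.tail.2 0) (c.tail.2 1) *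
      2 ^ (10 * q (c.tail.2 0) (c.tail.2 1)) then (c.1.getD c.head false).toNat else
      bit (table (q (c.tail.2 0) (c.tail.2 1)) (num (c.tail.2 0) (c.tail.2 1))
        (den (c.tail.2 0) (c.tail.2 1)))
        (∑ i ∈ Finset.range (10 * q (c.tail.2 0) (c.tail.2 1)),
          (c.1.getD ((c.head - t (c.tail.2 0) (c.tail.2 1) *
            2 ^ (10 * q (c.tail.2 0) (c.tail.2 1))) * 2 ^ (10 * q (c.tail.2 0) (c.tail.2 1)) + i)
              false).toNat * (ind (i < 10 * q (c.tail.2 0) (c.tail.2 1)) *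
                2 ^ min i (10 * q (c.tail.2 0) (c.tail.2 1)))) :=
    Feas.ite (FeasP.lt .head (ht.mul p10).tail) (Feas.coin .head) (Feas.bit ptable.tail
      (Feas.sum (F := fun (c : Ctx) i => (c.1.getD ((c.head - t (c.tail.2 0) (c.tail.2 1) *
            2 ^ (10 * q (c.tail.2 0) (c.tail.2 1))) * 2 ^ (10 * q (c.tail.2 0) (c.tail.2 1)) + i)
              false).toNat * (ind (i < 10 * q (c.tail.2 0) (c.tail.2 1)) *
                2 ^ min i (10 * q (c.tail.2 0) (c.tail.2 1))))
        ((Feas.const 10).mul hq).tail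
        (Feas.mul (Feas.coin (((Feas.head.tail.sub (ht.mul p10).tail.tail).mul p10.tail.tail).add
          .head)) hpow)))
  refine ⟨Polynomial.X, _, Expr.samplerOut_polyTime A Polynomial.X len b, fun N Δ hA => ?_⟩
  have hX : Polynomial.eval N Polynomial.X = N := Polynomial.eval_X
  have hN' : t N Δ * 2 ^ (10 * q N Δ) ≤ Polynomial.eval N Polynomial.X := by
    rw [hX]; exact hN N Δ hA
  simp only [hardDist]
  rw [← map_coinStrings hN', PMF.map_comp, PMF.map_comp]
  congr 1
  funext r
  simp only [Function.comp]
  have elen : len.eval (List.ofFn r) (Expr.params N Δ) =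
    t N Δ * 2 ^ (10 * q N Δ) + t N Δ := hlen (List.ofFn r, Expr.params N Δ)
  have ebit : ∀ i, b.eval (List.ofFn r) (ext i (Expr.params N Δ)) = _ := fun i =>
    hb (List.ofFn r, ext i (Expr.params N Δ))
  have ebit_coin : ∀ p, p < t N Δ * 2 ^ (10 * q N Δ) →
      b.eval (List.ofFn r) (ext p (Expr.params N Δ)) = ((List.ofFn r).getD p false).toNat :=
    fun p hp => (ebit p).trans (if_pos hp)
  have ebit_table : ∀ p, ¬p < t N Δ * 2 ^ (10 * q N Δ) →
      b.eval (List.ofFn r) (ext p (Expr.params N Δ)) = bit (table (q N Δ) (num N Δ) (den N Δ))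
        (∑ i ∈ Finset.range (10 * q N Δ), ((List.ofFn r).getD ((p - t N Δ * 2 ^ (10 * q N Δ)) *
          2 ^ (10 * q N Δ) + i) false).toNat * (ind (i < 10 * q N Δ) * 2 ^ min i (10 * q N Δ))) :=
    fun p hp => (ebit p).trans (if_neg hp)
  have hcoin : ∀ {k} (hk : k < t N Δ * 2 ^ (10 * q N Δ)),
      (List.ofFn r).getD k false = r (Fin.castLE hN' ⟨k, hk⟩) := by
    intro k hk
    rw [List.getD_eq_getElem _ _ (by rw [List.length_ofFn]; omega), List.getElem_ofFn]
    rfl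
  have hcs : ∀ j i, (coinStrings hN' r j i).val =
      (r (Fin.castLE hN' (finProdFinEquiv (j, i)))).toNat := by
    intro j i
    simp only [coinStrings]
    cases r (Fin.castLE hN' (finProdFinEquiv (j, i))) <;> rfl
  rw [Expr.samplerOut, bits, elen]
  refine List.ext_getElem (by simp) fun p hp _ => ?_
  simp only [List.length_map, List.length_range] at hp
  simp only [List.getElem_map, List.getElem_range, List.getElem_ofFn]
  refine decide_eq_decide.2 ?_
  by_cases hp' : p < t N Δ * 2 ^ (10 * q N Δ)
  · rw [ebit_coin p hp', hcoin hp']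
    have e : (⟨p, hp⟩ : Fin (t N Δ * 2 ^ (10 * q N Δ) + t N Δ)) = Fin.castAdd _ ⟨p, hp'⟩ := rfl
    rw [e, graphString_castAdd, coinStrings, Prod.mk.eta, Equiv.apply_symm_apply]
    cases r (Fin.castLE hN' ⟨p, hp'⟩) <;> simp
  · rw [ebit_table p hp']
    have hj : p - t N Δ * 2 ^ (10 * q N Δ) < t N Δ := by omega
    have e : (⟨p, hp⟩ : Fin (t N Δ * 2 ^ (10 * q N Δ) + t N Δ)) =
        Fin.natAdd _ ⟨p - t N Δ * 2 ^ (10 * q N Δ), hj⟩ := by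
      ext; simp only [Fin.natAdd_mk]; omega
    rw [e, graphString_natAdd, lookup, zmod_two_eq_one_iff (bit_lt_two _ _), prefixNum]
    refine iff_of_eq (congrArg (fun z => bit _ z ≠ 0) (Finset.sum_congr rfl fun i hi => ?_))
    have hi := Finset.mem_range.1 hi
    have hin : i < 2 ^ (10 * q N Δ) := hi.trans Nat.lt_two_pow_self
    rw [ind_of_true hi, one_mul, min_eq_left hi.le, dif_pos hin, hcs]
    have hk : (p - t N Δ * 2 ^ (10 * q N Δ)) * 2 ^ (10 * q N Δ) + i <
        t N Δ * 2 ^ (10 * q N Δ) := by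
      calc _ < (p - t N Δ * 2 ^ (10 * q N Δ)) * 2 ^ (10 * q N Δ) + 2 ^ (10 * q N Δ) := by omega
        _ = (p - t N Δ * 2 ^ (10 * q N Δ) + 1) * 2 ^ (10 * q N Δ) := by ring
        _ ≤ _ := Nat.mul_le_mul_right _ hj
    rw [hcoin hk]
    congr 4
    ext
    simp [finProdFinEquiv, mul_comm, add_comm]

/-! ### Isolators make distributions hard to sample -/

theorem map_uniform_apply_toReal {A B : Type} [Fintype A] [Nonempty A] [DecidableEq B] (f : A → B)
    (b : B) : ((PMF.uniformOfFintype A).map f b).toReal =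
      (Finset.univ.filter fun a => f a = b).card / Fintype.card A := by
  rw [PMF.map_apply, tsum_fintype]
  simp only [PMF.uniformOfFintype_apply]
  have : (Finset.univ.filter fun a => b = f a) = Finset.univ.filter fun a => f a = b := by
    ext a; simp [eq_comm]
  rw [← Finset.sum_filter, Finset.sum_const, nsmul_eq_mul, ENNReal.toReal_mul,
    ENNReal.toReal_inv, ENNReal.toReal_natCast, ENNReal.toReal_natCast, div_eq_mul_inv, ← this]

theorem sum_map_uniform {A B : Type} [Fintype A] [Nonempty A] [Fintype B] [DecidableEq B]
    (f : A → B) (g : B → ℝ) : ∑ b, ((PMF.uniformOfFintype A).map f b).toReal * g b =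
      (∑ a, g (f a)) / Fintype.card A := by
  simp only [map_uniform_apply_toReal]
  rw [← Finset.sum_fiberwise (s := Finset.univ) (g := f), Finset.sum_div]
  refine Finset.sum_congr rfl fun b _ => ?_
  rw [Finset.sum_congr rfl (g := fun _ => g b) (by
    intro a ha; rw [(Finset.mem_filter.1 ha).2])]
  rw [Finset.sum_const, nsmul_eq_mul]
  ring

theorem prob_eq_sum {A : Type} [Fintype A] (μ : PMF A) (E : Set A) [DecidablePred (· ∈ E)] :
    prob μ E = ∑ a, (μ a).toReal * if a ∈ E then 1 else 0 := by
  rw [prob, PMF.toOuterMeasure_apply, tsum_fintype, ENNReal.toReal_sum]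
  · refine Finset.sum_congr rfl fun a _ => ?_
    by_cases h : a ∈ E <;> simp [h]
  · intro a _
    by_cases h : a ∈ E <;> simp [h, PMF.apply_ne_top]

theorem sum_toReal_eq_one {A : Type} [Fintype A] (μ : PMF A) : ∑ a, (μ a).toReal = 1 := by
  rw [← ENNReal.toReal_sum (fun a _ => μ.apply_ne_top a),
    ← tsum_fintype (L := .unconditional _), μ.tsum_coe, ENNReal.toReal_one]

/-- The total variation distance bounds the advantage of every randomized test. -/
theorem sum_sub_sum_le_tvDist {A : Type} [Fintype A] (μ ν : PMF A) (g : A → ℝ)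
    (h0 : ∀ a, 0 ≤ g a) (h1 : ∀ a, g a ≤ 1) :
    ∑ a, (μ a).toReal * g a - ∑ a, (ν a).toReal * g a ≤ tvDist μ ν := by
  have e : ∑ a, ((μ a).toReal - (ν a).toReal) * (1 / 2) = 0 := by
    rw [← Finset.sum_mul, Finset.sum_sub_distrib, sum_toReal_eq_one, sum_toReal_eq_one]; simp
  rw [tvDist, ← Finset.sum_sub_distrib, Finset.mul_sum, ← sub_zero (∑ a, _), ← e,
    ← Finset.sum_sub_distrib]
  refine Finset.sum_le_sum fun a _ => ?_
  have ha : |g a - 1 / 2| ≤ 1 / 2 := abs_le.2 ⟨by linarith [h0 a], by linarith [h1 a]⟩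
  calc _ = ((μ a).toReal - (ν a).toReal) * (g a - 1 / 2) := by ring
    _ ≤ |((μ a).toReal - (ν a).toReal) * (g a - 1 / 2)| := le_abs_self _
    _ = |(μ a).toReal - (ν a).toReal| * |g a - 1 / 2| := abs_mul _ _
    _ ≤ |(μ a).toReal - (ν a).toReal| * (1 / 2) := by gcongr
    _ = _ := by ring

/-- The first `x_j` with `b_j = 1`, or `v` if all `b_j` are `0`. -/
def sel {R : Type} [CommRing R] : (t : ℕ) → (Fin t → R) → (Fin t → R) → R → R
  | 0, _, _, v => v
  | t + 1, b, x, v => b 0 * x 0 + (1 - b 0) * sel t (fun j => b j.succ) (fun j => x j.succ) v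

theorem map_sel {R R' : Type} [CommRing R] [CommRing R'] (φ : R →+* R') : ∀ (t : ℕ)
    (b x : Fin t → R) (v : R), φ (sel t b x v) = sel t (fun j => φ (b j)) (fun j => φ (x j)) (φ v)
  | 0, _, _, _ => rfl
  | t + 1, b, x, v => by simp [sel, map_sel φ t]

theorem totalDegree_sel_le {s : Type} {D : ℕ} : ∀ (t : ℕ) (b x : Fin t → MvPolynomial s (ZMod 2))
    (v : MvPolynomial s (ZMod 2)), (∀ j, (b j).totalDegree ≤ D) → (∀ j, (x j).totalDegree ≤ D) →
    v.totalDegree ≤ D → (sel t b x v).totalDegree ≤ D * (t + 1)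
  | 0, _, _, _, _, _, hv => by simpa [sel] using hv
  | t + 1, b, x, v, hb, hx, hv => by
    have ih := totalDegree_sel_le t (fun j => b j.succ) (fun j => x j.succ) v (fun j => hb _)
      (fun j => hx _) hv
    refine (MvPolynomial.totalDegree_add _ _).trans (max_le ?_ ?_)
    · refine (MvPolynomial.totalDegree_mul _ _).trans ?_
      have := hb 0; have := hx 0
      nlinarith
    · refine (MvPolynomial.totalDegree_mul _ _).trans ?_
      have h1 : (1 - b 0).totalDegree ≤ D :=
        (MvPolynomial.totalDegree_sub _ _).trans (max_le (by simp) (hb 0))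
      nlinarith

theorem sel_cases {n : ℕ} : ∀ (t : ℕ) (b : Fin t → ZMod 2) (x : Fin t → Fin n → ZMod 2)
    (v : Fin n → ZMod 2), (∃ j, b j = 1 ∧ (fun i => sel t b (fun j => x j i) (v i)) = x j) ∨
      ((∀ j, b j ≠ 1) ∧ (fun i => sel t b (fun j => x j i) (v i)) = v)
  | 0, _, _, _ => Or.inr ⟨fun j => j.elim0, rfl⟩
  | t + 1, b, x, v => by
    have h01 : ∀ y : ZMod 2, y = 0 ∨ y = 1 := by decide
    rcases h01 (b 0) with h | h
    · have e : (fun i => sel (t + 1) b (fun j => x j i) (v i)) =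
          fun i => sel t (fun j => b j.succ) (fun j => x j.succ i) (v i) := by
        funext i; simp [sel, h]
      rw [e]
      rcases sel_cases t (fun j => b j.succ) (fun j => x j.succ) v with ⟨j, hj, hj'⟩ | ⟨hj, hj'⟩
      · exact Or.inl ⟨j.succ, hj, hj'⟩
      · refine Or.inr ⟨fun j => ?_, hj'⟩
        refine Fin.cases (by rw [h]; decide) (fun j => hj j) j
    · refine Or.inl ⟨0, h, ?_⟩
      funext i; simp [sel, h]

theorem card_filter_apply_mem {t : ℕ} {A : Type} [Fintype A] [DecidableEq A] [Nonempty A]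
    (H : Finset A) (j : Fin t) : ((Finset.univ.filter fun u : Fin t → A => u j ∈ H).card : ℝ) =
      H.card / Fintype.card A * Fintype.card (Fin t → A) := by
  have : (Finset.univ.filter fun u : Fin t → A => u j ∈ H) =
      Fintype.piFinset fun j' => if j' = j then H else Finset.univ := by
    ext u
    simp only [Finset.mem_filter, Finset.mem_univ, true_and, Fintype.mem_piFinset]
    constructor
    · intro h j'
      split_ifs with e
      · rwa [e]
      · simp
    · intro h
      simpa using h j
  rw [this, Fintype.card_piFinset, ← Finset.mul_prod_erase _ _ (Finset.mem_univ j), if_pos rfl]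
  rw [Finset.prod_congr rfl (g := fun _ => Fintype.card A) (by
    intro j' hj'; rw [if_neg (Finset.ne_of_mem_erase hj'), Finset.card_univ])]
  have hA : (Fintype.card A : ℝ) ≠ 0 := by exact_mod_cast Fintype.card_ne_zero
  obtain ⟨t, rfl⟩ : ∃ t', t = t' + 1 := ⟨t - 1, by have := j.2; omega⟩
  simp only [Finset.prod_const, Finset.card_erase_of_mem (Finset.mem_univ j), Finset.card_univ,
    Fintype.card_fin, Fintype.card_pi, Nat.add_sub_cancel]
  push_cast
  rw [pow_succ]
  field_simp

/-- For most points of `V^t × V` some component lies in `I` and no component lies in the small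
set `H`. -/
theorem le_sum_good_points {V : Type} [Fintype V] [DecidableEq V] [Nonempty V] {t : ℕ}
    (I H : Finset V) (φ : (Fin t → V) → V → ℝ) (h0 : ∀ u v, 0 ≤ φ u v)
    (h1 : ∀ u v, ((∃ j, u j ∈ I) ∨ v ∈ I) → (∀ j, u j ∉ H) → v ∉ H → 1 ≤ φ u v) :
    1 - ((1 - I.card / Fintype.card V : ℝ) ^ (t + 1) + (t + 1) * (H.card / Fintype.card V)) ≤
      (∑ u, ∑ v, φ u v) / (Fintype.card (Fin t → V) * Fintype.card V) := by
  have hV : (0 : ℝ) < Fintype.card V := by exact_mod_cast Fintype.card_pos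
  have hT : (0 : ℝ) < Fintype.card (Fin t → V) := by exact_mod_cast Fintype.card_pos
  set G : Finset V := Iᶜ with hG
  have hGc : 1 - (I.card / Fintype.card V : ℝ) = G.card / Fintype.card V := by
    rw [hG, Finset.card_compl, Nat.cast_sub (Finset.card_le_univ _)]
    field_simp
  have hb : ∀ u v, (1 : ℝ) - (if u ∈ Fintype.piFinset fun _ => G then 1 else 0) *
      (if v ∈ G then 1 else 0) - (∑ j, if u j ∈ H then 1 else 0) - (if v ∈ H then 1 else 0) ≤
        φ u v := by
    intro u v
    have hs0 : (0 : ℝ) ≤ ∑ j, if u j ∈ H then 1 else 0 :=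
      Finset.sum_nonneg fun j _ => by split_ifs <;> norm_num
    by_cases hH : ∃ j, u j ∈ H
    · obtain ⟨j, hj⟩ := hH
      have : (1 : ℝ) ≤ ∑ j, if u j ∈ H then 1 else 0 := by
        refine le_trans ?_ (Finset.single_le_sum (f := fun j => if u j ∈ H then (1 : ℝ) else 0)
          (fun j _ => by positivity) (Finset.mem_univ j))
        simp [hj]
      have := h0 u v
      split_ifs <;> linarith
    · push Not at hH
      by_cases hv : v ∈ H
      · have := h0 u v
        rw [if_pos hv]
        split_ifs <;> linarith
      · by_cases hI : (∃ j, u j ∈ I) ∨ v ∈ I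
        · have := h1 u v hI hH hv
          split_ifs <;> linarith
        · push Not at hI
          have e1 : u ∈ Fintype.piFinset fun _ => G := by
            rw [Fintype.mem_piFinset]
            exact fun j => Finset.mem_compl.2 (hI.1 j)
          have e2 : v ∈ G := Finset.mem_compl.2 hI.2
          have := h0 u v
          rw [if_pos e1, if_pos e2, if_neg hv]
          linarith
  rw [le_div_iff₀ (by positivity), hGc]
  refine le_trans (le_of_eq ?_) (Finset.sum_le_sum fun u _ => Finset.sum_le_sum fun v _ => hb u v)
  simp only [Finset.sum_sub_distrib, ← Finset.mul_sum, ← Finset.sum_mul]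
  have e1 : ∑ u : Fin t → V, (if u ∈ Fintype.piFinset fun _ => G then (1 : ℝ) else 0) =
      (G.card : ℝ) ^ t := by
    rw [Finset.sum_boole, Finset.filter_mem_eq_inter, Finset.univ_inter,
      Fintype.card_piFinset]
    simp
  have e2 : ∀ K : Finset V, ∑ v : V, (if v ∈ K then (1 : ℝ) else 0) = K.card := fun K => by
    rw [Finset.sum_boole, Finset.filter_mem_eq_inter, Finset.univ_inter]
  have e3 : ∑ u : Fin t → V, ∑ _v : V, ∑ j, (if u j ∈ H then (1 : ℝ) else 0) =
      t * (H.card / Fintype.card V * Fintype.card (Fin t → V)) * Fintype.card V := by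
    simp only [Finset.sum_const, Finset.card_univ, nsmul_eq_mul, ← Finset.mul_sum]
    rw [Finset.sum_comm]
    simp only [Finset.sum_boole, card_filter_apply_mem, Finset.sum_const, Finset.card_univ,
      Fintype.card_fin, nsmul_eq_mul]
    ring
  rw [e1, e2, e3]
  simp only [e2, Finset.sum_const, Finset.card_univ, nsmul_eq_mul, mul_one]
  have e4 : (Fintype.card (Fin t → V) : ℝ) = (Fintype.card V : ℝ) ^ t := by
    rw [Fintype.card_pi]; simp
  rw [e4, div_pow, pow_succ, pow_succ]
  field_simp
  ring

theorem ite_one_le_ite_one {p p' : Prop} [Decidable p] [Decidable p'] (h : p → p') :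
    (if p then (1 : ℝ) else 0) ≤ if p' then 1 else 0 := by
  by_cases hp : p <;> by_cases hp' : p' <;> simp_all

/-- If `Iso` is an isolator for sources of degree `Δ (t + 1)`, then sources of degree `Δ` are far
from `(U_1, …, U_t, Iso(U_1), …, Iso(U_t))`. A source of degree `Δ` yields one of degree
`Δ (t + 1)` by outputting the first `u_j` that is labelled `1`, or a fresh uniform string if there
is none. The test is whether all labels are correct and the output is a light point that
satisfies `Iso`. -/
theorem one_sub_le_tvDist_hardDist {n t D d k : ℕ} {α β : ℝ} {Iso : (Fin n → ZMod 2) → ZMod 2}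
    (hD : 0 < D) (hd : D * (t + 1) ≤ d) (hkn : k ≤ n)
    (hIso : IsIsolator α β k (polySources n d) Iso) {X : PMF (Fin (t * n + t) → ZMod 2)}
    (hX : X ∈ polySources (t * n + t) D) :
    1 - ((1 - α) ^ (t + 1) + (t + 1) * ((2 : ℝ) ^ (n - k))⁻¹ + β) ≤
      tvDist (hardDist t Iso) X := by
  classical
  obtain ⟨m, P, hP, rfl⟩ := hX
  have hV : (0 : ℝ) < Fintype.card (Fin n → ZMod 2) := by exact_mod_cast Fintype.card_pos
  have hVc : (Fintype.card (Fin n → ZMod 2) : ℝ) = 2 ^ n := by simp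
  let xs : (Fin (t * n + t) → ZMod 2) → Fin t → (Fin n → ZMod 2) := fun y j i =>
    y (Fin.castAdd t (finProdFinEquiv (j, i)))
  let bs : (Fin (t * n + t) → ZMod 2) → Fin t → ZMod 2 := fun y j => y (Fin.natAdd (t * n) j)
  let S : (Fin (t * n + t) → ZMod 2) → (Fin n → ZMod 2) → (Fin n → ZMod 2) := fun y v i =>
    sel t (bs y) (fun j => xs y j i) (v i)
  let Q : Fin n → MvPolynomial (Fin (m + n)) (ZMod 2) := fun i => sel t
    (fun j => MvPolynomial.rename (Fin.castAdd n) (P (Fin.natAdd (t * n) j)))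
    (fun j => MvPolynomial.rename (Fin.castAdd n) (P (Fin.castAdd t (finProdFinEquiv (j, i)))))
    (MvPolynomial.X (Fin.natAdd m i))
  have hQ : ∀ i, (Q i).totalDegree ≤ d := fun i =>
    (totalDegree_sel_le (D := D) t _ _ _
      (fun j => (MvPolynomial.totalDegree_rename_le _ _).trans (hP _))
      (fun j => (MvPolynomial.totalDegree_rename_le _ _).trans (hP _))
      (by rw [MvPolynomial.totalDegree_X]; omega)).trans hd
  set Z : PMF (Fin n → ZMod 2) := (unif (m + n)).map (fun u i => MvPolynomial.eval u (Q i)) with hZ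
  have hZmem : Z ∈ polySources n d := ⟨m + n, Q, hQ, rfl⟩
  have hQS : ∀ (w : Fin m → ZMod 2) (v : Fin n → ZMod 2),
      (fun i => MvPolynomial.eval (Fin.append w v) (Q i)) =
        S (fun p => MvPolynomial.eval w (P p)) v := by
    intro w v
    funext i
    have e : ∀ p : MvPolynomial (Fin m) (ZMod 2), MvPolynomial.eval (Fin.append w v)
        (MvPolynomial.rename (Fin.castAdd n) p) = MvPolynomial.eval w p := by
      intro p
      rw [MvPolynomial.eval_rename]
      congr 2
      funext j
      exact Fin.append_left _ _ _
    simp only [Q, map_sel, e, MvPolynomial.eval_X, Fin.append_right]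
    rfl
  set L := lightPoints Z k with hL
  let φ : (Fin (t * n + t) → ZMod 2) → (Fin n → ZMod 2) → ℝ := fun y v =>
    if (∀ j, Iso (xs y j) = bs y j) ∧ S y v ∈ L ∧ Iso (S y v) = 1 then 1 else 0
  have hφ0 : ∀ y v, 0 ≤ φ y v := fun y v => by simp only [φ]; split_ifs <;> norm_num
  have hφ1 : ∀ y v, φ y v ≤ 1 := fun y v => by simp only [φ]; split_ifs <;> norm_num
  refine le_trans ?_ (sum_sub_sum_le_tvDist _ _
    (fun y => (∑ v, φ y v) / Fintype.card (Fin n → ZMod 2))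
    (fun y => div_nonneg (Finset.sum_nonneg fun v _ => hφ0 y v) hV.le)
    (fun y => (div_le_one hV).2 (by
      simpa using Finset.sum_le_sum fun v (_ : v ∈ Finset.univ) => hφ1 y v)))
  -- the source passes the test with probability at most `β`
  have hsource : ∑ y, (((unif m).map fun u i => MvPolynomial.eval u (P i)) y).toReal *
      ((∑ v, φ y v) / Fintype.card (Fin n → ZMod 2)) ≤ β := by
    refine le_trans ?_ (hIso.light_le Z hZmem)
    have hprob : prob Z {x | x ∈ L ∧ Iso x = 1} =
        (∑ w, if (fun i => MvPolynomial.eval w (Q i)) ∈ L ∧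
          Iso (fun i => MvPolynomial.eval w (Q i)) = 1 then (1 : ℝ) else 0) /
            Fintype.card (Fin (m + n) → ZMod 2) := by
      rw [prob_eq_sum]
      exact sum_map_uniform _ _
    rw [unif, sum_map_uniform, hprob, ← Finset.sum_div, div_div,
      ← Equiv.sum_comp (Fin.appendEquiv m n), Fintype.sum_prod_type]
    have hc : (Fintype.card (Fin (m + n) → ZMod 2) : ℝ) =
        Fintype.card (Fin n → ZMod 2) * Fintype.card (Fin m → ZMod 2) := by
      simp [pow_add, mul_comm]
    rw [hc]
    refine div_le_div_of_nonneg_right ?_ (by positivity)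
    refine Finset.sum_le_sum fun w _ => Finset.sum_le_sum fun v _ => ?_
    have hv : (fun i => MvPolynomial.eval (Fin.appendEquiv m n (w, v)) (Q i)) =
        S (fun p => MvPolynomial.eval w (P p)) v := hQS w v
    refine ite_one_le_ite_one fun h => ?_
    rw [hv]
    exact h.2
  -- there are few heavy points
  set H : Finset (Fin n → ZMod 2) := Finset.univ.filter fun z => z ∉ L with hH
  have hHc : (H.card : ℝ) / Fintype.card (Fin n → ZMod 2) ≤ ((2 : ℝ) ^ (n - k))⁻¹ := by
    have h1 : (H.card : ℝ) * ((2 : ℝ) ^ k)⁻¹ ≤ 1 := by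
      rw [← sum_toReal_eq_one Z, ← nsmul_eq_mul, ← Finset.sum_const]
      refine (Finset.sum_le_sum fun z hz => ?_).trans (Finset.sum_le_univ_sum_of_nonneg
        fun z => ENNReal.toReal_nonneg)
      have := (Finset.mem_filter.1 hz).2
      exact (not_le.1 this).le
    rw [hVc, div_le_iff₀ (by positivity)]
    have h2 : (2 : ℝ) ^ n = 2 ^ (n - k) * 2 ^ k := by rw [← pow_add, Nat.sub_add_cancel hkn]
    rw [h2, inv_mul_cancel_left₀ (by positivity)]
    rwa [mul_inv_le_iff₀ (by positivity), one_mul] at h1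
  have hα : α ≤ (Finset.univ.filter fun x => Iso x = 1).card / Fintype.card (Fin n → ZMod 2) := by
    refine hIso.mass_ge.trans (le_of_eq ?_)
    rw [prob_eq_sum]
    simp only [unif, PMF.uniformOfFintype_apply, ENNReal.toReal_inv, ENNReal.toReal_natCast,
      ← Finset.mul_sum, Set.mem_ofPred_eq, Finset.sum_boole]
    rw [div_eq_inv_mul]
  have hgood := le_sum_good_points (Finset.univ.filter fun x => Iso x = 1) H
    (fun u v => φ (graphString t Iso u) v) (fun u v => hφ0 _ v) (by
      intro u v hI hu hv
      simp only [Finset.mem_filter, Finset.mem_univ, true_and] at hI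
      have e1 : xs (graphString t Iso u) = u := by
        funext j i
        simp only [xs]
        rw [graphString_castAdd, Equiv.symm_apply_apply]
      have e2 : bs (graphString t Iso u) = fun j => Iso (u j) := by
        funext j
        exact graphString_natAdd Iso u j
      have e3 : S (graphString t Iso u) v =
        fun i => sel t (fun j => Iso (u j)) (fun j => u j i) (v i) := by simp only [S, e1, e2]
      have hLH : ∀ z, z ∉ H → z ∈ L := fun z hz => by
        by_contra h
        exact hz (Finset.mem_filter.2 ⟨Finset.mem_univ _, h⟩)
      simp only [φ]
      rw [if_pos]
      refine ⟨fun j => by rw [e1, e2], ?_⟩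
      rw [e3]
      rcases sel_cases t (fun j => Iso (u j)) u v with ⟨j, hj, hj'⟩ | ⟨hj, hj'⟩
      · rw [hj']
        exact ⟨hLH _ (hu j), hj⟩
      · rw [hj']
        exact ⟨hLH _ hv, hI.resolve_left fun ⟨j, h⟩ => hj j h⟩)
  have htrue : ∑ y, (hardDist t Iso y).toReal * ((∑ v, φ y v) / Fintype.card (Fin n → ZMod 2)) =
      (∑ u, ∑ v, φ (graphString t Iso u) v) /
        (Fintype.card (Fin t → (Fin n → ZMod 2)) * Fintype.card (Fin n → ZMod 2)) := by
    rw [hardDist, sum_map_uniform, ← Finset.sum_div, div_div, mul_comm]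
  rw [htrue]
  have hpow : (1 - ((Finset.univ.filter fun x => Iso x = 1).card /
      Fintype.card (Fin n → ZMod 2) : ℝ)) ^ (t + 1) ≤ (1 - α) ^ (t + 1) := by
    refine pow_le_pow_left₀ ?_ (by linarith) _
    rw [sub_nonneg, div_le_one hV]
    exact_mod_cast Finset.card_le_univ _
  have : ((t : ℝ) + 1) * (H.card / Fintype.card (Fin n → ZMod 2)) ≤
      (t + 1) * ((2 : ℝ) ^ (n - k))⁻¹ := by gcongr
  linarith

/-! ### Reducing the number of input bits of a source -/

/-- The point with coordinates `u` in the affine frame with origin `w.1` and directions `w.2`. -/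
def frame {V : Type} [AddCommGroup V] [Module (ZMod 2) V] {m : ℕ} (w : V × (Fin m → V))
    (u : Fin m → ZMod 2) : V := w.1 + ∑ j, u j • w.2 j

section

variable {V : Type} [AddCommGroup V] [Module (ZMod 2) V] [Fintype V] {m : ℕ}

theorem sum_comp_frame_add (f : V → V → ℝ) (u u' : Fin m → ZMod 2) (s : V × (Fin m → V)) :
    ∑ w : V × (Fin m → V), f (frame w u + frame s u) (frame w u' + frame s u') =
      ∑ w : V × (Fin m → V), f (frame w u) (frame w u') := by
  rw [← Equiv.sum_comp (Equiv.addRight s) fun w => f (frame w u) (frame w u')]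
  have e : ∀ w u, frame (w + s) u = frame w u + frame s u := by
    intro w u
    simp only [frame, Prod.fst_add, Prod.snd_add, Pi.add_apply, smul_add, Finset.sum_add_distrib]
    abel
  simp only [Equiv.coe_addRight, e]

theorem card_mul_sum_sq_frame (f : V → ℝ) (u : Fin m → ZMod 2) :
    (Fintype.card V : ℝ) * ∑ w : V × (Fin m → V), f (frame w u) * f (frame w u) =
      Fintype.card (V × (Fin m → V)) * ∑ v, f v ^ 2 := by
  calc _ = ∑ v : V, ∑ w : V × (Fin m → V), f (frame w u) * f (frame w u) := by
        rw [Finset.sum_const, nsmul_eq_mul, Finset.card_univ]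
    _ = ∑ v : V, ∑ w : V × (Fin m → V), f (frame w u + v) * f (frame w u + v) := by
        refine Finset.sum_congr rfl fun v _ => ?_
        rw [← sum_comp_frame_add (fun x y => f x * f y) u u (v, 0)]
        simp [frame]
    _ = ∑ w : V × (Fin m → V), ∑ v : V, f v ^ 2 := by
        rw [Finset.sum_comm]
        refine Finset.sum_congr rfl fun w _ => ?_
        rw [← Equiv.sum_comp (Equiv.addLeft (frame w u)) fun v => f v ^ 2]
        simp [sq]
    _ = _ := by rw [Finset.sum_const, nsmul_eq_mul, Finset.card_univ]

theorem sum_mul_frame_of_apply {f : V → ℝ} (hf : ∑ v, f v = 0) {u u' : Fin m → ZMod 2}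
    {j : Fin m} (h1 : u j = 1) (h0 : u' j = 0) :
    ∑ w : V × (Fin m → V), f (frame w u) * f (frame w u') = 0 := by
  have hV : (Fintype.card V : ℝ) ≠ 0 := by exact_mod_cast Fintype.card_ne_zero
  refine mul_left_cancel₀ hV ?_
  calc _ = ∑ v : V, ∑ w : V × (Fin m → V), f (frame w u) * f (frame w u') := by
        rw [Finset.sum_const, nsmul_eq_mul, Finset.card_univ]
    _ = ∑ v : V, ∑ w : V × (Fin m → V), f (frame w u + v) * f (frame w u') := by
        refine Finset.sum_congr rfl fun v _ => ?_
        rw [← sum_comp_frame_add (fun x y => f x * f y) u u' (0, Pi.single j v)]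
        simp [frame, Pi.single_apply, h1, h0]
    _ = ∑ w : V × (Fin m → V), 0 := by
        rw [Finset.sum_comm]
        refine Finset.sum_congr rfl fun w _ => ?_
        have : ∑ v, f (frame w u + v) = ∑ v, f v := Equiv.sum_comp (Equiv.addLeft (frame w u)) f
        rw [← Finset.sum_mul, this, hf, zero_mul]
    _ = _ := by simp

/-- Two different points of a random affine frame are independent. -/
theorem sum_mul_frame {f : V → ℝ} (hf : ∑ v, f v = 0) {u u' : Fin m → ZMod 2} (hu : u ≠ u') :
    ∑ w : V × (Fin m → V), f (frame w u) * f (frame w u') = 0 := by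
  obtain ⟨j, hj⟩ := Function.ne_iff.1 hu
  have h01 : ∀ y z : ZMod 2, y ≠ z → y = 1 ∧ z = 0 ∨ y = 0 ∧ z = 1 := by decide
  rcases h01 _ _ hj with ⟨h1, h0⟩ | ⟨h0, h1⟩
  · exact sum_mul_frame_of_apply hf h1 h0
  · simp only [mul_comm (f (frame _ u))]
    exact sum_mul_frame_of_apply hf h1 h0

/-- Sampling along a random affine frame of dimension `m` is as accurate as `2 ^ m` independent
samples. -/
theorem sum_sq_sum_frame {f : V → ℝ} (hf : ∑ v, f v = 0) :
    (Fintype.card V : ℝ) * ∑ w : V × (Fin m → V), (∑ u, f (frame w u)) ^ 2 =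
      2 ^ m * (Fintype.card (V × (Fin m → V)) * ∑ v, f v ^ 2) := by
  have e : ∑ w : V × (Fin m → V), (∑ u, f (frame w u)) ^ 2 =
      ∑ u : Fin m → ZMod 2, ∑ w : V × (Fin m → V), f (frame w u) * f (frame w u) := by
    simp only [sq, Finset.sum_mul_sum]
    rw [Finset.sum_comm]
    refine Finset.sum_congr rfl fun u _ => ?_
    rw [Finset.sum_comm, Finset.sum_eq_single_of_mem u (Finset.mem_univ u)]
    intro u' _ h
    exact sum_mul_frame hf h.symm
  rw [e, Finset.mul_sum]
  simp only [card_mul_sum_sq_frame]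
  simp

/-- For every map `G`, some affine frame of dimension `m` gives a source with `m` input bits that
is close to `G` of a uniform point. -/
theorem exists_frame_close {B : Type} [Fintype B] [DecidableEq B] (m : ℕ) (G : V → B) :
    ∃ w : V × (Fin m → V), (∑ z, |((unif m).map (fun u => G (frame w u)) z).toReal -
      ((PMF.uniformOfFintype V).map G z).toReal|) ^ 2 ≤ Fintype.card B / 2 ^ m := by
  have hV : (0 : ℝ) < Fintype.card V := by exact_mod_cast Fintype.card_pos
  set p : B → ℝ := fun z => ((PMF.uniformOfFintype V).map G z).toReal with hp
  let f : B → V → ℝ := fun z v => (if G v = z then 1 else 0) - p z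
  have hpc : ∀ z, (Fintype.card V : ℝ) * p z = ∑ v, if G v = z then (1 : ℝ) else 0 := by
    intro z
    rw [hp, Finset.sum_boole]
    simp only [map_uniform_apply_toReal]
    field_simp
  have hf0 : ∀ z, ∑ v, f z v = 0 := by
    intro z
    simp only [f, Finset.sum_sub_distrib, ← hpc]
    simp
  have hf2 : ∀ z, ∑ v, f z v ^ 2 ≤ Fintype.card V * p z := by
    intro z
    have : ∀ v, f z v ^ 2 = (1 - 2 * p z) * (if G v = z then 1 else 0) + p z ^ 2 := by
      intro v
      simp only [f]
      split_ifs <;> ring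
    simp only [this, Finset.sum_add_distrib, ← Finset.mul_sum, ← hpc, Finset.sum_const,
      Finset.card_univ, nsmul_eq_mul]
    nlinarith [mul_nonneg hV.le (sq_nonneg (p z))]
  have hhat : ∀ (w : V × (Fin m → V)) z,
      ((unif m).map (fun u => G (frame w u)) z).toReal - p z = (∑ u, f z (frame w u)) / 2 ^ m := by
    intro w z
    rw [unif, map_uniform_apply_toReal]
    simp only [f, Finset.sum_sub_distrib, Finset.sum_boole]
    simp [sub_div]
  have hp1 : ∑ z, p z = 1 := sum_toReal_eq_one _
  have htot : ∑ w : V × (Fin m → V), ∑ z, (∑ u, f z (frame w u)) ^ 2 ≤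
      ∑ _w : V × (Fin m → V), (2 : ℝ) ^ m := by
    rw [Finset.sum_comm]
    refine le_of_mul_le_mul_left ?_ hV
    rw [Finset.mul_sum, Finset.sum_congr rfl fun z _ => sum_sq_sum_frame (m := m) (hf0 z),
      ← Finset.mul_sum, ← Finset.mul_sum, Finset.sum_const, nsmul_eq_mul, Finset.card_univ]
    have : ∑ z, ∑ v, f z v ^ 2 ≤ Fintype.card V :=
      (Finset.sum_le_sum fun z _ => hf2 z).trans_eq (by rw [← Finset.mul_sum, hp1, mul_one])
    calc (2 : ℝ) ^ m * (Fintype.card (V × (Fin m → V)) * ∑ z, ∑ v, f z v ^ 2) ≤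
        2 ^ m * (Fintype.card (V × (Fin m → V)) * Fintype.card V) := by gcongr
      _ = _ := by ring
  obtain ⟨w, -, hw⟩ := Finset.exists_le_of_sum_le (Finset.univ_nonempty) htot
  refine ⟨w, sq_sum_le_card_mul_sum_sq.trans ?_⟩
  simp only [sq_abs]
  rw [Finset.card_univ, Finset.sum_congr rfl fun z _ => by rw [hhat w z], div_eq_mul_inv]
  gcongr
  simp only [div_pow, ← Finset.sum_div]
  rw [div_le_iff₀ (by positivity), sq, inv_mul_cancel_left₀ (by positivity)]
  exact hw

end

theorem totalDegree_aeval_le {σ τ : Type} (p : MvPolynomial σ (ZMod 2))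
    (L : σ → MvPolynomial τ (ZMod 2)) (hL : ∀ i, (L i).totalDegree ≤ 1) :
    (MvPolynomial.aeval L p).totalDegree ≤ p.totalDegree := by
  rw [MvPolynomial.aeval_def, MvPolynomial.eval₂_eq]
  refine MvPolynomial.totalDegree_finsetSum_le fun s hs => ?_
  refine (MvPolynomial.totalDegree_mul _ _).trans ?_
  rw [MvPolynomial.algebraMap_eq, MvPolynomial.totalDegree_C, zero_add]
  refine (MvPolynomial.totalDegree_finsetProd _ _).trans ?_
  refine (Finset.sum_le_sum fun i _ => ((MvPolynomial.totalDegree_pow _ _).trans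
    (Nat.mul_le_mul_left _ (hL i))).trans_eq (mul_one _)).trans ?_
  exact MvPolynomial.le_totalDegree hs

/-- Every polynomial source is close to one of the same degree with `m` input bits. -/
theorem exists_source_close {n d : ℕ} (m : ℕ) {X : PMF (Fin n → ZMod 2)}
    (hX : X ∈ polySources n d) : ∃ P : Fin n → MvPolynomial (Fin m) (ZMod 2),
      (∀ i, (P i).totalDegree ≤ d) ∧
      (∑ z, |((unif m).map (fun u i => MvPolynomial.eval u (P i)) z).toReal - (X z).toReal|) ^ 2 ≤
        2 ^ n / 2 ^ m := by
  obtain ⟨m₀, P, hP, rfl⟩ := hX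
  obtain ⟨w, hw⟩ := exists_frame_close m
    (fun (u : Fin m₀ → ZMod 2) (i : Fin n) => MvPolynomial.eval u (P i))
  refine ⟨fun i => MvPolynomial.aeval (fun k => MvPolynomial.C (w.1 k) +
    ∑ j, MvPolynomial.C (w.2 j k) * MvPolynomial.X j) (P i), fun i => ?_, ?_⟩
  · refine (totalDegree_aeval_le _ _ fun k => ?_).trans (hP i)
    refine (MvPolynomial.totalDegree_add _ _).trans (max_le (by simp) ?_)
    refine MvPolynomial.totalDegree_finsetSum_le fun j _ => ?_
    refine (MvPolynomial.totalDegree_mul _ _).trans ?_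
    rw [MvPolynomial.totalDegree_C, MvPolynomial.totalDegree_X]
  · have e : (fun (u : Fin m → ZMod 2) (i : Fin n) => MvPolynomial.eval u
        (MvPolynomial.aeval (fun k => MvPolynomial.C (w.1 k) +
          ∑ j, MvPolynomial.C (w.2 j k) * MvPolynomial.X j) (P i))) =
        fun u i => MvPolynomial.eval (frame w u) (P i) := by
      funext u i
      rw [MvPolynomial.aeval_def, ← MvPolynomial.coe_eval₂Hom, MvPolynomial.algebraMap_eq]
      rw [← RingHom.comp_apply, MvPolynomial.comp_eval₂Hom]
      rw [MvPolynomial.coe_eval₂Hom, ← MvPolynomial.eval₂_id]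
      congr 1
      · ext; simp
      · funext k
        simp [frame, mul_comm]
    rw [e]
    simpa [unif] using hw

/-! ### Coding points and polynomials by numbers -/

/-- The number whose binary digits are the coordinates of a point. -/
def code (m : ℕ) : (Fin m → ZMod 2) ≃ Fin (2 ^ m) := finFunctionFinEquiv

theorem bit_code {m : ℕ} (x : Fin m → ZMod 2) (k : Fin m) : bit (code m x) k = (x k).val := by
  have h : (code m).symm (code m x) k = x k := by rw [Equiv.symm_apply_apply]
  rw [← h]
  rfl

theorem prefixNum_eq_code {l n : ℕ} (h : l ≤ n) (x : Fin n → ZMod 2) :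
    prefixNum l x = code l fun i => x (Fin.castLE h i) := by
  have e : ∀ y : Fin l → ZMod 2, (code l y : ℕ) = ∑ i : Fin l, (y i).val * 2 ^ (i : ℕ) :=
    fun y => rfl
  rw [prefixNum, Finset.sum_range, e]
  refine Finset.sum_congr rfl fun i _ => ?_
  rw [dif_pos (i.2.trans_le h)]
  rfl

theorem sum_range_two_pow {M : Type} [AddCommMonoid M] (m : ℕ) (f : ℕ → M) :
    ∑ u ∈ Finset.range (2 ^ m), f u = ∑ x : Fin m → ZMod 2, f (code m x) := by
  rw [Finset.sum_range, ← Equiv.sum_comp (code m)]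

/-- Arbitrary binary digits can be prescribed. -/
theorem exists_bit_eq (c : ℕ → ZMod 2) (m : ℕ) :
    ∃ F < 2 ^ m, ∀ j < m, bit F j = (c j).val := by
  refine ⟨code m fun j => c j, (code m _).2, fun j hj => ?_⟩
  exact bit_code _ ⟨j, hj⟩

theorem weight_code {m : ℕ} (x : Fin m → ZMod 2) : weight m (code m x) = ∑ k, (x k).val := by
  rw [weight, Finset.sum_range]
  exact Finset.sum_congr rfl fun k _ => bit_code x k

/-- Polynomials of degree at most `d` over the field of two elements are combinations of monomials
that are products of at most `d` distinct variables. -/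
theorem exists_eval_eq_sum {m d : ℕ} {p : MvPolynomial (Fin m) (ZMod 2)} (hp : p.totalDegree ≤ d) :
    ∃ a : (Fin m → ZMod 2) → ZMod 2, ∀ u, MvPolynomial.eval u p =
      ∑ x, (if ∑ k, (x k).val ≤ d ∧ ∀ k, (x k).val ≤ (u k).val then 1 else 0) * a x := by
  classical
  let ι : (Fin m →₀ ℕ) → Fin m → ZMod 2 := fun s k => if s k = 0 then 0 else 1
  refine ⟨fun x => ∑ s ∈ p.support with ι s = x, p.coeff s, fun u => ?_⟩
  rw [MvPolynomial.eval_eq']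
  rw [← Finset.sum_fiberwise (s := p.support) (g := ι)]
  refine Finset.sum_congr rfl fun x _ => ?_
  rw [Finset.mul_sum]
  refine Finset.sum_congr rfl fun s hs => ?_
  obtain ⟨hs', rfl⟩ := Finset.mem_filter.1 hs
  rw [mul_comm]
  congr 1
  have hdeg : ∑ k, (ι s k).val ≤ d := by
    refine le_trans ?_ ((MvPolynomial.le_totalDegree hs').trans hp)
    rw [Finsupp.sum_fintype _ _ fun _ => rfl]
    refine Finset.sum_le_sum fun k _ => ?_
    simp only [ι]
    split_ifs with h
    · simp
    · rw [ZMod.val_one]; omega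
  have h01 : ∀ y : ZMod 2, y = 0 ∨ y = 1 := by decide
  by_cases h : ∀ k, (ι s k).val ≤ (u k).val
  · rw [if_pos ⟨hdeg, h⟩]
    refine Finset.prod_eq_one fun k _ => ?_
    by_cases hk : s k = 0
    · rw [hk, pow_zero]
    · have := h k
      simp only [ι, if_neg hk] at this
      rcases h01 (u k) with h' | h'
      · rw [h'] at this; exact absurd this (by decide)
      · rw [h', one_pow]
  · rw [if_neg fun h' => h h'.2]
    push Not at h
    obtain ⟨k, hk⟩ := h
    refine Finset.prod_eq_zero (Finset.mem_univ k) ?_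
    by_cases hs0 : s k = 0
    · simp [ι, hs0] at hk
    · simp only [ι, if_neg hs0] at hk
      rcases h01 (u k) with h' | h'
      · rw [h', zero_pow hs0]
      · rw [h'] at hk; exact absurd hk (by decide)

theorem coord_code {q F i : ℕ} (u : Fin (20 * q) → ZMod 2) :
    coord q F i (code (20 * q) u) = (∑ x : Fin (20 * q) → ZMod 2,
      ind (∑ k, (x k).val ≤ q ∧ ∀ k, (x k).val ≤ (u k).val) *
        bit F (code (20 * q) x * (10 * q) + i)) % 2 := by
  rw [coord, sum_range_two_pow]
  congr 1
  refine Finset.sum_congr rfl fun x _ => ?_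
  congr 1
  rw [weight_code]
  congr 2
  have : (∀ k < 20 * q, bit (code (20 * q) x) k ≤ bit (code (20 * q) u) k) ↔
      ∀ k, (x k).val ≤ (u k).val := by
    constructor
    · intro h k
      rw [← bit_code, ← bit_code]
      exact h k k.2
    · intro h k hk
      have := h ⟨k, hk⟩
      rwa [← bit_code, ← bit_code] at this
  rw [this]

/-- Every tuple of `10 q` polynomials of degree at most `q` in `20 q` variables has a code. -/
theorem exists_coord_eq {q : ℕ} (P : Fin (10 * q) → MvPolynomial (Fin (20 * q)) (ZMod 2))
    (hP : ∀ i, (P i).totalDegree ≤ q) : ∃ F < 2 ^ (10 * q * 2 ^ (20 * q)),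
      ∀ (i : Fin (10 * q)) u,
        coord q F i (code (20 * q) u) = (MvPolynomial.eval u (P i)).val := by
  choose a ha using fun i => exists_eval_eq_sum (hP i)
  obtain ⟨F, hF, hb⟩ := exists_bit_eq (fun j => if h : j % (10 * q) < 10 * q then
    if h' : j / (10 * q) < 2 ^ (20 * q) then a ⟨_, h⟩ ((code (20 * q)).symm ⟨_, h'⟩) else 0 else 0)
      (10 * q * 2 ^ (20 * q))
  refine ⟨F, hF, fun i u => ?_⟩
  have hbit : ∀ x : Fin (20 * q) → ZMod 2,
      bit F (code (20 * q) x * (10 * q) + i) = (a i x).val := by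
    intro x
    have hi := i.2
    have hx := (code (20 * q) x).2
    have e1 : (code (20 * q) x * (10 * q) + i : ℕ) % (10 * q) = i := by
      rw [Nat.mul_add_mod', Nat.mod_eq_of_lt hi]
    have e2 : (code (20 * q) x * (10 * q) + i : ℕ) / (10 * q) = code (20 * q) x := by
      rw [add_comm, Nat.add_mul_div_right _ _ (by omega), Nat.div_eq_of_lt hi, zero_add]
    rw [hb]
    · simp only [e1, e2]
      simp
    · nlinarith
  rw [coord_code, ← ZMod.val_natCast, ha]
  congr 1
  push_cast
  refine Finset.sum_congr rfl fun x _ => ?_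
  rw [hbit, ZMod.natCast_val, ZMod.cast_id]
  congr 1
  by_cases h : ∑ k, (x k).val ≤ q ∧ ∀ k, (x k).val ≤ (u k).val
  · rw [if_pos h, ind_of_true h, Nat.cast_one]
  · rw [if_neg h, ind_of_false h, Nat.cast_zero]

/-- The number of hits of the source given by the polynomials with code `F`. -/
theorem hits_eq_prob {q F : ℕ} (P : Fin (10 * q) → MvPolynomial (Fin (20 * q)) (ZMod 2))
    (hF : ∀ (i : Fin (10 * q)) u,
      coord q F i (code (20 * q) u) = (MvPolynomial.eval u (P i)).val)
    (z : Fin (10 * q) → ZMod 2) : (hits q F (code (10 * q) z) : ℝ) = 2 ^ (20 * q) *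
      ((unif (20 * q)).map (fun u i => MvPolynomial.eval u (P i)) z).toReal := by
  rw [unif, map_uniform_apply_toReal, hits, sum_range_two_pow]
  have : ∀ u, ind (∀ i < 10 * q, coord q F i (code (20 * q) u) = bit (code (10 * q) z) i) =
      if (fun i => MvPolynomial.eval u (P i)) = z then 1 else 0 := by
    intro u
    have e : (∀ i < 10 * q, coord q F i (code (20 * q) u) = bit (code (10 * q) z) i) ↔
        (fun i => MvPolynomial.eval u (P i)) = z := by
      constructor
      · intro h
        funext i
        have := h i i.2
        rw [hF, bit_code] at this
        exact ZMod.val_injective 2 this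
      · intro h i hi
        rw [hF ⟨i, hi⟩, bit_code z ⟨i, hi⟩, ← h]
    by_cases h : (fun i => MvPolynomial.eval u (P i)) = z
    · rw [if_pos h, ind_of_true (e.2 h)]
    · rw [if_neg h, ind_of_false (mt e.1 h)]
  rw [Finset.sum_congr rfl fun u _ => this u, Finset.sum_boole]
  simp only [Nat.cast_id, Fintype.card_pi, ZMod.card, Finset.prod_const, Finset.card_univ,
    Fintype.card_fin]
  push_cast
  field_simp

/-! ### Good truth tables give isolators -/

theorem sum_append {l r : ℕ} (f : (Fin (l + r) → ZMod 2) → ℝ) :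
    ∑ x, f x = ∑ y : Fin l → ZMod 2, ∑ w : Fin r → ZMod 2, f (Fin.append y w) := by
  rw [← Equiv.sum_comp (Fin.appendEquiv l r), Fintype.sum_prod_type]
  rfl

theorem lookup_append {l r : ℕ} (h : ℕ) (y : Fin l → ZMod 2) (w : Fin r → ZMod 2) :
    lookup l h (Fin.append y w) = (bit h (code l y) : ZMod 2) := by
  rw [lookup, prefixNum_eq_code (Nat.le_add_right l r)]
  congr 4
  funext i
  exact Fin.append_left y w i

theorem ite_lookup_append {l r : ℕ} (h : ℕ) (y : Fin l → ZMod 2) (w : Fin r → ZMod 2) :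
    (if lookup l h (Fin.append y w) = 1 then (1 : ℝ) else 0) = bit h (code l y) := by
  rw [lookup_append]
  have := bit_lt_two h (code l y)
  interval_cases bit h (code l y) <;> simp

/-- The distribution of the first `l` bits. -/
theorem map_castAdd_apply {l r : ℕ} (X : PMF (Fin (l + r) → ZMod 2)) (y : Fin l → ZMod 2) :
    ((X.map fun x i => x (Fin.castAdd r i)) y).toReal =
      ∑ w : Fin r → ZMod 2, (X (Fin.append y w)).toReal := by
  classical
  rw [PMF.map_apply, tsum_fintype, ENNReal.toReal_sum]
  · rw [sum_append, Finset.sum_eq_single_of_mem y (Finset.mem_univ y)]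
    · refine Finset.sum_congr rfl fun w _ => ?_
      rw [if_pos]
      funext i
      exact (Fin.append_left y w i).symm
    · intro y' _ hy'
      refine Finset.sum_eq_zero fun w _ => ?_
      rw [if_neg, ENNReal.toReal_zero]
      intro h
      refine hy' (funext fun i => ?_)
      rw [h]
      exact (Fin.append_left y' w i).symm
  · intro x _
    split_ifs
    · exact X.apply_ne_top x
    · exact ENNReal.zero_ne_top

/-- The probability that a source hits a light point `x` with `h(x) = 1` is at most the truncated
mass that the distribution of the first `l` bits gives to `h`. -/
theorem prob_light_le {l r k : ℕ} (h : ℕ) (X : PMF (Fin (l + r) → ZMod 2)) :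
    prob X {x | x ∈ lightPoints X k ∧ lookup l h x = 1} ≤
      ∑ y : Fin l → ZMod 2, bit h (code l y) *
        min ((X.map fun x i => x (Fin.castAdd r i)) y).toReal (2 ^ r * ((2 : ℝ) ^ k)⁻¹) := by
  classical
  rw [prob_eq_sum, sum_append]
  refine Finset.sum_le_sum fun y _ => ?_
  have e : ∀ w : Fin r → ZMod 2, (X (Fin.append y w)).toReal *
      (if Fin.append y w ∈ {x | x ∈ lightPoints X k ∧ lookup l h x = 1} then (1 : ℝ) else 0) ≤
        bit h (code l y) * min (X (Fin.append y w)).toReal ((2 : ℝ) ^ k)⁻¹ := by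
    intro w
    rw [← ite_lookup_append h y w]
    have h0 : 0 ≤ (X (Fin.append y w)).toReal := ENNReal.toReal_nonneg
    by_cases hw : Fin.append y w ∈ lightPoints X k ∧ lookup l h (Fin.append y w) = 1
    · rw [if_pos (show Fin.append y w ∈ {x | x ∈ lightPoints X k ∧ lookup l h x = 1} from hw),
        if_pos hw.2, mul_one, one_mul, min_eq_left hw.1]
    · rw [if_neg (show Fin.append y w ∉ {x | x ∈ lightPoints X k ∧ lookup l h x = 1} from hw),
        mul_zero]
      exact mul_nonneg (by split_ifs <;> norm_num) (le_min h0 (by positivity))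
  refine (Finset.sum_le_sum fun w _ => e w).trans ?_
  rw [← Finset.mul_sum, map_castAdd_apply]
  refine mul_le_mul_of_nonneg_left (le_min ?_ ?_) (by positivity)
  · exact Finset.sum_le_sum fun w _ => min_le_left _ _
  · refine (Finset.sum_le_sum fun w _ => min_le_right _ _).trans_eq ?_
    simp

theorem map_castAdd_mem_polySources {l r d : ℕ} {X : PMF (Fin (l + r) → ZMod 2)}
    (hX : X ∈ polySources (l + r) d) :
    (X.map fun x i => x (Fin.castAdd r i)) ∈ polySources l d := by
  obtain ⟨m, P, hP, rfl⟩ := hX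
  exact ⟨m, fun i => P (Fin.castAdd r i), fun i => hP _, by rw [PMF.map_comp]; rfl⟩

/-- The truncated masses of arbitrary sources are controlled by those of the finitely many coded
ones. -/
theorem sum_min_le_of_isGood {q num den h : ℕ} (hden : 0 < den) (hg : IsGood q num den h)
    {Y : PMF (Fin (10 * q) → ZMod 2)} (hY : Y ∈ polySources (10 * q) q) :
    ∑ y : Fin (10 * q) → ZMod 2, (bit h (code (10 * q) y) : ℝ) *
        min (Y y).toReal ((2 : ℝ) ^ (9 * q))⁻¹ ≤
      num / den + ((2 : ℝ) ^ q)⁻¹ + ((2 : ℝ) ^ (5 * q))⁻¹ := by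
  obtain ⟨P, hP, hclose⟩ := exists_source_close (20 * q) hY
  obtain ⟨F, hF, hcoord⟩ := exists_coord_eq P hP
  set Z := (unif (20 * q)).map (fun u i => MvPolynomial.eval u (P i)) with hZ
  have hmass := hg.2 F hF
  have hmass' : (mass q h F : ℝ) = 2 ^ (20 * q) * ∑ y : Fin (10 * q) → ZMod 2,
      (bit h (code (10 * q) y) : ℝ) * min (Z y).toReal ((2 : ℝ) ^ (9 * q))⁻¹ := by
    rw [mass, sum_range_two_pow, Finset.mul_sum]
    push_cast
    refine Finset.sum_congr rfl fun y _ => ?_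
    rw [hits_eq_prob P hcoord, mul_left_comm,
      mul_min_of_nonneg _ _ (show (0 : ℝ) ≤ 2 ^ (20 * q) by positivity)]
    congr 2
    rw [eq_mul_inv_iff_mul_eq₀ (by positivity), ← pow_add]
    congr 1
    ring
  have hle : ∑ y : Fin (10 * q) → ZMod 2, (bit h (code (10 * q) y) : ℝ) *
      min (Z y).toReal ((2 : ℝ) ^ (9 * q))⁻¹ ≤ num / den + ((2 : ℝ) ^ q)⁻¹ := by
    have hd : (0 : ℝ) < den := by exact_mod_cast hden
    have : (den : ℝ) * 2 ^ q * mass q h F ≤ (num * 2 ^ q + den) * 2 ^ (20 * q) := by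
      exact_mod_cast hmass
    rw [hmass'] at this
    have e : (num / den + ((2 : ℝ) ^ q)⁻¹ : ℝ) =
        (num * 2 ^ q + den) / (den * 2 ^ q) := by field_simp
    rw [e, le_div_iff₀ (by positivity)]
    refine le_of_mul_le_mul_right ?_ (show (0 : ℝ) < 2 ^ (20 * q) by positivity)
    linarith
  have hdist : ∑ z, |(Z z).toReal - (Y z).toReal| ≤ ((2 : ℝ) ^ (5 * q))⁻¹ := by
    refine le_of_sq_le_sq (hclose.trans_eq ?_) (by positivity)
    rw [div_eq_iff (by positivity), inv_pow, eq_comm, inv_mul_eq_iff_eq_mul₀ (by positivity),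
      ← pow_mul, ← pow_add]
    congr 1
    ring
  refine le_trans ?_ (add_le_add hle hdist)
  rw [← Finset.sum_add_distrib]
  refine Finset.sum_le_sum fun y _ => ?_
  have hb : (bit h (code (10 * q) y) : ℝ) ≤ 1 := by
    exact_mod_cast Nat.lt_succ_iff.1 (bit_lt_two _ _)
  have hmin : min (Y y).toReal ((2 : ℝ) ^ (9 * q))⁻¹ ≤
      min (Z y).toReal ((2 : ℝ) ^ (9 * q))⁻¹ + |(Z y).toReal - (Y y).toReal| := by
    rcases min_cases (Z y).toReal ((2 : ℝ) ^ (9 * q))⁻¹ with ⟨h1, -⟩ | ⟨h1, -⟩ <;> rw [h1]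
    · have := neg_abs_le ((Z y).toReal - (Y y).toReal)
      linarith [min_le_left (Y y).toReal ((2 : ℝ) ^ (9 * q))⁻¹]
    · have := abs_nonneg ((Z y).toReal - (Y y).toReal)
      linarith [min_le_right (Y y).toReal ((2 : ℝ) ^ (9 * q))⁻¹]
  have hb0 : (0 : ℝ) ≤ bit h (code (10 * q) y) := by positivity
  nlinarith [abs_nonneg ((Z y).toReal - (Y y).toReal)]

/-- A good truth table on the first `10 q` bits is an isolator. -/
theorem isIsolator_lookup {q num den h n : ℕ} (hden : 0 < den) (hg : IsGood q num den h)
    (hn : 10 * q ≤ n) : IsIsolator (n := n) (num / den)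
      (num / den + ((2 : ℝ) ^ q)⁻¹ + ((2 : ℝ) ^ (5 * q))⁻¹) (n - q) (polySources n q)
      (lookup (10 * q) h) := by
  classical
  obtain ⟨r, rfl⟩ := Nat.exists_eq_add_of_le hn
  constructor
  · have e : prob (unif (10 * q + r)) {x | lookup (10 * q) h x = 1} =
        (∑ y : Fin (10 * q) → ZMod 2, (bit h (code (10 * q) y) : ℝ)) / 2 ^ (10 * q) := by
      rw [prob_eq_sum, sum_append]
      simp only [Set.mem_ofPred_eq, ite_lookup_append, unif, PMF.uniformOfFintype_apply,
        ENNReal.toReal_inv, ENNReal.toReal_natCast, Finset.sum_const, nsmul_eq_mul,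
        ← Finset.mul_sum, Finset.card_univ, Fintype.card_pi, ZMod.card, Finset.prod_const,
        Fintype.card_fin]
      push_cast
      rw [pow_add]
      field_simp
    have hd : (0 : ℝ) < den := by exact_mod_cast hden
    rw [e, div_le_div_iff₀ hd (by positivity)]
    have := hg.1
    rw [sum_range_two_pow] at this
    rw [mul_comm (∑ y, _)]
    exact_mod_cast this
  · intro X hX
    refine (prob_light_le h X).trans ?_
    refine le_trans (le_of_eq ?_) (sum_min_le_of_isGood hden hg (map_castAdd_mem_polySources hX))
    have e : (2 : ℝ) ^ r * (2 ^ (10 * q + r - q))⁻¹ = (2 ^ (9 * q))⁻¹ := by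
      rw [show 10 * q + r - q = 9 * q + r by omega, pow_add]
      field_simp
    rw [e]

/-! ### Random truth tables are good -/

theorem one_sub_add_mul_exp_le {p x : ℝ} (hp : 0 ≤ p) (hx : |x| ≤ 1) :
    p * exp x + (1 - p) ≤ exp (p * (x + x ^ 2)) := by
  have h1 := (abs_le.1 (Real.abs_exp_sub_one_sub_id_le hx)).2
  have h2 := Real.add_one_le_exp (p * (x + x ^ 2))
  nlinarith

/-- Among subsets chosen by including each point independently with probability `p`, the mean of
`exp (∑ f)`. -/
theorem sum_powerset_exp_le {B : Type} [Fintype B] [DecidableEq B] {p : ℝ} (hp0 : 0 ≤ p)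
    (hp1 : p ≤ 1) (f : B → ℝ) (hf : ∀ y, |f y| ≤ 1) :
    ∑ T ∈ (Finset.univ : Finset B).powerset,
        (∏ _y ∈ T, p) * (∏ _y ∈ Finset.univ \ T, (1 - p)) * exp (∑ y ∈ T, f y) ≤
      exp (p * (∑ y, f y + ∑ y, f y ^ 2)) := by
  have e : ∀ T ∈ (Finset.univ : Finset B).powerset,
      (∏ _y ∈ T, p) * (∏ _y ∈ Finset.univ \ T, (1 - p)) * exp (∑ y ∈ T, f y) =
        (∏ y ∈ T, p * exp (f y)) * ∏ _y ∈ Finset.univ \ T, (1 - p) := by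
    intro T _
    rw [exp_sum, Finset.prod_mul_distrib]
    ring
  rw [Finset.sum_congr rfl e, ← Finset.prod_add, ← Finset.sum_add_distrib, Finset.mul_sum, exp_sum]
  exact Finset.prod_le_prod (fun y _ => add_nonneg (by positivity) (by linarith))
    fun y _ => one_sub_add_mul_exp_le hp0 (hf y)

/-- Sampling without large deviations: some subset has nearly the expected sum for every function
of a not too large family of bounded functions. -/
theorem exists_subset_sum_lt {B : Type} [Fintype B] [DecidableEq B] {p τ γ : ℝ} (hp0 : 0 ≤ p)
    (hp1 : p ≤ 1) (hτ : 0 < τ) (hγ : 0 < γ) (hγ1 : γ ≤ 1) (S : Finset (B → ℝ))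
    (hS : ∀ f ∈ S, (∀ y, |f y| ≤ τ) ∧ ∑ y, |f y| ≤ 1) (hcard : S.card < exp (γ ^ 2 / (16 * τ))) :
    ∃ T : Finset B, ∀ f ∈ S, ∑ y ∈ T, f y < p * ∑ y, f y + γ / 2 := by
  by_contra! hcon
  -- the exponent that optimizes the bound, up to a constant factor
  set c := γ / (4 * τ) with hc
  have hc0 : 0 < c := by positivity
  have hcτ : c * τ ≤ 1 := by
    rw [hc]
    have : γ / (4 * τ) * τ = γ / 4 := by field_simp
    linarith
  set w : Finset B → ℝ := fun T => (∏ _y ∈ T, p) * (∏ _y ∈ Finset.univ \ T, (1 - p)) with hw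
  have hw0 : ∀ T, 0 ≤ w T := fun T =>
    mul_nonneg (Finset.prod_nonneg fun _ _ => hp0) (Finset.prod_nonneg fun _ _ => by linarith)
  have hw1 : ∑ T ∈ (Finset.univ : Finset B).powerset, w T = 1 := by
    rw [hw, ← Finset.prod_add]
    simp
  have hmean : ∀ f ∈ S, ∑ T ∈ (Finset.univ : Finset B).powerset,
      w T * exp (c * (∑ y ∈ T, f y) - c * (p * ∑ y, f y + γ / 2)) ≤
        exp (-(γ ^ 2 / (16 * τ))) := by
    intro f hf
    obtain ⟨h1, h2⟩ := hS f hf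
    have hcf : ∀ y, |c * f y| ≤ 1 := fun y => by
      rw [abs_mul, abs_of_pos hc0]
      exact (mul_le_mul_of_nonneg_left (h1 y) hc0.le).trans hcτ
    have key := sum_powerset_exp_le hp0 hp1 (fun y => c * f y) hcf
    have hsq : ∑ y, (c * f y) ^ 2 ≤ c ^ 2 * τ := by
      calc ∑ y, (c * f y) ^ 2 ≤ ∑ y, c ^ 2 * τ * |f y| := by
            refine Finset.sum_le_sum fun y _ => ?_
            rw [mul_pow, mul_assoc, ← sq_abs (f y), sq |f y|]
            exact mul_le_mul_of_nonneg_left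
              (mul_le_mul_of_nonneg_right (h1 y) (abs_nonneg _)) (sq_nonneg c)
        _ = c ^ 2 * τ * ∑ y, |f y| := by rw [Finset.mul_sum]
        _ ≤ c ^ 2 * τ := mul_le_of_le_one_right (by positivity) h2
    have hsq0 : 0 ≤ ∑ y, (c * f y) ^ 2 := Finset.sum_nonneg fun _ _ => sq_nonneg _
    simp only [sub_eq_add_neg _ (c * (p * _ + _)), exp_add, ← mul_assoc, ← Finset.sum_mul]
    simp only [← Finset.mul_sum] at key
    refine (mul_le_mul_of_nonneg_right key (exp_pos _).le).trans ?_
    rw [← exp_add, exp_le_exp]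
    have e1 : c ^ 2 * τ = γ ^ 2 / (16 * τ) := by rw [hc]; field_simp; norm_num
    have e2 : c * (γ / 2) = 2 * (γ ^ 2 / (16 * τ)) := by rw [hc]; field_simp; norm_num
    have : p * ∑ y, (c * f y) ^ 2 ≤ c ^ 2 * τ :=
      (mul_le_of_le_one_left hsq0 hp1).trans hsq
    nlinarith
  have hone : ∀ T : Finset B,
      1 ≤ ∑ f ∈ S, exp (c * (∑ y ∈ T, f y) - c * (p * ∑ y, f y + γ / 2)) := by
    intro T
    obtain ⟨f, hf, hT⟩ := hcon T
    refine le_trans ?_ (Finset.single_le_sum (fun g _ => (exp_pos _).le) hf)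
    rw [← exp_zero, exp_le_exp, sub_nonneg]
    exact mul_le_mul_of_nonneg_left hT hc0.le
  have : (1 : ℝ) ≤ S.card * exp (-(γ ^ 2 / (16 * τ))) := by
    calc (1 : ℝ) = ∑ T ∈ (Finset.univ : Finset B).powerset, w T * 1 := by
          simp only [mul_one, hw1]
      _ ≤ ∑ T ∈ (Finset.univ : Finset B).powerset, w T *
          ∑ f ∈ S, exp (c * (∑ y ∈ T, f y) - c * (p * ∑ y, f y + γ / 2)) :=
        Finset.sum_le_sum fun T _ => mul_le_mul_of_nonneg_left (hone T) (hw0 T)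
      _ = ∑ f ∈ S, ∑ T ∈ (Finset.univ : Finset B).powerset,
          w T * exp (c * (∑ y ∈ T, f y) - c * (p * ∑ y, f y + γ / 2)) := by
        simp only [Finset.mul_sum]
        exact Finset.sum_comm
      _ ≤ ∑ f ∈ S, exp (-(γ ^ 2 / (16 * τ))) := Finset.sum_le_sum hmean
      _ = _ := by rw [Finset.sum_const, nsmul_eq_mul]
  rw [exp_neg, ← div_eq_mul_inv, le_div_iff₀ (exp_pos _), one_mul] at this
  exact absurd hcard (not_lt.2 this)

/-- The number of monomials of degree at most `q` in `20 q` variables. -/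
theorem card_low_weight_le (q : ℕ) :
    Fintype.card {x : Fin (20 * q) → ZMod 2 // ∑ k, (x k).val ≤ q} ≤ 2 ^ (6 * q) := by
  classical
  have h1 : (Fintype.card {x : Fin (20 * q) → ZMod 2 // ∑ k, (x k).val ≤ q} : ℝ) ≤
      ∑ x : Fin (20 * q) → ZMod 2, 32 ^ q * ∏ k, (1 / 32 : ℝ) ^ (x k).val := by
    rw [Fintype.card_subtype, ← Finset.sum_boole]
    refine Finset.sum_le_sum fun x _ => ?_
    split_ifs with h
    · rw [Finset.prod_pow_eq_pow_sum, one_div, inv_pow, ← div_eq_mul_inv,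
        le_div_iff₀ (by positivity), one_mul]
      exact pow_le_pow_right₀ (by norm_num) h
    · positivity
  have h2 : ∑ x : Fin (20 * q) → ZMod 2, ∏ k, (1 / 32 : ℝ) ^ (x k).val = (33 / 32) ^ (20 * q) := by
    have := Finset.prod_univ_sum (fun _ : Fin (20 * q) => (Finset.univ : Finset (ZMod 2)))
      (fun _ b => (1 / 32 : ℝ) ^ b.val)
    rw [Fintype.piFinset_univ] at this
    rw [← this]
    have e : ∑ b : ZMod 2, (1 / 32 : ℝ) ^ b.val = 33 / 32 := by
      rw [show (Finset.univ : Finset (ZMod 2)) = {0, 1} from rfl, Finset.sum_pair (by decide),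
        ZMod.val_zero, ZMod.val_one]
      norm_num
    simp only [e, Finset.prod_const, Finset.card_univ, Fintype.card_fin]
  rw [← Finset.mul_sum, h2] at h1
  have h3 : (32 : ℝ) ^ q * (33 / 32) ^ (20 * q) ≤ 2 ^ (6 * q) := by
    rw [pow_mul, pow_mul, ← mul_pow]
    exact pow_le_pow_left₀ (by norm_num) (by norm_num) _
  exact_mod_cast h1.trans h3

/-- The number of hits depends only on the coefficients of the monomials of degree at most `q`. -/
theorem hits_congr {q F F' : ℕ} (h : ∀ x : Fin (20 * q) → ZMod 2, ∑ k, (x k).val ≤ q →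
    ∀ i < 10 * q, bit F (code (20 * q) x * (10 * q) + i) =
      bit F' (code (20 * q) x * (10 * q) + i)) (z : ℕ) : hits q F z = hits q F' z := by
  rw [hits, hits, sum_range_two_pow, sum_range_two_pow]
  refine Finset.sum_congr rfl fun u _ => ?_
  have : ∀ i < 10 * q, coord q F i (code (20 * q) u) = coord q F' i (code (20 * q) u) := by
    intro i hi
    rw [coord_code, coord_code]
    congr 1
    refine Finset.sum_congr rfl fun x _ => ?_
    by_cases hx : ∑ k, (x k).val ≤ q
    · rw [h x hx i hi]
    · rw [ind_of_false fun h => hx h.1, zero_mul, zero_mul]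
  congr 1
  refine propext (forall₂_congr fun i hi => ?_)
  rw [this i hi]

theorem sum_hits_le (q F : ℕ) :
    ∑ y : Fin (10 * q) → ZMod 2, hits q F (code (10 * q) y) ≤ 2 ^ (20 * q) := by
  simp only [hits]
  rw [Finset.sum_comm]
  refine (Finset.sum_le_sum (g := fun _ => 1) fun u _ => ?_).trans_eq (by simp)
  have key : ∀ y : Fin (10 * q) → ZMod 2,
      ind (∀ i < 10 * q, coord q F i u = bit (code (10 * q) y) i) ≤
        if y = fun i : Fin (10 * q) => (coord q F i u : ZMod 2) then 1 else 0 := by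
    intro y
    by_cases h : ∀ i < 10 * q, coord q F i u = bit (code (10 * q) y) i
    · rw [ind_of_true h, if_pos]
      funext i
      rw [h i i.2, bit_code, ZMod.natCast_val, ZMod.cast_id]
    · rw [ind_of_false h]
      exact Nat.zero_le _
  refine (Finset.sum_le_sum fun y _ => key y).trans_eq ?_
  simp

/-- Good truth tables exist, because the number of truncated source distributions is much less than
the inverse of the probability of a large deviation. -/
theorem exists_isGood {q num den : ℕ} (hq : 11 ≤ q) (hden : 0 < den) (hnum : 2 * num ≤ den) :
    ∃ h < 2 ^ 2 ^ (10 * q), IsGood q num den h := by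
  classical
  have hd : (0 : ℝ) < den := by exact_mod_cast hden
  have hα : (num / den : ℝ) ≤ 1 / 2 := by
    rw [div_le_iff₀ hd]
    have : (2 * num : ℝ) ≤ den := by exact_mod_cast hnum
    linarith
  set τ : ℝ := ((2 : ℝ) ^ (9 * q))⁻¹ with hτ
  set γ : ℝ := ((2 : ℝ) ^ q)⁻¹ with hγ
  have hτ0 : 0 < τ := by positivity
  have hγ0 : 0 < γ := by positivity
  have hγ1 : γ ≤ 1 := inv_le_one_of_one_le₀ (one_le_pow₀ (by norm_num))
  let f : ℕ → (Fin (10 * q) → ZMod 2) → ℝ := fun F y =>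
    min (hits q F (code (10 * q) y) / 2 ^ (20 * q)) τ
  have hf0 : ∀ F y, 0 ≤ f F y := fun F y => le_min (by positivity) hτ0.le
  have hfs : ∀ F, ∑ y, f F y ≤ 1 := by
    intro F
    refine (Finset.sum_le_sum fun y _ => min_le_left _ _).trans ?_
    rw [← Finset.sum_div, div_le_one (by positivity)]
    exact_mod_cast sum_hits_le q F
  let coeffs : ℕ → Fin (10 * q) × {x : Fin (20 * q) → ZMod 2 // ∑ k, (x k).val ≤ q} → Fin 2 :=
    fun F s => ⟨bit F (code (20 * q) s.2 * (10 * q) + s.1), bit_lt_two _ _⟩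
  have hfac : ∀ F F', coeffs F = coeffs F' → f F = f F' := by
    intro F F' h
    funext y
    simp only [f]
    rw [hits_congr fun x hx i hi => ?_]
    exact congrArg Fin.val (congrFun h (⟨i, hi⟩, ⟨x, hx⟩))
  set R := (Finset.range (2 ^ (10 * q * 2 ^ (20 * q)))).image f with hR
  have hRcard : R.card ≤ 2 ^ (10 * q * 2 ^ (6 * q)) := by
    have e : f = Function.extend coeffs f 0 ∘ coeffs := by
      funext F
      exact (Function.FactorsThrough.extend_apply (fun F F' h => hfac F F' h) 0 F).symm
    rw [hR, e, ← Finset.image_image]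
    refine Finset.card_image_le.trans ((Finset.card_le_univ _).trans ?_)
    rw [Fintype.card_fun, Fintype.card_prod, Fintype.card_fin, Fintype.card_fin]
    exact Nat.pow_le_pow_right (by norm_num) (Nat.mul_le_mul_left _ (card_low_weight_le q))
  -- the constant function controls the density of the set from below
  let f₀ : (Fin (10 * q) → ZMod 2) → ℝ := fun _ => -((2 : ℝ) ^ (10 * q))⁻¹
  have hS : ∀ g ∈ insert f₀ R, (∀ y, |g y| ≤ τ) ∧ ∑ y, |g y| ≤ 1 := by
    intro g hg
    rcases Finset.mem_insert.1 hg with rfl | hg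
    · simp only [f₀, abs_neg, abs_inv, abs_pow, Nat.abs_ofNat]
      refine ⟨fun _ => ?_, ?_⟩
      · exact inv_anti₀ (by positivity) (pow_le_pow_right₀ (by norm_num) (by omega))
      · simp
    · obtain ⟨F, -, rfl⟩ := Finset.mem_image.1 hg
      simp only [abs_of_nonneg (hf0 F _)]
      exact ⟨fun y => min_le_right _ _, hfs F⟩
  have hcard : ((insert f₀ R).card : ℝ) < exp (γ ^ 2 / (16 * τ)) := by
    have h1 : (insert f₀ R).card ≤ 2 ^ (10 * q * 2 ^ (6 * q) + 1) := by
      refine (Finset.card_insert_le _ _).trans ?_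
      rw [pow_succ]
      have := Nat.one_le_two_pow (n := 10 * q * 2 ^ (6 * q))
      omega
    have h2 : (2 : ℝ) ^ (10 * q * 2 ^ (6 * q) + 1) < exp (γ ^ 2 / (16 * τ)) := by
      refine (pow_lt_pow_left₀ (show (2 : ℝ) < exp 1 by linarith [exp_one_gt_d9]) (by norm_num)
        (by omega)).trans_le ?_
      rw [← exp_nat_mul, exp_le_exp, mul_one]
      have e : γ ^ 2 / (16 * τ) = 2 ^ (6 * q) * 2 ^ q / 16 := by
        rw [hγ, hτ, show 9 * q = 6 * q + q + (q + q) by ring]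
        simp only [pow_add]
        field_simp
      rw [e, le_div_iff₀ (by norm_num)]
      have hq' : 160 * q + 1 ≤ 2 ^ q := by
        clear * - hq
        induction q, hq using Nat.le_induction with
        | base => norm_num
        | succ k _ ih => rw [pow_succ]; omega
      have h6 : 16 ≤ 2 ^ (6 * q) := by
        calc 16 = 2 ^ 4 := by norm_num
          _ ≤ 2 ^ (6 * q) := Nat.pow_le_pow_right (by norm_num) (by omega)
      have : (10 * q * 2 ^ (6 * q) + 1) * 16 ≤ 2 ^ (6 * q) * 2 ^ q := by nlinarith
      exact_mod_cast this
    refine lt_of_le_of_lt ?_ h2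
    exact_mod_cast h1
  have hα0 : (0 : ℝ) ≤ num / den := by positivity
  -- half of the slack `γ` is spent on the density, so that it is at least `num / den`
  obtain ⟨T, hT⟩ := exists_subset_sum_lt (p := num / den + γ / 2) (by positivity) (by linarith)
    hτ0 hγ0 hγ1 _ hS hcard
  obtain ⟨h, hh, hbit⟩ := exists_bit_eq (fun j => if hj : j < 2 ^ (10 * q) then
    if (code (10 * q)).symm ⟨j, hj⟩ ∈ T then 1 else 0 else 0) (2 ^ (10 * q))
  have hbit' : ∀ y, (bit h (code (10 * q) y) : ℝ) = if y ∈ T then 1 else 0 := by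
    intro y
    rw [hbit _ (code (10 * q) y).2]
    simp only [Fin.is_lt, dif_pos, Fin.eta, Equiv.symm_apply_apply]
    split_ifs <;> simp [ZMod.val_one]
  have hsumT : ∀ g : (Fin (10 * q) → ZMod 2) → ℝ,
      ∑ y, (bit h (code (10 * q) y) : ℝ) * g y = ∑ y ∈ T, g y := by
    intro g
    simp only [hbit', ite_mul, one_mul, zero_mul]
    rw [Finset.sum_ite_mem, Finset.univ_inter]
  refine ⟨h, hh, ?_, fun F hF => ?_⟩
  · have := hT f₀ (Finset.mem_insert_self _ _)
    rw [← hsumT] at this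
    simp only [f₀, ← Finset.sum_mul, Finset.sum_const, Finset.card_univ, Fintype.card_pi,
      ZMod.card, Finset.prod_const, Fintype.card_fin, nsmul_eq_mul] at this
    push_cast at this
    rw [mul_neg, mul_neg, mul_inv_cancel₀ (by positivity), ← div_eq_mul_inv] at this
    have h1 : (num / den : ℝ) ≤ (∑ y : Fin (10 * q) → ZMod 2, (bit h (code (10 * q) y) : ℝ)) /
        2 ^ (10 * q) := by linarith
    rw [div_le_div_iff₀ hd (by positivity)] at h1
    rw [sum_range_two_pow, mul_comm den]
    exact_mod_cast h1
  · have := hT (f F) (Finset.mem_insert_of_mem (Finset.mem_image_of_mem _ (Finset.mem_range.2 hF)))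
    rw [← hsumT] at this
    have hp : (num / den + γ / 2) * ∑ y, f F y ≤ num / den + γ / 2 :=
      mul_le_of_le_one_right (by positivity) (hfs F)
    have hm : (mass q h F : ℝ) =
        2 ^ (20 * q) * ∑ y, (bit h (code (10 * q) y) : ℝ) * f F y := by
      rw [mass, sum_range_two_pow, Finset.mul_sum]
      push_cast
      refine Finset.sum_congr rfl fun y _ => ?_
      simp only [f]
      rw [mul_left_comm, mul_min_of_nonneg _ _ (show (0 : ℝ) ≤ 2 ^ (20 * q) by positivity),
        mul_div_cancel₀ _ (by positivity)]
      congr 2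
      rw [hτ, eq_mul_inv_iff_mul_eq₀ (by positivity), ← pow_add]
      congr 1
      ring
    have h1 : ∑ y, (bit h (code (10 * q) y) : ℝ) * f F y ≤
        (num * 2 ^ q + den) / (den * 2 ^ q) := by
      have e : (num * 2 ^ q + den) / (den * 2 ^ q) = num / den + γ := by rw [hγ]; field_simp
      rw [e]
      linarith
    rw [le_div_iff₀ (by positivity)] at h1
    have h2 : (den : ℝ) * 2 ^ q * mass q h F ≤ (num * 2 ^ q + den) * 2 ^ (20 * q) := by
      rw [hm]
      have := mul_le_mul_of_nonneg_right h1 (show (0 : ℝ) ≤ 2 ^ (20 * q) by positivity)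
      linarith
    exact_mod_cast h2

/-! ### The choice of parameters -/

/-- Good truth tables give suitable isolators and distributions that are hard to sample. -/
theorem IsGood.suitable_and_far {q num den h n t D : ℕ} {η : ℝ} (hg : IsGood q num den h)
    (hden : 0 < den) (hq : 0 < q) (hn : 10 * q ≤ n) (ht : 0 < t) (hD : 0 < D)
    (hd : D * (t + 1) ≤ q) (hβ : (num / den + ((2 : ℝ) ^ q)⁻¹ + ((2 : ℝ) ^ (5 * q))⁻¹ : ℝ) ≤ 1)
    (hη : (1 - num / den : ℝ) ^ (t + 1) + (2 * (t : ℝ) ^ 3 + 1) * ((2 : ℝ) ^ q)⁻¹ +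
      (num / den + ((2 : ℝ) ^ q)⁻¹ + ((2 : ℝ) ^ (5 * q))⁻¹) ≤ η) :
    IsSuitableIsolator (n := n) q t η (lookup (10 * q) h) ∧
      ∀ X ∈ polySources (t * n + t) D,
        1 - η ≤ tvDist (hardDist t (lookup (n := n) (10 * q) h)) X := by
  have hiso := isIsolator_lookup hden hg hn
  have hα0 : (0 : ℝ) ≤ num / den := by positivity
  have hγ0 : (0 : ℝ) ≤ ((2 : ℝ) ^ q)⁻¹ := by positivity
  have hγ0' : (0 : ℝ) ≤ ((2 : ℝ) ^ (5 * q))⁻¹ := by positivity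
  have hnq : n - (n - q) = q := by omega
  refine ⟨⟨_, _, n - q, hα0, by linarith, by positivity, hβ, by omega, by omega, hiso, ?_⟩,
    fun X hX => ?_⟩
  · rw [hnq]
    exact hη
  · refine le_trans ?_ (one_sub_le_tvDist_hardDist hD hd (by omega) hiso hX)
    rw [hnq]
    have ht1 : (1 : ℝ) ≤ t := by exact_mod_cast ht
    have : ((t : ℝ) + 1) * ((2 : ℝ) ^ q)⁻¹ ≤ (2 * (t : ℝ) ^ 3 + 1) * ((2 : ℝ) ^ q)⁻¹ := by
      refine mul_le_mul_of_nonneg_right ?_ hγ0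
      have : (t : ℝ) ≤ (t : ℝ) ^ 3 := le_self_pow₀ ht1 (by norm_num)
      linarith
    linarith

/-- The degree: a fortieth of `log log N`. Thus `10 q * 2 ^ (20 q)`, the number of digits of the
code of a source, is at most `log N`. For small `N` it is `0`. -/
def level (N : ℕ) : ℕ := Nat.log 2 (Nat.log 2 N) / 40

/-- The number of copies: about `log log N / (80 Δ)`. -/
def copies (N Δ : ℕ) : ℕ := level N / (2 * Δ)

/-- The density of the isolator is this number divided by the number of copies, so that at least
one of the copies is likely to lie in the isolated set. -/
def densityNum (N Δ : ℕ) : ℕ := Nat.log 2 (copies N Δ) + 1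

theorem Feas.level : Feas fun c => level (c.2 0) := (var 0).log.log.div (const 40)

theorem Feas.copies : Feas fun c => copies (c.2 0) (c.2 1) := level.div ((const 2).mul (var 1))

theorem Feas.densityNum : Feas fun c => densityNum (c.2 0) (c.2 1) := copies.log.add (const 1)

theorem two_pow_two_pow_le {N : ℕ} (h : 0 < level N) : 2 ^ 2 ^ (40 * level N) ≤ N := by
  have h1 : 40 * level N ≤ Nat.log 2 (Nat.log 2 N) := Nat.mul_div_le _ _
  have hN' : Nat.log 2 N ≠ 0 := by
    intro h0
    simp [level, h0] at h
  have h2 : 2 ^ (40 * level N) ≤ Nat.log 2 N := Nat.pow_le_of_le_log hN' h1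
  have hN : N ≠ 0 := by rintro rfl; simp at hN'
  exact Nat.pow_le_of_le_log hN h2

theorem two_pow_le_add_two {N e : ℕ} (h : e ≤ 2 ^ (40 * level N)) : 2 ^ e ≤ N + 2 := by
  rcases Nat.eq_zero_or_pos (level N) with h0 | h0
  · rw [h0] at h
    exact (Nat.pow_le_pow_right (by norm_num) h).trans (by norm_num)
  · exact ((Nat.pow_le_pow_right (by norm_num) h).trans (two_pow_two_pow_le h0)).trans (by omega)

theorem mul_level_le_two_pow {k m : ℕ} (N : ℕ) (hkm : k * level N ≤ m) : k * level N ≤ 2 ^ m :=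
  hkm.trans Nat.lt_two_pow_self.le

theorem copies_le_level {N Δ : ℕ} : copies N Δ ≤ level N := Nat.div_le_self _ _

/-- The hard distributions can be sampled, even though a truth table of the isolator has to be
found by exhaustive search: its length and the number of sources are tiny compared to `N`. -/
theorem polyTimeSamplable_table (A : Set (ℕ × ℕ)) (t num den : ℕ → ℕ → ℕ)
    (ht : Feas fun c => t (c.2 0) (c.2 1)) (hnum : Feas fun c => num (c.2 0) (c.2 1))
    (hden : Feas fun c => den (c.2 0) (c.2 1))
    (hN : ∀ N Δ, (N, Δ) ∈ A → t N Δ * 2 ^ (10 * level N) ≤ N) :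
    PolyTimeSamplable A (fun N Δ => hardDist (t N Δ)
      (lookup (n := 2 ^ (10 * level N)) (10 * level N)
        (table (level N) (num N Δ) (den N Δ)))) := by
  refine polyTimeSamplable_hardDist A (fun N _ => level N) t num den (fun N _ => N + 2)
    Feas.level ht hnum hden ((Feas.var 0).add (.const 2)) (fun N _ => ?_) (fun N _ => ?_)
    (fun N _ => ?_) hN
  · exact two_pow_le_add_two (mul_level_le_two_pow N (by omega))
  · exact two_pow_le_add_two (Nat.pow_le_pow_right (by norm_num) (by omega))
  · refine two_pow_le_add_two ?_
    calc 10 * level N * 2 ^ (20 * level N) ≤ 2 ^ (20 * level N) * 2 ^ (20 * level N) :=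
          Nat.mul_le_mul_right _ (mul_level_le_two_pow N (by omega))
      _ = 2 ^ (40 * level N) := by rw [← pow_add]; congr 1; ring

/-- The constant `δ`. It is so small that there are at least twelve copies, which makes the density
of the isolator at most `1 / 2`. -/
noncomputable def deltaBound : ℝ := 1 / 1000

section

variable {N Δ : ℕ}

theorem logb_nat_lt (N : ℕ) : logb 2 (N : ℝ) < Nat.log 2 N + 1 := by
  rcases Nat.eq_zero_or_pos N with rfl | hN
  · simp
  · rw [logb_lt_iff_lt_rpow one_lt_two (by exact_mod_cast hN)]
    exact_mod_cast Nat.lt_pow_succ_log_self one_lt_two N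

theorem natLog_le_logb {N : ℕ} (hN : N ≠ 0) : (Nat.log 2 N : ℝ) ≤ logb 2 (N : ℝ) := by
  rw [le_logb_iff_rpow_le one_lt_two (by exact_mod_cast Nat.pos_of_ne_zero hN)]
  exact_mod_cast Nat.pow_log_le_self 2 hN

theorem logb_pos_of_loglog_pos (h : 0 < loglog N) : 1 < logb 2 (N : ℝ) := by
  have h0 : 0 ≤ logb 2 (N : ℝ) := by
    rcases Nat.eq_zero_or_pos N with rfl | hN
    · simp
    · exact logb_nonneg one_lt_two (by exact_mod_cast hN)
  by_contra! hle
  rcases h0.eq_or_lt with he | hlt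
  · rw [loglog, ← he, logb_zero] at h
    exact lt_irrefl _ h
  · exact absurd h (not_lt.2 (logb_nonpos one_lt_two h0 hle))

theorem loglog_le (h : 0 < loglog N) : loglog N ≤ Nat.log 2 (Nat.log 2 N) + 1 := by
  have h1 := logb_pos_of_loglog_pos h
  rw [loglog, logb_le_iff_le_rpow one_lt_two (by linarith)]
  have h2 : Nat.log 2 N + 1 ≤ 2 ^ (Nat.log 2 (Nat.log 2 N) + 1) :=
    Nat.lt_pow_succ_log_self one_lt_two _
  have h3 : ((Nat.log 2 N + 1 : ℕ) : ℝ) ≤ ((2 ^ (Nat.log 2 (Nat.log 2 N) + 1) : ℕ) : ℝ) := by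
    exact_mod_cast h2
  push_cast at h3
  refine ((logb_nat_lt N).le.trans h3).trans_eq ?_
  exact_mod_cast rfl

theorem le_loglog (h : 0 < loglog N) : (Nat.log 2 (Nat.log 2 N) : ℝ) ≤ loglog N := by
  have h1 := logb_pos_of_loglog_pos h
  have hN : N ≠ 0 := by rintro rfl; simp at h1; linarith
  have hl : Nat.log 2 N ≠ 0 := by
    intro h0
    have h2 : N < 2 := by
      by_contra! h2
      exact (Nat.log_pos one_lt_two h2).ne' h0
    have : N = 1 := by omega
    rw [this] at h1
    simp at h1
    linarith
  refine (natLog_le_logb hl).trans ?_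
  exact logb_le_logb_of_le one_lt_two (by exact_mod_cast Nat.pos_of_ne_zero hl)
    (natLog_le_logb hN)

theorem pos_of_mem_admissible (h : (N, Δ) ∈ admissible deltaBound) :
    0 < Δ ∧ 1000 * (Δ : ℝ) ≤ loglog N := by
  obtain ⟨-, h1, h2⟩ := h
  refine ⟨h1, ?_⟩
  simp only [deltaBound] at h2
  linarith

theorem loglog_pos_of_mem_admissible (h : (N, Δ) ∈ admissible deltaBound) : 0 < loglog N := by
  obtain ⟨h1, h2⟩ := pos_of_mem_admissible h
  have : (0 : ℝ) < Δ := by exact_mod_cast h1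
  linarith

theorem mul_le_level (h : (N, Δ) ∈ admissible deltaBound) : 24 * Δ ≤ level N := by
  obtain ⟨h1, h2⟩ := pos_of_mem_admissible h
  have h3 := h2.trans (loglog_le (loglog_pos_of_mem_admissible h))
  have h4 : 1000 * Δ ≤ Nat.log 2 (Nat.log 2 N) + 1 := by exact_mod_cast h3
  rw [level, Nat.le_div_iff_mul_le (by norm_num)]
  omega

theorem twelve_le_copies (h : (N, Δ) ∈ admissible deltaBound) : 12 ≤ copies N Δ := by
  have h1 := (pos_of_mem_admissible h).1
  have h2 := mul_le_level h
  rw [copies, Nat.le_div_iff_mul_le (by omega)]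
  omega

theorem mul_copies_add_one_le (h : (N, Δ) ∈ admissible deltaBound) :
    Δ * (copies N Δ + 1) ≤ level N := by
  have h2 := mul_le_level h
  have h3 : copies N Δ * (2 * Δ) ≤ level N := Nat.div_mul_le_self _ _
  nlinarith

theorem two_mul_densityNum_le (h : (N, Δ) ∈ admissible deltaBound) :
    2 * densityNum N Δ ≤ copies N Δ := by
  have h1 := twelve_le_copies h
  have h2 : 3 ≤ Nat.log 2 (copies N Δ) := Nat.le_log_of_pow_le one_lt_two (by omega)
  have h3 : 2 ^ Nat.log 2 (copies N Δ) ≤ copies N Δ := Nat.pow_log_le_self 2 (by omega)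
  have h4 : ∀ k, 3 ≤ k → 2 * (k + 1) ≤ 2 ^ k := by
    intro k hk
    induction k, hk using Nat.le_induction with
    | base => norm_num
    | succ k _ ih => rw [pow_succ]; omega
  exact (h4 _ h2).trans h3

theorem pow_four_le_two_pow {q : ℕ} (hq : 16 ≤ q) : q ^ 4 ≤ 2 ^ q := by
  induction q, hq using Nat.le_induction with
  | base => norm_num
  | succ k hk ih =>
    rw [pow_succ 2]
    have h2 : 16 * k ≤ k ^ 2 := by nlinarith
    have h3 : 16 * k ^ 2 ≤ k ^ 3 := by nlinarith
    have h4 : 16 * k ^ 3 ≤ k ^ 4 := by nlinarith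
    nlinarith

/-- The ratio `densityNum / copies` is of the order of the rate. -/
theorem densityNum_div_copies_le (h : (N, Δ) ∈ admissible deltaBound) :
    (densityNum N Δ : ℝ) / copies N Δ ≤ 320 * rate N Δ := by
  obtain ⟨h1, h2⟩ := pos_of_mem_admissible h
  have hL := loglog_pos_of_mem_admissible h
  have hΔ : (0 : ℝ) < Δ := by exact_mod_cast h1
  have ht := twelve_le_copies h
  have ht' : (12 : ℝ) ≤ copies N Δ := by exact_mod_cast ht
  set x := loglog N / (Δ : ℝ) with hx
  have hx1000 : 1000 ≤ x := by rw [hx, le_div_iff₀ hΔ]; exact h2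
  have hrate : rate N Δ = logb 2 x / x := by rw [rate, ← hx, hx]; field_simp
  have hlog : 1 ≤ logb 2 x := by
    rw [le_logb_iff_rpow_le one_lt_two (by linarith), rpow_one]
    linarith
  have hx160 : x ≤ 160 * copies N Δ := by
    rw [hx, div_le_iff₀ hΔ]
    have h3 : Nat.log 2 (Nat.log 2 N) + 1 ≤ 160 * copies N Δ * Δ := by
      have e1 : Nat.log 2 (Nat.log 2 N) < 40 * (level N + 1) :=
        Nat.lt_mul_div_succ _ (by norm_num)
      have e2 : level N < 2 * Δ * (copies N Δ + 1) := Nat.lt_mul_div_succ _ (by omega)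
      nlinarith
    refine (loglog_le hL).trans ?_
    exact_mod_cast h3
  have htx : (copies N Δ : ℝ) ≤ x := by
    rw [hx, le_div_iff₀ hΔ]
    have h3 : copies N Δ * Δ ≤ Nat.log 2 (Nat.log 2 N) := by
      have e1 : 40 * level N ≤ Nat.log 2 (Nat.log 2 N) := Nat.mul_div_le _ _
      have e2 := mul_copies_add_one_le h
      nlinarith
    refine le_trans ?_ (le_loglog hL)
    exact_mod_cast h3
  have hnum : (densityNum N Δ : ℝ) ≤ 2 * logb 2 x := by
    have e1 : (Nat.log 2 (copies N Δ) : ℝ) ≤ logb 2 (copies N Δ : ℝ) := natLog_le_logb (by omega)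
    have e2 : logb 2 (copies N Δ : ℝ) ≤ logb 2 x :=
      logb_le_logb_of_le one_lt_two (by linarith) htx
    rw [densityNum]
    push_cast
    linarith
  rw [hrate, ← mul_div_assoc, div_le_div_iff₀ (by linarith) (by linarith)]
  calc (densityNum N Δ : ℝ) * x ≤ 2 * logb 2 x * (160 * copies N Δ) := by gcongr
    _ = _ := by ring

/-- The error of the isolator for `copies N Δ` copies. -/
theorem error_le (h : (N, Δ) ∈ admissible deltaBound) :
    (1 - densityNum N Δ / copies N Δ : ℝ) ^ (copies N Δ + 1) +
      (2 * (copies N Δ : ℝ) ^ 3 + 1) * ((2 : ℝ) ^ level N)⁻¹ +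
      (densityNum N Δ / copies N Δ + ((2 : ℝ) ^ level N)⁻¹ + ((2 : ℝ) ^ (5 * level N))⁻¹) ≤
        2240 * rate N Δ := by
  have hratio := densityNum_div_copies_le h
  set t := copies N Δ with ht
  set a := densityNum N Δ with ha
  set q := level N with hq
  have ht12 : 12 ≤ t := twelve_le_copies h
  have ht0 : (0 : ℝ) < t := by exact_mod_cast (show 0 < t by omega)
  have h2a : 2 * (a : ℝ) ≤ t := by exact_mod_cast two_mul_densityNum_le h
  have hα1 : (a / t : ℝ) ≤ 1 := by rw [div_le_one ht0]; linarith
  have htq : t ≤ q := copies_le_level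
  have h1 : (1 - a / t : ℝ) ^ (t + 1) ≤ 1 / t := by
    have e1 : (1 - a / t : ℝ) ≤ exp (-(a / t)) := by linarith [add_one_le_exp (-(a / t : ℝ))]
    calc (1 - a / t : ℝ) ^ (t + 1) ≤ (1 - a / t : ℝ) ^ t :=
          pow_le_pow_of_le_one (by linarith) (by linarith [show (0 : ℝ) ≤ a / t by positivity])
            (by omega)
      _ ≤ exp (-(a / t)) ^ t := pow_le_pow_left₀ (by linarith) e1 _
      _ = (exp 1 ^ a)⁻¹ := by
          rw [← exp_nat_mul, ← exp_nat_mul, ← exp_neg]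
          congr 1
          field_simp
      _ ≤ (2 ^ a)⁻¹ := inv_anti₀ (by positivity)
          (pow_le_pow_left₀ (by norm_num) (by linarith [exp_one_gt_d9]) _)
      _ ≤ 1 / t := by
          rw [one_div]
          refine inv_anti₀ ht0 ?_
          exact_mod_cast (Nat.lt_pow_succ_log_self one_lt_two t).le
  have h2 : (2 * (t : ℝ) ^ 3 + 1) * ((2 : ℝ) ^ q)⁻¹ ≤ 3 / t := by
    rw [← div_eq_mul_inv, div_le_div_iff₀ (by positivity) ht0]
    have e1 : t ^ 4 ≤ 2 ^ q :=
      (Nat.pow_le_pow_left htq 4).trans (pow_four_le_two_pow (by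
        have := mul_le_level h
        have := (pos_of_mem_admissible h).1
        omega))
    have e2 : (2 * t ^ 3 + 1) * t ≤ 3 * 2 ^ q := by
      have : t ≤ t ^ 4 := Nat.le_self_pow (by norm_num) t
      calc (2 * t ^ 3 + 1) * t = 2 * t ^ 4 + t := by ring
        _ ≤ 3 * 2 ^ q := by omega
    exact_mod_cast e2
  have h3 : ((2 : ℝ) ^ q)⁻¹ ≤ 1 / t := by
    rw [one_div]
    refine inv_anti₀ ht0 ?_
    exact_mod_cast htq.trans Nat.lt_two_pow_self.le
  have h4 : ((2 : ℝ) ^ (5 * q))⁻¹ ≤ ((2 : ℝ) ^ q)⁻¹ :=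
    inv_anti₀ (by positivity) (pow_le_pow_right₀ (by norm_num) (by omega))
  have h5 : 1 / (t : ℝ) ≤ a / t := by
    gcongr
    exact_mod_cast Nat.succ_pos _
  have h6 : 3 / (t : ℝ) = 3 * (1 / t) := by ring
  linarith

theorem two_pow_inv_le (h : (N, Δ) ∈ admissible deltaBound) :
    5 * ((2 : ℝ) ^ level N)⁻¹ ≤ (((2 ^ (10 * level N) : ℕ)) : ℝ) ^ (-(1 / 40) : ℝ) := by
  have hq : 24 ≤ level N := by
    have := mul_le_level h
    have := (pos_of_mem_admissible h).1
    omega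
  have hq' : (24 : ℝ) ≤ level N := by exact_mod_cast hq
  push_cast
  rw [← rpow_natCast, ← rpow_natCast, ← rpow_neg (by norm_num), ← rpow_mul (by norm_num)]
  calc 5 * (2 : ℝ) ^ (-(level N : ℝ)) ≤ 2 ^ (3 : ℝ) * 2 ^ (-(level N : ℝ)) := by
        gcongr
        norm_num
    _ = 2 ^ (3 - level N : ℝ) := by rw [← rpow_add (by norm_num)]; congr 1
    _ ≤ _ := by
        refine rpow_le_rpow_of_exponent_le one_le_two ?_
        push_cast
        linarith

theorem logb_rpow_le (h : (N, Δ) ∈ admissible deltaBound) :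
    (logb 2 (N : ℝ)) ^ (1 / 40 : ℝ) ≤ ((2 ^ (10 * level N) : ℕ) : ℝ) := by
  have hL := loglog_pos_of_mem_admissible h
  have h1 := logb_pos_of_loglog_pos hL
  have h2 := loglog_le hL
  have hq : 24 ≤ level N := by
    have := mul_le_level h
    have := (pos_of_mem_admissible h).1
    omega
  have h3 : Nat.log 2 (Nat.log 2 N) + 1 ≤ 400 * level N := by
    have : Nat.log 2 (Nat.log 2 N) < 40 * (level N + 1) := Nat.lt_mul_div_succ _ (by norm_num)
    omega
  have h4 : loglog N ≤ 400 * level N := h2.trans (by exact_mod_cast h3)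
  rw [loglog, logb_le_iff_le_rpow one_lt_two (by linarith)] at h4
  refine (rpow_le_rpow (by linarith) h4 (by norm_num)).trans_eq ?_
  rw [← rpow_mul (by norm_num)]
  push_cast
  rw [← rpow_natCast]
  congr 1
  push_cast
  ring

theorem length_mul_copies_le (h : (N, Δ) ∈ admissible deltaBound) :
    (2 ^ (10 * level N) + 1) * copies N Δ ≤ N := by
  have hq : 24 ≤ level N := by
    have := mul_le_level h
    have := (pos_of_mem_admissible h).1
    omega
  refine le_trans ?_ (two_pow_two_pow_le (N := N) (by omega))
  calc (2 ^ (10 * level N) + 1) * copies N Δ ≤ 2 ^ (10 * level N + 1) * 2 ^ level N := by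
        refine Nat.mul_le_mul ?_ (copies_le_level.trans Nat.lt_two_pow_self.le)
        rw [pow_succ]
        have := Nat.one_le_two_pow (n := 10 * level N)
        omega
    _ = 2 ^ (11 * level N + 1) := by rw [← pow_add]; congr 1; ring
    _ ≤ 2 ^ 2 ^ (40 * level N) := Nat.pow_le_pow_right (by norm_num)
        ((show 11 * level N + 1 ≤ 40 * level N by omega).trans Nat.lt_two_pow_self.le)

end

end HardDist

open HardDist in
theorem theorem3p1 :
    ∃ δ C c : ℝ, 0 < δ ∧ 0 < C ∧ 0 < c ∧
      ∃ (n t d : ℕ → ℕ → ℕ)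
        (Iso Iso' : ∀ N Δ : ℕ, (Fin (n N Δ) → ZMod 2) → ZMod 2),
        (∀ N Δ : ℕ, (N, Δ) ∈ HardDist.admissible δ →
          0 < n N Δ ∧ 0 < t N Δ ∧ 0 < d N Δ ∧
          (n N Δ + 1) * t N Δ ≤ N ∧
          (Real.logb 2 (N : ℝ)) ^ c ≤ (n N Δ : ℝ) ∧
          Δ * (t N Δ + 1) ≤ d N Δ ∧
          HardDist.IsSuitableIsolator (d N Δ) (t N Δ) (C * HardDist.rate N Δ) (Iso N Δ) ∧
          (∀ X ∈ HardDist.polySources (t N Δ * n N Δ + t N Δ) Δ,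
            1 - C * HardDist.rate N Δ ≤
              HardDist.tvDist (HardDist.hardDist (t N Δ) (Iso N Δ)) X) ∧
          HardDist.IsSuitableIsolator (d N Δ) 1 (3 / 4 + (n N Δ : ℝ) ^ (-c)) (Iso' N Δ) ∧
          (∀ Y ∈ HardDist.polySources (1 * n N Δ + 1) Δ,
            1 / 4 - (n N Δ : ℝ) ^ (-c) ≤
              HardDist.tvDist (HardDist.hardDist 1 (Iso' N Δ)) Y)) ∧
        HardDist.PolyTimeSamplable (HardDist.admissible δ)
          (fun N Δ => HardDist.hardDist (t N Δ) (Iso N Δ)) ∧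
        HardDist.PolyTimeSamplable (HardDist.admissible δ)
          (fun N Δ => HardDist.hardDist 1 (Iso' N Δ)) := by
  refine ⟨deltaBound, 2240, 1 / 40, by norm_num [deltaBound], by norm_num, by norm_num,
    fun N _ => 2 ^ (10 * level N), copies, fun N _ => level N,
    fun N Δ => lookup (10 * level N) (table (level N) (densityNum N Δ) (copies N Δ)),
    fun N Δ => lookup (10 * level N) (table (level N) 1 2), fun N Δ h => ?_,
    polyTimeSamplable_table _ _ _ _ Feas.copies Feas.densityNum Feas.copies fun N Δ h => ?_,
    polyTimeSamplable_table _ (fun _ _ => 1) (fun _ _ => 1) (fun _ _ => 2) (Feas.const 1)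
      (Feas.const 1) (Feas.const 2) fun N Δ h => ?_⟩
  · have hΔ := (pos_of_mem_admissible h).1
    have hlevel := mul_le_level h
    have ht := twelve_le_copies h
    have hd := mul_copies_add_one_le h
    have hn : 10 * level N ≤ 2 ^ (10 * level N) := Nat.lt_two_pow_self.le
    have hinv := two_pow_inv_le h
    have h5 : ((2 : ℝ) ^ (5 * level N))⁻¹ ≤ ((2 : ℝ) ^ level N)⁻¹ :=
      inv_anti₀ (by positivity) (pow_le_pow_right₀ (by norm_num) (by omega))
    have h4 : ((2 : ℝ) ^ level N)⁻¹ ≤ 1 / 4 := by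
      rw [one_div]
      refine inv_anti₀ (by norm_num) ?_
      calc (4 : ℝ) = 2 ^ 2 := by norm_num
        _ ≤ 2 ^ level N := pow_le_pow_right₀ (by norm_num) (by omega)
    obtain ⟨T, hT, hgood⟩ := exists_isGood (q := level N) (num := densityNum N Δ)
      (den := copies N Δ) (by omega) (by omega) (two_mul_densityNum_le h)
    obtain ⟨T', hT', hgood'⟩ := exists_isGood (q := level N) (num := 1) (den := 2) (by omega)
      (by norm_num) le_rfl
    have hhalf : (densityNum N Δ / copies N Δ : ℝ) ≤ 1 / 2 := by
      rw [div_le_div_iff₀ (by exact_mod_cast (show 0 < copies N Δ by omega)) (by norm_num)]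
      have : ((2 * densityNum N Δ : ℕ) : ℝ) ≤ copies N Δ := by
        exact_mod_cast two_mul_densityNum_le h
      push_cast at this
      linarith
    obtain ⟨h1, h2⟩ := (isGood_table hT hgood).suitable_and_far (n := 2 ^ (10 * level N))
      (t := copies N Δ) (D := Δ) (by omega) (by omega) hn (by omega) hΔ hd (by linarith)
      (error_le h)
    obtain ⟨h1', h2'⟩ := (isGood_table hT' hgood').suitable_and_far (n := 2 ^ (10 * level N))
      (t := 1) (D := Δ) (η := 3 / 4 + ((2 ^ (10 * level N) : ℕ) : ℝ) ^ (-(1 / 40) : ℝ))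
      (by norm_num) (by omega) hn one_pos hΔ (by omega) (by push_cast; linarith)
      (by push_cast at hinv ⊢; linarith)
    refine ⟨by positivity, by omega, show 0 < level N by omega, length_mul_copies_le h,
      logb_rpow_le h, hd, h1, h2, h1', fun Y hY => le_trans (le_of_eq ?_) (h2' Y hY)⟩
    ring
  · refine le_trans ?_ (length_mul_copies_le h)
    rw [mul_comm]
    exact Nat.mul_le_mul_right _ (Nat.le_succ _)
  · refine le_trans ?_ (length_mul_copies_le h)
    have ht := twelve_le_copies h
    rw [mul_comm]
    exact Nat.mul_le_mul (Nat.le_succ _) (by omega)
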